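/- Let $k\ge 1$ be an integer and let $\Delta,\alpha>0$ be real numbers. A finite simple graph $G$ is called $(\alpha,\Delta)$-bounded if at least $\alpha\cdot|V(G)|$ of its vertices have degree at most $\Delta$. In the $k$-list-coloring problem one is given a graph $G$ and, for every vertex $v$, a set $C_v\subseteq U$ of at most $k$ colors, where $U$ is an arbitrary universe of colors, and has to decide whether there is a map $c:V(G)\to U$ with $c(v)\in C_v$ for every vertex $v$ and $c(u)\ne c(v)$ for every edge $uv$ of $G$. For all such $k,\Delta,\alpha$ there is a constant $\varepsilon=\varepsilon_{k,\Delta,\alpha}\in(0,2)$ and a deterministic algorithm that solves the $k$-list-coloring problem on all $(\alpha,\Delta)$-bounded graphs in time $O\left((2-\varepsilon)^n\right)$, where $n=|V(G)|$, regardless of the size of $U$. Here the algorithm is a single program for a word RAM whose word length $w$ may be any number $w\ge c\,(n+1)$, with a constant $c$; the usual arithmetic, bitwise and comparison operations on words and random access to memory cost one step each; distinct colors of the instance are named by distinct, otherwise arbitrary, $w$-bit words; and the time bound depends on $n$ only (not on $w$ or on $U$), with implied constant depending only on $k,\Delta,\alpha$. -/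

import Mathlib

open Filter Asymptotics

universe u

/-! ### The machine model: deterministic word RAM programs with a step count

A machine with word length `w` has registers `reg 0, reg 1, …`, each holding a `w`-bit word, and
memory banks `mem 0, mem 1, …`, each consisting of `2 ^ w` cells that hold a word and are addressed
by a word (random access).  A program is a fixed finite piece of structured code, so it names only
finitely many registers and banks; it does not depend on the input or on the word length. -/

namespace WordRAM

/-- The machine operations on words (unsigned, modulo `2 ^ w`). -/
inductive Op where
  | add | sub | mul | div | mod | and | or | xor | shl | shr | lt | eq

/-- The result of a machine operation; comparisons return `1` for true and `0` for false. -/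
def Op.apply {w : ℕ} : Op → BitVec w → BitVec w → BitVec w
  | .add, x, y => x + y
  | .sub, x, y => x - y
  | .mul, x, y => x * y
  | .div, x, y => x / y
  | .mod, x, y => x % y
  | .and, x, y => x &&& y
  | .or, x, y => x ||| y
  | .xor, x, y => x ^^^ y
  | .shl, x, y => x <<< y
  | .shr, x, y => x >>> y
  | .lt, x, y => if x < y then 1 else 0
  | .eq, x, y => if x = y then 1 else 0

/-- Expressions: constants, registers, memory reads and machine operations. -/
inductive Expr where
  | const (c : ℕ)
  | var (x : ℕ)
  | load (bank : ℕ) (addr : Expr)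
  | op (o : Op) (e₁ e₂ : Expr)

/-- Programs. `cond` and `loop` test whether an expression is nonzero. -/
inductive Prog where
  | skip
  | assign (x : ℕ) (e : Expr)
  | store (bank : ℕ) (addr e : Expr)
  | seq (p q : Prog)
  | cond (e : Expr) (p q : Prog)
  | loop (e : Expr) (p : Prog)

/-- The contents of the registers and of the memory banks. -/
structure State (w : ℕ) where
  reg : ℕ → BitVec w
  mem : ℕ → BitVec w → BitVec w

/-- The value of an expression. -/
def Expr.eval {w : ℕ} (σ : State w) : Expr → BitVec w
  | .const c => BitVec.ofNat w c
  | .var x => σ.reg x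
  | .load b a => σ.mem b (a.eval σ)
  | .op o e₁ e₂ => o.apply (e₁.eval σ) (e₂.eval σ)

/-- The number of steps needed to evaluate an expression: one for each constant, register read,
memory read and operation. -/
def Expr.cost : Expr → ℕ
  | .const _ => 1
  | .var _ => 1
  | .load _ a => a.cost + 1
  | .op _ e₁ e₂ => e₁.cost + e₂.cost + 1

/-- Write the word `v` to register `x`. -/
def State.setReg {w : ℕ} (σ : State w) (x : ℕ) (v : BitVec w) : State w :=
  { σ with reg := Function.update σ.reg x v }

/-- Write the word `v` to the cell with address `a` of memory bank `b`. -/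
def State.setMem {w : ℕ} (σ : State w) (b : ℕ) (a v : BitVec w) : State w :=
  { σ with mem := Function.update σ.mem b (Function.update (σ.mem b) a v) }

/-- `Runs p σ t τ`: started in state `σ`, the program `p` halts in state `τ` after exactly `t`
steps. -/
inductive Runs {w : ℕ} : Prog → State w → ℕ → State w → Prop
  | skip (σ : State w) : Runs .skip σ 1 σ
  | assign (x : ℕ) (e : Expr) (σ : State w) :
      Runs (.assign x e) σ (e.cost + 1) (σ.setReg x (e.eval σ))
  | store (b : ℕ) (a e : Expr) (σ : State w) :
      Runs (.store b a e) σ (a.cost + e.cost + 1) (σ.setMem b (a.eval σ) (e.eval σ))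
  | seq {p q : Prog} {σ τ ρ : State w} {s t : ℕ} :
      Runs p σ s τ → Runs q τ t ρ → Runs (.seq p q) σ (s + t) ρ
  | condTrue {e : Expr} {p q : Prog} {σ τ : State w} {t : ℕ} :
      e.eval σ ≠ 0 → Runs p σ t τ → Runs (.cond e p q) σ (e.cost + 1 + t) τ
  | condFalse {e : Expr} {p q : Prog} {σ τ : State w} {t : ℕ} :
      e.eval σ = 0 → Runs q σ t τ → Runs (.cond e p q) σ (e.cost + 1 + t) τ
  | loopDone {e : Expr} {p : Prog} {σ : State w} :
      e.eval σ = 0 → Runs (.loop e p) σ (e.cost + 1) σ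
  | loopStep {e : Expr} {p : Prog} {σ τ ρ : State w} {s t : ℕ} :
      e.eval σ ≠ 0 → Runs p σ s τ → Runs (.loop e p) τ t ρ →
        Runs (.loop e p) σ (e.cost + 1 + s + t) ρ

/-- The machine is deterministic: the number of steps and the final state are determined by the
program and the initial state. -/
theorem Runs.unique {w : ℕ} {p : Prog} {σ τ τ' : State w} {t t' : ℕ}
    (h : Runs p σ t τ) (h' : Runs p σ t' τ') : t = t' ∧ τ = τ' := by
  induction h generalizing t' τ' with
  | skip σ => cases h'; exact ⟨rfl, rfl⟩
  | assign x e σ => cases h'; exact ⟨rfl, rfl⟩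
  | store b a e σ => cases h'; exact ⟨rfl, rfl⟩
  | seq _ _ ih₁ ih₂ =>
    cases h' with
    | seq g₁ g₂ =>
      obtain ⟨rfl, rfl⟩ := ih₁ g₁
      obtain ⟨rfl, rfl⟩ := ih₂ g₂
      exact ⟨rfl, rfl⟩
  | condTrue he _ ih =>
    cases h' with
    | condTrue _ g => obtain ⟨rfl, rfl⟩ := ih g; exact ⟨rfl, rfl⟩
    | condFalse he' _ => exact absurd he' he
  | condFalse he _ ih =>
    cases h' with
    | condTrue he' _ => exact absurd he he'
    | condFalse _ g => obtain ⟨rfl, rfl⟩ := ih g; exact ⟨rfl, rfl⟩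
  | loopDone he =>
    cases h' with
    | loopDone _ => exact ⟨rfl, rfl⟩
    | loopStep he' _ _ => exact absurd he he'
  | loopStep he _ _ ih₁ ih₂ =>
    cases h' with
    | loopDone he' => exact absurd he' he
    | loopStep _ g₁ g₂ =>
      obtain ⟨rfl, rfl⟩ := ih₁ g₁
      obtain ⟨rfl, rfl⟩ := ih₂ g₂
      exact ⟨rfl, rfl⟩

end WordRAM

/-! ### Graphs and list coloring -/

open scoped Classical in
/-- `G` is `(α, Δ)`-bounded: at least `α * |V(G)|` of its vertices have degree at most `Δ`. -/
def IsAlphaDeltaBounded (α Δ : ℝ) {V : Type*} [Fintype V] (G : SimpleGraph V) : Prop :=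
  α * (Fintype.card V : ℝ) ≤
    ((Finset.univ.filter fun v : V => (G.degree v : ℝ) ≤ Δ).card : ℝ)

/-- There is a proper coloring of `G` that gives every vertex `v` a color from its set `C v`. -/
def IsListColorable {V U : Type*} (G : SimpleGraph V) (C : V → Finset U) : Prop :=
  ∃ c : V → U, (∀ v, c v ∈ C v) ∧ ∀ u v, G.Adj u v → c u ≠ c v

/-! ### List coloring as a computational problem -/

open scoped Classical in
/-- The initial state of the machine on an instance with vertices `0, …, n - 1`.
Register `0` holds `n`. Bank `0` holds the adjacency matrix (row by row). Cell `v` of bank `1`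
holds the number of colors listed for the vertex `v`, and the names of these colors are in the cells
`k * v, k * v + 1, …` of bank `2`. Everything else is `0`. -/
noncomputable def listColoringInput (k n w : ℕ) {U : Type*} (G : SimpleGraph (Fin n))
    (L : Fin n → List U) (name : U → BitVec w) : WordRAM.State w where
  reg x := if x = 0 then BitVec.ofNat w n else 0
  mem b a :=
    if b = 0 then
      if ∃ u v : Fin n, G.Adj u v ∧ a.toNat = n * u + v then 1 else 0
    else if b = 1 then
      if h : a.toNat < n then BitVec.ofNat w (L ⟨a.toNat, h⟩).length else 0
    else if b = 2 then
      if h : a.toNat / k < n then ((L ⟨a.toNat / k, h⟩).map name).getD (a.toNat % k) 0 else 0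
    else 0

/-- A single program decides `k`-list-coloring on `(α, Δ)`-bounded graphs with `n` vertices in at
most `T n` steps, for colors from any universe `U`.

The word length `w` may be any number that is at least `c * (n + 1)` for a constant `c`.  A color is
given by its name, which is a word; distinct colors that occur in the instance have distinct
names. The set `C v` is given as a list without repetitions, in any order.  The program accepts
if register `0` is nonzero in the end. -/
def ListColoringSolvableInTime (k : ℕ) (α Δ : ℝ) (T : ℕ → ℕ) : Prop :=
  ∃ (p : WordRAM.Prog) (c : ℕ), ∀ n w : ℕ, c * (n + 1) ≤ w →
    ∀ (U : Type u) (G : SimpleGraph (Fin n)) (C : Fin n → Finset U) (L : Fin n → List U)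
      (name : U → BitVec w),
      IsAlphaDeltaBounded α Δ G →
      (∀ v, (C v).card ≤ k) →
      (∀ v, (L v).Nodup ∧ ∀ x, x ∈ L v ↔ x ∈ C v) →
      Set.InjOn name {x | ∃ v, x ∈ C v} →
      ∃ (t : ℕ) (τ : WordRAM.State w),
        WordRAM.Runs p (listColoringInput k n w G L name) t τ ∧ t ≤ T n ∧
          (τ.reg 0 ≠ 0 ↔ IsListColorable G C)

/-! Let d = ⌊Δ⌋ and call a vertex low if its degree is at most d. Fix a coloring χ of a set H of
vertices. It extends to a list coloring iff χ is proper on H and P = V \ H is covered by stable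
sets, one for each color c inside the set W_c of vertices that list c and have no neighbor in H
colored c. Covers suffice, since a vertex in several classes may pick one of them. By
inclusion–exclusion the number of covers is, up to sign, ∑_{S ⊆ P} (-1)^|S| ∏_c i(S ∩ W_c), where i
counts stable subsets (`sum_neg_one_pow_mul_prod_stableCount`).

To beat 2^n, take a set A ⊆ P of low vertices whose closed neighborhoods are disjoint within P. If v
∈ A is outside S and has no neighbor in S, adding v multiplies the summand by -2^r, where r is the
number of colors left to v. The two summands merge into one with weight 1 - 2^r, and only the sets
in which no element of A is isolated remain (`sum_powerset_eq_sum_trimmed`). Each element of A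
reduces their number by a factor of at most 1 - 2^-(d+1) (`card_trimmed_le`). On this trimmed family
i is tabulated by i(S ∪ {u}) = i(S) + i(S \ N(u)); a set outside it is reduced to a member by
deleting isolated elements of A, each of which accounts for a factor 2.

All colorings of H are tried, at most k^|H| of them, so H must be small compared with A. Let H
consist of the vertices with at least D low neighbors. A maximal A then satisfies |A| ≥ αn /
((d+1)D) (`card_low_le`), so the gain is exponential in n/D, and it outweighs the cost of H once |H|
≤ n/(DM) for a large constant M (`mul_pow_le_of_trimmed`). For a single D, double counting gives
only |H| ≤ dn/D. But a vertex with x low neighbors is charged at most 2x in total over the scales D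
= (d+1)2^j, so one of any 2dM+1 consecutive scales is good enough (`exists_card_heavy_le`).

A word stores a set of vertices, and the sums are computed in the ring of words, modulo 2^w. There
are at most 2^(kn) < 2^w covers, so the residue of their number decides whether one exists
(`sum_term_ne_zero`). The size of U never enters, because each color is treated at the first vertex
that lists it (`prod_first`). -/

namespace WordRAM

infixl:65 " +ᵣ " => Expr.op Op.add
infixl:65 " -ᵣ " => Expr.op Op.sub
infixl:70 " *ᵣ " => Expr.op Op.mul
infixl:70 " /ᵣ " => Expr.op Op.div
infixl:70 " %ᵣ " => Expr.op Op.mod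
infixl:60 " &ᵣ " => Expr.op Op.and
infixl:55 " |ᵣ " => Expr.op Op.or
infixl:58 " ^ᵣ " => Expr.op Op.xor
infixl:75 " <<ᵣ " => Expr.op Op.shl
infixl:75 " >>ᵣ " => Expr.op Op.shr
infix:50 " <ᵣ " => Expr.op Op.lt
infix:50 " =ᵣ " => Expr.op Op.eq
prefix:max "♯" => Expr.var
prefix:max "♭" => Expr.const
infix:40 " ::= " => Prog.assign
infixr:30 " ;; " => Prog.seq

variable {w : ℕ}

/-! ### Total correctness with a bound on the number of steps -/

/-- Started in `σ`, the program `p` halts within `T` steps in a state that satisfies `Q`. -/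
def WP (p : Prog) (T : ℕ) (Q : State w → Prop) (σ : State w) : Prop :=
  ∃ t τ, Runs p σ t τ ∧ t ≤ T ∧ Q τ

theorem WP.mono {p : Prog} {T T' : ℕ} {Q Q' : State w → Prop} {σ : State w}
    (h : WP p T Q σ) (hT : T ≤ T') (hQ : ∀ τ, Q τ → Q' τ) : WP p T' Q' σ := by
  obtain ⟨t, τ, hr, ht, hq⟩ := h
  exact ⟨t, τ, hr, ht.trans hT, hQ _ hq⟩

theorem WP.skip {Q : State w → Prop} {σ : State w} (h : Q σ) : WP .skip 1 Q σ :=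
  ⟨_, _, .skip σ, le_rfl, h⟩

theorem WP.assign {x : ℕ} {e : Expr} {Q : State w → Prop} {σ : State w}
    (h : Q (σ.setReg x (e.eval σ))) : WP (x ::= e) (e.cost + 1) Q σ :=
  ⟨_, _, .assign x e σ, le_rfl, h⟩

theorem WP.store {b : ℕ} {a e : Expr} {Q : State w → Prop} {σ : State w}
    (h : Q (σ.setMem b (a.eval σ) (e.eval σ))) : WP (.store b a e) (a.cost + e.cost + 1) Q σ :=
  ⟨_, _, .store b a e σ, le_rfl, h⟩

theorem WP.seq {p q : Prog} {T₁ T₂ : ℕ} {Q : State w → Prop} {σ : State w}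
    (h : WP p T₁ (fun τ => WP q T₂ Q τ) σ) : WP (p ;; q) (T₁ + T₂) Q σ := by
  obtain ⟨t, τ, hr, ht, t', τ', hr', ht', hq⟩ := h
  exact ⟨_, _, .seq hr hr', add_le_add ht ht', hq⟩

theorem WP.cond {e : Expr} {p q : Prog} {T₁ T₂ : ℕ} {Q : State w → Prop} {σ : State w}
    (h₁ : e.eval σ ≠ 0#w → WP p T₁ Q σ) (h₂ : e.eval σ = 0#w → WP q T₂ Q σ) :
    WP (.cond e p q) (e.cost + 1 + (T₁ + T₂)) Q σ := by
  by_cases he : e.eval σ = 0#w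
  · obtain ⟨t, τ, hr, ht, hq⟩ := h₂ he
    exact ⟨_, _, .condFalse he hr, by omega, hq⟩
  · obtain ⟨t, τ, hr, ht, hq⟩ := h₁ he
    exact ⟨_, _, .condTrue he hr, by omega, hq⟩

/-- Run `body` for the values `0, 1, …` of register `i` below `b`. -/
def forLoop (i : ℕ) (b : Expr) (body : Prog) : Prog :=
  i ::= ♭0 ;; .loop (♯i <ᵣ b) (body ;; i ::= ♯i +ᵣ ♭1)

@[simp] theorem State.setReg_reg (σ : State w) (x y : ℕ) (v : BitVec w) :
    (σ.setReg x v).reg y = if y = x then v else σ.reg y := by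
  simp [State.setReg, Function.update_apply]

@[simp] theorem State.setReg_mem (σ : State w) (x : ℕ) (v : BitVec w) :
    (σ.setReg x v).mem = σ.mem := rfl

@[simp] theorem State.setMem_reg (σ : State w) (b : ℕ) (a v : BitVec w) :
    (σ.setMem b a v).reg = σ.reg := rfl

theorem State.setMem_mem (σ : State w) (b b' : ℕ) (a a' v : BitVec w) :
    (σ.setMem b a v).mem b' a' = if b' = b ∧ a' = a then v else σ.mem b' a' := by
  by_cases hb : b' = b
  · subst hb; simp [State.setMem, Function.update_apply]
  · simp [State.setMem, hb]

theorem State.setMem_mem_ne (σ : State w) {b b' : ℕ} (h : b' ≠ b) (a v : BitVec w) :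
    (σ.setMem b a v).mem b' = σ.mem b' := by
  simp [State.setMem, h]

theorem ofNat_lt_ofNat {a b : ℕ} (ha : a < 2 ^ w) (hb : b < 2 ^ w) :
    BitVec.ofNat w a < BitVec.ofNat w b ↔ a < b := by
  simp [BitVec.lt_def, Nat.mod_eq_of_lt ha, Nat.mod_eq_of_lt hb]

theorem ofNat_inj {a b : ℕ} (ha : a < 2 ^ w) (hb : b < 2 ^ w) :
    BitVec.ofNat w a = BitVec.ofNat w b ↔ a = b := by
  simp [← BitVec.toNat_inj, Nat.mod_eq_of_lt ha, Nat.mod_eq_of_lt hb]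

theorem one_ne_zero_of_pos (hw : 0 < w) : 1#w ≠ 0#w := by
  intro h
  have := congrArg BitVec.toNat h
  simp [hw.ne'] at this

/-- Induction on the number of remaining rounds. A round costs `b.cost + 3` for the test, `T` for
the body and 4 for the increment; the initial assignment and the last test add `b.cost + 5`. The
bound `N < 2 ^ w` keeps the counter from wrapping around, and `0 < w` is needed because for `w = 0`
the truth value 1 equals 0. -/
theorem WP.forLoop {i : ℕ} {b : Expr} {body : Prog} {Q : State w → Prop} {σ : State w}
    (Inv : ℕ → State w → Prop) (N T : ℕ) (hN : N < 2 ^ w) (hw : 0 < w)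
    (hb : ∀ m ≤ N, ∀ τ, Inv m τ → τ.reg i = BitVec.ofNat w m → b.eval τ = BitVec.ofNat w N)
    (h0 : Inv 0 (σ.setReg i 0))
    (hstep : ∀ m < N, ∀ τ, Inv m τ → τ.reg i = BitVec.ofNat w m →
      WP body T (fun τ' => τ'.reg i = BitVec.ofNat w m ∧
        Inv (m + 1) (τ'.setReg i (BitVec.ofNat w (m + 1)))) τ)
    (hQ : ∀ τ, Inv N τ → τ.reg i = BitVec.ofNat w N → Q τ) :
    WP (forLoop i b body) (N * (T + b.cost + 7) + b.cost + 5) Q σ := by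
  have main : ∀ d m τ, m + d = N → Inv m τ → τ.reg i = BitVec.ofNat w m →
      WP (.loop (♯i <ᵣ b) (body ;; i ::= ♯i +ᵣ ♭1)) (d * (T + b.cost + 7) + b.cost + 3) Q τ := by
    intro d
    induction d with
    | zero =>
      intro m τ hm hI hi
      have hm : m = N := by omega
      subst hm
      refine ⟨_, τ, .loopDone ?_, ?_, hQ τ hI hi⟩
      · simp [Expr.eval, Op.apply, hb m le_rfl τ hI hi, hi]
      · simp [Expr.cost]; omega
    | succ d ih =>
      intro m τ hm hI hi
      obtain ⟨t, τ₁, hr, ht, hi₁, hI₁⟩ := hstep m (by omega) τ hI hi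
      obtain ⟨t', τ₂, hr', ht', hq⟩ := ih (m + 1) _ (by omega) hI₁ (by simp)
      refine ⟨_, τ₂, .loopStep ?_ (.seq hr (.assign _ _ _)) (?_ : Runs _ _ t' _), ?_, hq⟩
      · have : BitVec.ofNat w m < BitVec.ofNat w N :=
          (ofNat_lt_ofNat (by omega) hN).2 (by omega)
        simp only [Expr.eval, Op.apply, hb m (by omega) τ hI hi, hi, this, if_true]
        exact one_ne_zero_of_pos hw
      · have : Expr.eval τ₁ (♯i +ᵣ ♭1) = BitVec.ofNat w (m + 1) := by
          simp [Expr.eval, Op.apply, hi₁, BitVec.ofNat_add]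
        rw [this]; exact hr'
      · simp only [Expr.cost]; rw [Nat.succ_mul]; omega
  obtain ⟨t, τ, hr, ht, hq⟩ := main N 0 _ (by omega) h0 (by simp)
  refine ⟨_, τ, .seq (.assign _ _ _) (by simpa [Expr.eval] using hr), ?_, hq⟩
  simp only [Expr.cost]; omega

/-- The states `σ` and `τ` agree in the registers below `b` and in the whole memory. -/
def Frame (b : ℕ) (σ τ : State w) : Prop :=
  (∀ x < b, τ.reg x = σ.reg x) ∧ τ.mem = σ.mem

theorem Frame.refl (b : ℕ) (σ : State w) : Frame b σ σ := ⟨fun _ _ => rfl, rfl⟩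

theorem Frame.trans {b : ℕ} {σ τ ρ : State w} (h : Frame b σ τ) (h' : Frame b τ ρ) :
    Frame b σ ρ :=
  ⟨fun x hx => (h'.1 x hx).trans (h.1 x hx), h'.2.trans h.2⟩

theorem Frame.mono {b b' : ℕ} {σ τ : State w} (h : Frame b σ τ) (hb : b' ≤ b) : Frame b' σ τ :=
  ⟨fun x hx => h.1 x (by omega), h.2⟩

theorem Frame.setReg {b x : ℕ} {σ τ : State w} (h : Frame b σ τ) (hx : b ≤ x) (v : BitVec w) :
    Frame b σ (τ.setReg x v) :=
  ⟨fun y hy => by simp [show y ≠ x by omega, h.1 y hy], h.2⟩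

/-! ### Sets of numbers as words -/

/-- The word whose `i`-th bit tells whether `i ∈ S`. -/
def enc (w : ℕ) (S : Finset ℕ) : BitVec w := BitVec.ofFnLE fun i : Fin w => decide (i.1 ∈ S)

theorem getElem_enc (S : Finset ℕ) (i : ℕ) (hi : i < w) : (enc w S)[i] = decide (i ∈ S) := by
  simp [enc]

theorem enc_empty : enc w ∅ = 0#w := by
  ext i hi; simp [getElem_enc]

theorem enc_inter (S T : Finset ℕ) : enc w S &&& enc w T = enc w (S ∩ T) := by
  ext i hi; simp [getElem_enc]

theorem enc_union (S T : Finset ℕ) : enc w S ||| enc w T = enc w (S ∪ T) := by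
  ext i hi; simp [getElem_enc]

/-- The machine has no complement instruction, so set differences are always formed in this way. -/
theorem enc_sdiff (S T : Finset ℕ) : enc w S ^^^ (enc w S &&& enc w T) = enc w (S \ T) := by
  ext i hi; by_cases h : i ∈ S <;> by_cases h' : i ∈ T <;> simp [getElem_enc, h, h']

theorem enc_inj {S T : Finset ℕ} (hS : S ⊆ Finset.range w) (hT : T ⊆ Finset.range w) :
    enc w S = enc w T ↔ S = T := by
  refine ⟨fun h => ?_, fun h => by rw [h]⟩
  ext i
  by_cases hi : i < w
  · have : (enc w S)[i] = (enc w T)[i] := by rw [h]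
    simpa [getElem_enc] using this
  · constructor <;> intro h'
    · exact absurd (Finset.mem_range.1 (hS h')) hi
    · exact absurd (Finset.mem_range.1 (hT h')) hi

theorem enc_eq_zero {S : Finset ℕ} (hS : S ⊆ Finset.range w) : enc w S = 0#w ↔ S = ∅ := by
  rw [← enc_empty, enc_inj hS (by simp)]

theorem shl_eq (x : BitVec w) {v : ℕ} (hv : v < 2 ^ w) :
    x <<< BitVec.ofNat w v = x <<< v := by
  simp [BitVec.shiftLeft_eq', Nat.mod_eq_of_lt hv]

theorem shr_eq (x : BitVec w) {v : ℕ} (hv : v < 2 ^ w) :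
    x >>> BitVec.ofNat w v = x >>> v := by
  simp [BitVec.ushiftRight_eq', Nat.mod_eq_of_lt hv]

theorem bit_eq {v : ℕ} (hv : v < w) : 1#w <<< BitVec.ofNat w v = enc w {v} := by
  rw [shl_eq _ (hv.trans Nat.lt_two_pow_self)]
  ext i hi
  simp [getElem_enc]
  rw [Bool.eq_iff_iff]
  simp
  omega

theorem bit_test (S : Finset ℕ) {v : ℕ} (hv : v < w) :
    (enc w S >>> BitVec.ofNat w v) &&& 1#w = if v ∈ S then 1#w else 0#w := by
  rw [shr_eq _ (hv.trans Nat.lt_two_pow_self)]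
  have : (if v ∈ S then 1#w else 0#w) = if (enc w S).getLsbD v then 1#w else 0#w := by
    rw [BitVec.getLsbD_eq_getElem hv, getElem_enc]; simp
  rw [this]
  ext i hi
  by_cases h0 : i = 0
  · subst h0; simp; cases (enc w S).getLsbD v <;> simp
  · have : (1#w)[i] = false := by simp [h0]
    simp only [BitVec.getElem_and, this, Bool.and_false]
    split <;> simp [h0]

/-- The carry runs through all `v` ones. In the induction the top bit is split off, the lower bits
plus one give 2^v, and 2^v + 2^v = 2^(v+1). The purpose is to obtain initial segments as `(1 << v) -
1`. -/
theorem enc_range_add_one {v : ℕ} (hv : v < w) :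
    enc w (Finset.range v) + 1#w = enc w {v} := by
  induction v with
  | zero => rw [Finset.range_zero, enc_empty, ← bit_eq hv]; simp
  | succ v ih =>
    have h1 : enc w (Finset.range (v + 1)) = enc w (Finset.range v) + enc w {v} := by
      rw [BitVec.add_eq_or_of_and_eq_zero, enc_union]
      · congr 1; ext; simp; omega
      · rw [enc_inter, enc_eq_zero] <;> simp
    rw [h1, add_right_comm, ih (by omega), ← bit_eq (by omega), ← bit_eq hv,
      shl_eq _ (by have := @Nat.lt_two_pow_self w; omega),
      shl_eq _ (by have := @Nat.lt_two_pow_self w; omega), BitVec.shiftLeft_add,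
      ← BitVec.toNat_inj]
    simp [BitVec.toNat_add, Nat.shiftLeft_eq, mul_two]

theorem enc_range {v : ℕ} (hv : v < w) :
    enc w (Finset.range v) = enc w {v} - 1#w := by
  rw [← enc_range_add_one hv]; simp

end WordRAM

section

/-! ### Stable sets, trimmed families and inclusion–exclusion -/

open Finset

/-- `S` is a stable set of the graph with neighborhoods `N`. -/
def IsStable (N : ℕ → Finset ℕ) (S : Finset ℕ) : Prop := ∀ u ∈ S, ∀ v ∈ S, v ∉ N u

open scoped Classical in
/-- The stable subsets of `S`. -/
noncomputable def stableSubsets (N : ℕ → Finset ℕ) (S : Finset ℕ) : Finset (Finset ℕ) :=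
  S.powerset.filter (IsStable N)

/-- The number of stable subsets of `S`. -/
noncomputable def stableCount (N : ℕ → Finset ℕ) (S : Finset ℕ) : ℕ := (stableSubsets N S).card

/-- The subsets of `P` in which no element of `A` is isolated. -/
def trimmed (N : ℕ → Finset ℕ) (A P : Finset ℕ) : Finset (Finset ℕ) :=
  P.powerset.filter fun S => ∀ v ∈ A, v ∈ S → (S ∩ N v).Nonempty

theorem mem_stableSubsets {N : ℕ → Finset ℕ} {S I : Finset ℕ} :
    I ∈ stableSubsets N S ↔ I ⊆ S ∧ IsStable N I := by
  simp [stableSubsets]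

theorem mem_trimmed {N : ℕ → Finset ℕ} {A P S : Finset ℕ} :
    S ∈ trimmed N A P ↔ S ⊆ P ∧ ∀ v ∈ A, v ∈ S → (S ∩ N v).Nonempty := by
  simp [trimmed]

theorem stableCount_empty (N : ℕ → Finset ℕ) : stableCount N ∅ = 1 := by
  have : stableSubsets N ∅ = {∅} := by
    ext I
    simp only [mem_stableSubsets, subset_empty, mem_singleton]
    exact ⟨fun h => h.1, by rintro rfl; exact ⟨rfl, by simp [IsStable]⟩⟩
  simp [stableCount, this]

/-- The neighborhoods of a simple graph. -/
structure IsNbhd (N : ℕ → Finset ℕ) : Prop where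
  symm : ∀ {u v}, u ∈ N v → v ∈ N u
  irrefl : ∀ v, v ∉ N v

theorem IsNbhd.stable_insert {N : ℕ → Finset ℕ} (hN : IsNbhd N) {u : ℕ} {I : Finset ℕ} :
    IsStable N (insert u I) ↔ IsStable N I ∧ Disjoint I (N u) := by
  constructor
  · intro h
    refine ⟨fun a ha b hb => h a (mem_insert_of_mem ha) b (mem_insert_of_mem hb), ?_⟩
    rw [disjoint_left]
    exact fun a ha => h u (mem_insert_self _ _) a (mem_insert_of_mem ha)
  · rintro ⟨h, hd⟩ a ha b hb
    rw [disjoint_left] at hd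
    rcases mem_insert.1 ha with rfl | ha'
    · rcases mem_insert.1 hb with rfl | hb'
      · exact hN.irrefl _
      · exact hd hb'
    · rcases mem_insert.1 hb with rfl | hb'
      · exact fun h' => hd ha' (hN.symm h')
      · exact h a ha' b hb'

/-- Split by membership of `u`: a stable set that contains `u` is `u` together with a stable set
that avoids `N u`. This recursion fills the table of stable set counts. -/
theorem IsNbhd.stableCount_insert {N : ℕ → Finset ℕ} (hN : IsNbhd N) {u : ℕ} {S : Finset ℕ}
    (hu : u ∉ S) :
    stableCount N (insert u S) = stableCount N S + stableCount N (S \ N u) := by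
  have h1 : stableSubsets N (insert u S) =
      stableSubsets N S ∪ (stableSubsets N (S \ N u)).image (insert u) := by
    ext I
    simp only [mem_union, mem_image, mem_stableSubsets]
    constructor
    · rintro ⟨hI, hs⟩
      by_cases huI : u ∈ I
      · refine Or.inr ⟨I.erase u, ?_, insert_erase huI⟩
        rw [← insert_erase huI, hN.stable_insert] at hs
        refine ⟨fun x hx => Finset.mem_sdiff.2 ⟨?_, disjoint_left.1 hs.2 hx⟩, hs.1⟩
        have := hI (mem_of_mem_erase hx)
        exact (mem_insert.1 this).resolve_left (ne_of_mem_erase hx)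
      · exact Or.inl ⟨(subset_insert_iff_of_notMem huI).1 hI, hs⟩
    · rintro (⟨hI, hs⟩ | ⟨J, ⟨hJ, hs⟩, rfl⟩)
      · exact ⟨hI.trans (subset_insert _ _), hs⟩
      · refine ⟨insert_subset_insert _ (hJ.trans sdiff_subset), hN.stable_insert.2 ⟨hs, ?_⟩⟩
        exact disjoint_left.2 fun x hx => (Finset.mem_sdiff.1 (hJ hx)).2
  rw [stableCount, h1, card_union_of_disjoint, card_image_of_injOn]
  · rfl
  · intro I hI J hJ h
    have hI : u ∉ I := fun h => hu (sdiff_subset ((mem_stableSubsets.1 hI).1 h))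
    have hJ : u ∉ J := fun h => hu (sdiff_subset ((mem_stableSubsets.1 hJ).1 h))
    rw [← erase_insert hI, ← erase_insert hJ]
    exact congrArg (fun X => erase X u) h
  · rw [disjoint_left]
    intro I hI hI'
    obtain ⟨J, _, rfl⟩ := mem_image.1 hI'
    exact hu ((mem_stableSubsets.1 hI).1 (mem_insert_self _ _))

theorem IsNbhd.stableCount_insert_isolated {N : ℕ → Finset ℕ} (hN : IsNbhd N) {u : ℕ}
    {S : Finset ℕ} (hu : u ∉ S) (h : S ∩ N u = ∅) :
    stableCount N (insert u S) = 2 * stableCount N S := by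
  rw [hN.stableCount_insert hu, sdiff_eq_self_of_disjoint (disjoint_iff_inter_eq_empty.2 h),
    two_mul]

theorem trimmed_insert {N : ℕ → Finset ℕ} {A P : Finset ℕ} {a : ℕ} :
    trimmed N (insert a A) P = (trimmed N A P).filter fun S => a ∈ S → (S ∩ N a).Nonempty := by
  ext S
  simp only [mem_trimmed, mem_filter, forall_mem_insert]
  tauto

/-- The elements of `A` are treated one at a time. A set in which `a` is isolated is merged into the
same set without `a`, which multiplies the summand there by `1 - g a`. As `A` is stable, `a` is not
a neighbor of any other element of `A`, so neither their trimming conditions nor their weights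
notice whether `a` is present. -/
theorem sum_powerset_eq_sum_trimmed {R : Type*} [CommRing R] {N : ℕ → Finset ℕ} (hN : IsNbhd N)
    {A P : Finset ℕ} (hAP : A ⊆ P) (hA : IsStable N A) (f : Finset ℕ → R) (g : ℕ → R)
    (hf : ∀ S ⊆ P, ∀ v ∈ A, v ∉ S → S ∩ N v = ∅ → f (insert v S) = -g v * f S) :
    ∑ S ∈ P.powerset, f S = ∑ S ∈ trimmed N A P,
      f S * ∏ v ∈ A, if v ∉ S ∧ S ∩ N v = ∅ then 1 - g v else 1 := by
  induction A using Finset.induction_on with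
  | empty => simp [trimmed]
  | insert a A ha ih =>
    rw [ih (fun x hx => hAP (mem_insert_of_mem hx)) (hN.stable_insert.1 hA).1
      fun S hS v hv => hf S hS v (mem_insert_of_mem hv)]
    have haP : a ∈ P := hAP (mem_insert_self _ _)
    have hd : ∀ v ∈ A, a ∉ N v := fun v hv => hA v (mem_insert_of_mem hv) a (mem_insert_self _ _)
    set F : Finset ℕ → R := fun S => ∏ v ∈ A, if v ∉ S ∧ S ∩ N v = ∅ then 1 - g v else 1 with hF
    have hFi : ∀ S, F (insert a S) = F S := by
      intro S
      refine prod_congr rfl fun v hv => ?_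
      have h1 : v ≠ a := fun h => ha (h ▸ hv)
      rw [insert_inter_of_notMem (hd v hv)]
      simp [h1]
    rw [trimmed_insert, ← sum_filter_add_sum_filter_not (trimmed N A P)
      (fun S => a ∈ S → (S ∩ N a).Nonempty)]
    -- The discarded sets, in which `a` is isolated, correspond via `S ↦ S.erase a` to the retained
    -- sets that have neither `a` nor a neighbor of `a`.
    have hbad : ∑ S ∈ (trimmed N A P).filter (fun S => ¬(a ∈ S → (S ∩ N a).Nonempty)), f S * F S =
        ∑ S ∈ ((trimmed N A P).filter fun S => a ∈ S → (S ∩ N a).Nonempty).filter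
          (fun S => a ∉ S ∧ S ∩ N a = ∅), -g a * (f S * F S) := by
      refine sum_bij' (fun S _ => S.erase a) (fun S _ => insert a S) ?_ ?_ ?_ ?_ ?_
      · intro S hS
        simp only [mem_filter, mem_trimmed, Classical.not_imp, not_nonempty_iff_eq_empty] at hS ⊢
        obtain ⟨⟨h1, h2⟩, h3, h4⟩ := hS
        have h5 : S.erase a ∩ N a = ∅ := by
          rw [erase_inter, h4]; simp
        refine ⟨⟨⟨(erase_subset _ _).trans h1, fun v hv hvS => ?_⟩, by simp⟩, by simp, h5⟩
        rw [erase_inter, erase_eq_of_notMem (by simp [hd v hv])]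
        exact h2 v hv (mem_of_mem_erase hvS)
      · intro S hS
        simp only [mem_filter, mem_trimmed, Classical.not_imp, not_nonempty_iff_eq_empty] at hS ⊢
        obtain ⟨⟨⟨h1, h2⟩, _⟩, h3, h4⟩ := hS
        refine ⟨⟨insert_subset haP h1, fun v hv hvS => ?_⟩, mem_insert_self _ _, ?_⟩
        · rw [insert_inter_of_notMem (hd v hv)]
          exact h2 v hv ((mem_insert.1 hvS).resolve_left fun h => ha (h ▸ hv))
        · rw [insert_inter_of_notMem (hN.irrefl a), h4]
      · intro S hS
        simp only [mem_filter, Classical.not_imp] at hS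
        exact insert_erase hS.2.1
      · intro S hS
        simp only [mem_filter] at hS
        exact erase_insert hS.2.1
      · intro S hS
        simp only [mem_filter, mem_trimmed, Classical.not_imp, not_nonempty_iff_eq_empty] at hS
        obtain ⟨⟨h1, h2⟩, h3, h4⟩ := hS
        have h5 : S.erase a ∩ N a = ∅ := by
          rw [erase_inter, h4]; simp
        have := hf (S.erase a) ((erase_subset _ _).trans h1) a (mem_insert_self _ _) (by simp) h5
        have h6 := hFi (S.erase a)
        rw [insert_erase h3] at this h6
        rw [this, h6, mul_assoc]
    rw [hbad, sum_filter (fun S => a ∉ S ∧ S ∩ N a = ∅), ← sum_add_distrib]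
    refine sum_congr rfl fun S _ => ?_
    rw [prod_insert ha]
    change _ = f S * ((if a ∉ S ∧ S ∩ N a = ∅ then 1 - g a else 1) * F S)
    split_ifs <;> ring

theorem sum_neg_one_pow_card_Icc {R : Type*} [CommRing R] {U P : Finset ℕ} (h : U ⊆ P) :
    ∑ S ∈ P.powerset with U ⊆ S, (-1 : R) ^ S.card = if U = P then (-1) ^ P.card else 0 := by
  have h1 : ∑ S ∈ P.powerset with U ⊆ S, (-1 : R) ^ S.card =
      ∑ T ∈ (P \ U).powerset, (-1 : R) ^ U.card * (-1) ^ T.card := by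
    refine sum_bij' (fun S _ => S \ U) (fun T _ => T ∪ U) ?_ ?_ ?_ ?_ ?_
    · intro S hS
      simp only [mem_filter, mem_powerset] at hS ⊢
      exact sdiff_subset_sdiff hS.1 le_rfl
    · intro T hT
      simp only [mem_filter, mem_powerset] at hT ⊢
      exact ⟨union_subset (hT.trans sdiff_subset) h, subset_union_right⟩
    · intro S hS
      simp only [mem_filter] at hS
      exact sdiff_union_of_subset hS.2
    · intro T hT
      rw [mem_powerset] at hT
      rw [union_sdiff_right, sdiff_eq_self_of_disjoint]
      exact disjoint_of_subset_left hT sdiff_disjoint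
    · intro S hS
      simp only [mem_filter] at hS
      rw [← pow_add, add_comm, card_sdiff_add_card_eq_card hS.2]
  rw [h1, ← mul_sum]
  split_ifs with hU
  · subst hU; simp
  · have : (∑ T ∈ (P \ U).powerset, (-1 : ℤ) ^ T.card) = 0 :=
      sum_powerset_neg_one_pow_card_of_nonempty
        (sdiff_nonempty.2 fun h' => hU (subset_antisymm h h'))
    have := congrArg (Int.cast : ℤ → R) this
    push_cast at this
    rw [this, mul_zero]

open scoped Classical in
/-- The covers of `P` by stable sets, one contained in `W c` for each `c ∈ C`. -/
noncomputable def stableCovers {κ : Type*} (N : ℕ → Finset ℕ) (C : Finset κ)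
    (W : κ → Finset ℕ) (P : Finset ℕ) : Finset ((c : κ) → c ∈ C → Finset ℕ) :=
  (C.pi fun c => stableSubsets N (P ∩ W c)).filter fun F =>
    C.attach.biUnion (fun c => F c.1 c.2) = P

/-- The product counts the families of stable sets whose union lies in `S`. After exchanging the
sums, a family contributes the alternating sum over all `S` between its union and `P`, which
vanishes unless the union is all of `P`. -/
theorem sum_neg_one_pow_mul_prod_stableCount {κ R : Type*} [CommRing R]
    (N : ℕ → Finset ℕ) (C : Finset κ) (W : κ → Finset ℕ) (P : Finset ℕ) :
    ∑ S ∈ P.powerset, (-1 : R) ^ S.card * ∏ c ∈ C, (stableCount N (S ∩ W c) : R) =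
      (-1) ^ P.card * (stableCovers N C W P).card := by
  classical
  have h1 : ∀ S ∈ P.powerset, ∏ c ∈ C, (stableCount N (S ∩ W c) : R) =
      ∑ F ∈ C.pi fun c => stableSubsets N (P ∩ W c),
        if C.attach.biUnion (fun c => F c.1 c.2) ⊆ S then 1 else 0 := by
    intro S hS
    rw [mem_powerset] at hS
    rw [← sum_filter, sum_const, nsmul_one, ← Nat.cast_prod]
    congr 1
    simp only [stableCount]
    rw [← card_pi]
    congr 1
    ext F
    simp only [Finset.mem_pi, mem_filter, mem_stableSubsets, biUnion_subset, mem_attach, true_imp_iff,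
      Subtype.forall, subset_inter_iff]
    constructor
    · intro h
      exact ⟨fun c hc => ⟨⟨(h c hc).1.1.trans hS, (h c hc).1.2⟩, (h c hc).2⟩,
        fun c hc => (h c hc).1.1⟩
    · rintro ⟨h, h'⟩ c hc
      exact ⟨⟨h' c hc, (h c hc).1.2⟩, (h c hc).2⟩
  rw [sum_congr rfl fun S hS => by rw [h1 S hS, mul_sum], sum_comm, stableCovers, card_filter,
    Nat.cast_sum, mul_sum]
  refine sum_congr rfl fun F hF => ?_
  simp only [mul_ite, mul_one, mul_zero]
  rw [← sum_filter, sum_neg_one_pow_card_Icc]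
  · split_ifs <;> simp
  · simp only [Finset.mem_pi, mem_stableSubsets, subset_inter_iff] at hF
    simp only [biUnion_subset, mem_attach, true_imp_iff, Subtype.forall]
    exact fun c hc => (hF c hc).1.1

/-- From a cover, give each vertex any color whose class contains it; subsets of stable sets are
stable, so overlaps do no harm. Conversely, color classes form a cover. `Nonempty κ` only serves to
define the coloring outside `P`. -/
theorem stableCovers_nonempty {κ : Type*} [Nonempty κ] {N : ℕ → Finset ℕ} {C : Finset κ}
    {W : κ → Finset ℕ} {P : Finset ℕ} :
    (stableCovers N C W P).Nonempty ↔
      ∃ f : ℕ → κ, (∀ v ∈ P, f v ∈ C ∧ v ∈ W (f v)) ∧ ∀ u ∈ P, ∀ v ∈ P, v ∈ N u → f u ≠ f v := by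
  classical
  constructor
  · rintro ⟨F, hF⟩
    simp only [stableCovers, mem_filter, Finset.mem_pi, mem_stableSubsets, subset_inter_iff] at hF
    obtain ⟨hF, hU⟩ := hF
    have : ∀ v ∈ P, ∃ c, ∃ hc : c ∈ C, v ∈ F c hc := by
      intro v hv
      rw [← hU] at hv
      simpa using hv
    choose! f hf using this
    refine ⟨f, fun v hv => ?_, fun u hu v hv huv h => ?_⟩
    · obtain ⟨hc, hv'⟩ := hf v hv
      exact ⟨hc, (hF _ hc).1.2 hv'⟩
    · obtain ⟨hc, hu'⟩ := hf u hu
      obtain ⟨hc', hv'⟩ := hf v hv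
      have hv' : v ∈ F (f u) hc := by simp only [h]; exact hv'
      exact (hF _ hc).2 u hu' v hv' huv
  · rintro ⟨f, hf, hp⟩
    refine ⟨fun c _ => P.filter (f · = c), ?_⟩
    simp only [stableCovers, mem_filter, Finset.mem_pi, mem_stableSubsets, subset_inter_iff]
    refine ⟨fun c hc => ⟨⟨filter_subset _ _, ?_⟩, ?_⟩, ?_⟩
    · intro v hv
      obtain ⟨hv', rfl⟩ := mem_filter.1 hv
      exact (hf v hv').2
    · intro u hu v hv huv
      rw [mem_filter] at hu hv
      exact hp u hu.1 v hv.1 huv (hu.2.trans hv.2.symm)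
    · ext v
      simp only [mem_biUnion, mem_attach, true_and, mem_filter, Subtype.exists]
      exact ⟨fun ⟨c, _, h, _⟩ => h, fun h => ⟨f v, (hf v h).1, h, rfl⟩⟩

theorem card_stableCovers_le {κ : Type*} (N : ℕ → Finset ℕ) (C : Finset κ)
    (W : κ → Finset ℕ) (P : Finset ℕ) :
    (stableCovers N C W P).card ≤ 2 ^ ∑ c ∈ C, (P ∩ W c).card := by
  classical
  refine (card_filter_le _ _).trans ?_
  rw [card_pi, ← prod_pow_eq_pow_sum]
  refine prod_le_prod' fun c _ => ?_
  rw [← card_powerset]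
  exact card_filter_le _ _

/-- Adding `a` to `A` discards at least a fraction 2^-(m+1) of the family. Isolating `a` turns any
member `S` into a discarded set, and at most 2^(m+1) members give the same set, because only their
traces on the closed neighborhood of `a` have been lost. -/
theorem card_trimmed_le {N : ℕ → Finset ℕ} {A P : Finset ℕ} (hN : IsNbhd N) {m : ℕ}
    (hAP : A ⊆ P) (hdeg : ∀ v ∈ A, (N v).card ≤ m)
    (hdisj : ∀ u ∈ A, ∀ v ∈ A, u ≠ v → Disjoint (insert u (N u) ∩ P) (insert v (N v))) :
    (trimmed N A P).card * (2 ^ (m + 1)) ^ A.card ≤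
      2 ^ P.card * (2 ^ (m + 1) - 1) ^ A.card := by
  induction A using Finset.induction_on with
  | empty => simp [trimmed]
  | insert a A ha ih =>
    have ih := ih (fun x hx => hAP (mem_insert_of_mem hx))
      (fun v hv => hdeg v (mem_insert_of_mem hv))
      fun u hu v hv => hdisj u (mem_insert_of_mem hu) v (mem_insert_of_mem hv)
    have haP : a ∈ P := hAP (mem_insert_self _ _)
    have hd : ∀ v ∈ A, Disjoint (insert a (N a) ∩ P) (insert v (N v)) := fun v hv =>
      hdisj a (mem_insert_self _ _) v (mem_insert_of_mem hv) fun h => ha (h ▸ hv)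
    set B := (trimmed N A P).filter fun S => ¬(a ∈ S → (S ∩ N a).Nonempty) with hB
    -- The injection records the trace on the closed neighborhood of `a` next to the set with `a`
    -- isolated. The latter still satisfies the conditions for the other elements of `A`, since by
    -- disjointness their neighbors in `S` are not deleted.
    have hcard : (trimmed N A P).card ≤ 2 ^ (m + 1) * B.card := by
      have h1 : (trimmed N A P).card ≤ ((insert a (N a)).powerset ×ˢ B).card := by
        refine card_le_card_of_injOn (fun S => (S ∩ insert a (N a), insert a (S \ N a))) ?_ ?_
        · intro S hS
          simp only [coe_product, Set.mem_prod, mem_coe, mem_powerset]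
          refine ⟨inter_subset_right, ?_⟩
          obtain ⟨h1, h2⟩ := mem_trimmed.1 hS
          simp only [hB, mem_filter, mem_trimmed, Classical.not_imp, not_nonempty_iff_eq_empty]
          refine ⟨⟨insert_subset haP (sdiff_subset.trans h1), fun v hv hvS => ?_⟩,
            mem_insert_self _ _, ?_⟩
          · have hva : v ≠ a := fun h => ha (h ▸ hv)
            have hvS : v ∈ S := (Finset.mem_sdiff.1 ((mem_insert.1 hvS).resolve_left hva)).1
            obtain ⟨x, hx⟩ := h2 v hv hvS
            rw [mem_inter] at hx
            refine ⟨x, mem_inter.2 ⟨mem_insert_of_mem (Finset.mem_sdiff.2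
              ⟨hx.1, fun hxa => ?_⟩), hx.2⟩⟩
            exact disjoint_left.1 (hd v hv) (mem_inter.2 ⟨mem_insert_of_mem hxa, h1 hx.1⟩)
              (mem_insert_of_mem hx.2)
          · ext x
            simp only [mem_inter, mem_insert, Finset.mem_sdiff, notMem_empty, iff_false]
            rintro ⟨rfl | h, h'⟩
            · exact hN.irrefl _ h'
            · exact h.2 h'
        · intro S hS T hT h
          simp only [Prod.mk.injEq] at h
          ext x
          have e1 := Finset.ext_iff.1 h.1 x
          have e2 := Finset.ext_iff.1 h.2 x
          simp only [mem_inter, mem_insert, Finset.mem_sdiff] at e1 e2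
          by_cases hx : x ∈ N a
          · simpa [hx] using e1
          · by_cases hxa : x = a
            · simpa [hxa] using e1
            · simpa [hx, hxa] using e2
      rw [card_product, card_powerset] at h1
      refine h1.trans (Nat.mul_le_mul_right _ (Nat.pow_le_pow_right (by norm_num) ?_))
      exact (card_insert_le _ _).trans (by have := hdeg a (mem_insert_self _ _); omega)
    have hsplit : (trimmed N (insert a A) P).card + B.card = (trimmed N A P).card := by
      rw [trimmed_insert]; exact card_filter_add_card_filter_not _
    rw [card_insert_of_notMem ha, pow_succ _ A.card, pow_succ _ A.card]
    have hpos : 1 ≤ 2 ^ (m + 1) := Nat.one_le_two_pow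
    generalize 2 ^ (m + 1) = X at *
    set d := (trimmed N A P).card
    set d' := (trimmed N (insert a A) P).card
    -- With `B` the discarded part, `d' + |B| = d` and `d ≤ X * |B|`.
    have key : d' * X ≤ d * (X - 1) := by
      obtain ⟨y, hy⟩ : ∃ y, X = y + 1 := ⟨X - 1, by omega⟩
      rw [hy] at hcard ⊢
      simp only [Nat.add_sub_cancel]
      nlinarith
    calc d' * (X ^ A.card * X) = (d' * X) * X ^ A.card := by ring
      _ ≤ (d * (X - 1)) * X ^ A.card := Nat.mul_le_mul_right _ key
      _ = (d * X ^ A.card) * (X - 1) := by ring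
      _ ≤ (2 ^ P.card * (X - 1) ^ A.card) * (X - 1) := Nat.mul_le_mul_right _ ih
      _ = _ := by ring

end

section

open Finset

/-! ### Counting colorings that extend a coloring of a set of vertices -/

/-- A list coloring instance with vertices `0, …, n - 1`, in which the list of the vertex `v`
consists of `col v j` for `j < len v`. -/
structure ListInstance (κ : Type*) where
  n : ℕ
  nbr : ℕ → Finset ℕ
  len : ℕ → ℕ
  col : ℕ → ℕ → κ

namespace ListInstance

variable {κ : Type*} [DecidableEq κ] {R : Type*} [CommRing R]

structure Valid (I : ListInstance κ) (k : ℕ) : Prop where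
  isNbhd : IsNbhd I.nbr
  nbr_subset : ∀ v, I.nbr v ⊆ range I.n
  len_le : ∀ v, I.len v ≤ k
  col_inj : ∀ v, Set.InjOn (I.col v) (range (I.len v))

variable (I : ListInstance κ) (χ : ℕ → κ) (H A : Finset ℕ)

def colors (v : ℕ) : Finset κ := (range (I.len v)).image (I.col v)

def allColors : Finset κ := (range I.n).biUnion I.colors

/-- The vertices that have the color `c` in their list. -/
def having (c : κ) : Finset ℕ := (range I.n).filter fun v => c ∈ I.colors v

/-- The vertices of `H` that get the color `c`. -/
def colored (c : κ) : Finset ℕ := H.filter fun h => χ h = c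

/-- The vertices to which the color `c` is forbidden. -/
def blocked (c : κ) : Finset ℕ := (colored χ H c).biUnion I.nbr

/-- The number of possible color classes for `c` in `S`, and zero if `χ` is not proper. -/
noncomputable def factor (S : Finset ℕ) (c : κ) : R :=
  if Disjoint (colored χ H c) (I.blocked χ H c) then
    (stableCount I.nbr (S ∩ (I.having c \ I.blocked χ H c)) : R) else 0

/-- The number of colors that are left to the vertex `v`. -/
def remaining (v : ℕ) : ℕ := ((range (I.len v)).filter fun j => v ∉ I.blocked χ H (I.col v j)).card

/-- The contribution of the vertex `v` to the term of `S`, where each color is attributed to the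
first vertex that has it. -/
noncomputable def vertexTerm (S : Finset ℕ) (v : ℕ) : R :=
  (if v ∈ S then -1 else 1) *
    (∏ j ∈ range (I.len v), if I.having (I.col v j) ∩ range v = ∅ then
      I.factor χ H S (I.col v j) else 1) *
    if v ∈ A ∧ v ∉ S ∧ S ∩ I.nbr v = ∅ then 1 - 2 ^ I.remaining χ H v else 1

noncomputable def term (S : Finset ℕ) : R := ∏ v ∈ range I.n, I.vertexTerm χ H A S v

variable {I χ H A} {k : ℕ}

/-- The inner condition holds for exactly one vertex with color `c`, the smallest one, so every
color is counted once. A program can thus form the product over all colors without making a list of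
them. -/
theorem prod_first (f : κ → R) (hI : I.Valid k) :
    ∏ v ∈ range I.n, ∏ j ∈ range (I.len v),
      (if I.having (I.col v j) ∩ range v = ∅ then f (I.col v j) else 1) =
      ∏ c ∈ I.allColors, f c := by
  have h1 : ∀ v, ∏ j ∈ range (I.len v),
      (if I.having (I.col v j) ∩ range v = ∅ then f (I.col v j) else 1) =
      ∏ c ∈ I.colors v, if I.having c ∩ range v = ∅ then f c else 1 := by
    intro v
    rw [colors, prod_image (hI.col_inj v)]
  rw [prod_congr rfl fun v _ => h1 v,
    prod_comm' (t' := I.allColors) (s' := fun c => I.having c)]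
  · refine prod_congr rfl fun c hc => ?_
    have hne : (I.having c).Nonempty := by
      obtain ⟨v, hv, hc⟩ := mem_biUnion.1 hc
      exact ⟨v, mem_filter.2 ⟨hv, hc⟩⟩
    rw [prod_eq_single ((I.having c).min' hne), if_pos]
    · ext x
      simp only [mem_inter, Finset.mem_range, notMem_empty, iff_false, not_and, not_lt]
      exact fun hx => min'_le _ _ hx
    · intro v hv hne'
      rw [if_neg]
      rw [← ne_eq, ← nonempty_iff_ne_empty]
      refine ⟨(I.having c).min' hne, mem_inter.2 ⟨min'_mem _ _, Finset.mem_range.2 ?_⟩⟩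
      exact lt_of_le_of_ne (min'_le _ _ hv) (Ne.symm hne')
    · exact fun h => absurd (min'_mem _ _) h
  · intro v c
    simp only [having, allColors, mem_filter, mem_biUnion, Finset.mem_range]
    constructor
    · rintro ⟨h1, h2⟩
      exact ⟨⟨h1, h2⟩, v, h1, h2⟩
    · rintro ⟨h, _⟩
      exact h

theorem term_eq (hI : I.Valid k) {S : Finset ℕ} (hS : S ⊆ range I.n) (hA : A ⊆ range I.n) :
    (I.term χ H A S : R) = ((-1) ^ S.card * ∏ c ∈ I.allColors, I.factor χ H S c) *
      ∏ v ∈ A, if v ∉ S ∧ S ∩ I.nbr v = ∅ then 1 - 2 ^ I.remaining χ H v else 1 := by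
  simp only [term, vertexTerm]
  rw [prod_mul_distrib, prod_mul_distrib, prod_first _ hI]
  congr 1
  · congr 1
    rw [← prod_const, ← inter_eq_right.2 hS, ← filter_mem_eq_inter, prod_filter]
    refine prod_congr rfl fun v hv => ?_
    simp [hv]
  · rw [← inter_eq_right.2 hA, ← filter_mem_eq_inter, prod_filter]
    refine prod_congr rfl fun v hv => ?_
    have := Finset.mem_range.1 hv
    by_cases h : v ∈ A <;> simp [h, this]

/-- The right-hand side counts the factors that double when `v` is added as an isolated vertex; the
left-hand side is what can be read off the list of `v` alone. -/
theorem card_remaining (hI : I.Valid k) {v : ℕ} (hv : v < I.n) :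
    I.remaining χ H v =
      (I.allColors.filter fun c => v ∈ I.having c \ I.blocked χ H c).card := by
  rw [remaining, ← card_image_of_injOn ((hI.col_inj v).mono (filter_subset _ _))]
  congr 1
  ext c
  simp only [mem_image, mem_filter, Finset.mem_range, Finset.mem_sdiff, having, allColors,
    mem_biUnion, colors, hv, true_and]
  constructor
  · rintro ⟨j, ⟨hj, hb⟩, rfl⟩
    exact ⟨⟨v, hv, j, hj, rfl⟩, ⟨j, hj, rfl⟩, hb⟩
  · rintro ⟨_, ⟨j, hj, rfl⟩, hb⟩
    exact ⟨j, ⟨hj, hb⟩, rfl⟩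

/-- If `χ` is proper on `H`, the compression of the sum applies with `g v = 2 ^ I.remaining χ H v`,
because an isolated `v` doubles precisely the factors of the colors left to it; inclusion–exclusion
then counts the covers. Otherwise some color has factor zero in every term. -/
theorem sum_term (hI : I.Valid k) (hA : A ⊆ range I.n \ H) (hst : IsStable I.nbr A) :
    ∑ S ∈ trimmed I.nbr A (range I.n \ H), (I.term χ H A S : R) =
      if ∀ c ∈ I.allColors, Disjoint (colored χ H c) (I.blocked χ H c) then
        (-1) ^ (range I.n \ H).card * ((stableCovers I.nbr I.allColors
          (fun c => I.having c \ I.blocked χ H c) (range I.n \ H)).card : R) else 0 := by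
  have hA' : A ⊆ range I.n := hA.trans sdiff_subset
  have h1 : ∀ S ∈ trimmed I.nbr A (range I.n \ H), (I.term χ H A S : R) = _ := fun S hS =>
    term_eq hI ((mem_trimmed.1 hS).1.trans sdiff_subset) hA'
  rw [sum_congr rfl h1]
  split_ifs with hok
  · have h2 : ∀ S, ∏ c ∈ I.allColors, (I.factor χ H S c : R) =
        ∏ c ∈ I.allColors, (stableCount I.nbr (S ∩ (I.having c \ I.blocked χ H c)) : R) :=
      fun S => prod_congr rfl fun c hc => by rw [factor, if_pos (hok c hc)]
    simp only [h2]
    rw [← sum_neg_one_pow_mul_prod_stableCount,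
      sum_powerset_eq_sum_trimmed hI.isNbhd hA hst _ (fun v => 2 ^ I.remaining χ H v)]
    intro S hS v hv hvS hiso
    rw [card_insert_of_notMem hvS, pow_succ]
    have h3 : ∏ c ∈ I.allColors,
          (stableCount I.nbr (insert v S ∩ (I.having c \ I.blocked χ H c)) : R) =
        2 ^ I.remaining χ H v * ∏ c ∈ I.allColors,
          (stableCount I.nbr (S ∩ (I.having c \ I.blocked χ H c)) : R) := by
      rw [card_remaining hI (Finset.mem_range.1 (hA' hv)), ← prod_const, prod_filter,
        ← prod_mul_distrib]
      refine prod_congr rfl fun c _ => ?_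
      split_ifs with h
      · rw [insert_inter_of_mem h, hI.isNbhd.stableCount_insert_isolated]
        · push_cast; ring
        · exact fun h' => hvS (mem_inter.1 h').1
        · rw [← subset_empty, ← hiso]
          exact inter_subset_inter inter_subset_left le_rfl
      · rw [insert_inter_of_notMem h, one_mul]
    rw [h3]; ring
  · push Not at hok
    obtain ⟨c, hc, hd⟩ := hok
    refine sum_eq_zero fun S _ => ?_
    rw [prod_eq_zero hc, mul_zero, zero_mul]
    rw [factor, if_neg hd]

def Colorable (I : ListInstance κ) : Prop :=
  ∃ f : ℕ → κ, (∀ v < I.n, f v ∈ I.colors v) ∧ ∀ u < I.n, ∀ v ∈ I.nbr u, f u ≠ f v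

/-- A coloring is split into its restriction `χ` to `H` and the color classes outside `H`. The edges
inside `H` are handled by the disjointness condition, the edges between `H` and its complement by
removing the blocked vertices, and the remaining edges by stability. -/
theorem colorable_iff [Nonempty κ] (hI : I.Valid k) (hH : H ⊆ range I.n) :
    I.Colorable ↔ ∃ χ : ℕ → κ, (∀ h ∈ H, χ h ∈ I.colors h) ∧
      (∀ c ∈ I.allColors, Disjoint (colored χ H c) (I.blocked χ H c)) ∧
      (stableCovers I.nbr I.allColors
          (fun c => I.having c \ I.blocked χ H c) (range I.n \ H)).Nonempty := by
  simp only [stableCovers_nonempty]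
  constructor
  · rintro ⟨f, hf, hp⟩
    refine ⟨f, fun h hh => hf h (Finset.mem_range.1 (hH hh)), fun c _ => ?_, f, fun v hv => ?_,
      fun u hu v _ huv => hp u (Finset.mem_range.1 (Finset.mem_sdiff.1 hu).1) v huv⟩
    · rw [disjoint_left]
      intro v hv hb
      simp only [colored, blocked, mem_filter, mem_biUnion] at hv hb
      obtain ⟨u, ⟨hu, huc⟩, huv⟩ := hb
      exact hp u (Finset.mem_range.1 (hH hu)) v huv (huc.trans hv.2.symm)
    · have hv' := (Finset.mem_sdiff.1 hv).1
      have hvn := Finset.mem_range.1 hv'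
      refine ⟨mem_biUnion.2 ⟨v, hv', hf v hvn⟩, Finset.mem_sdiff.2
        ⟨mem_filter.2 ⟨hv', hf v hvn⟩, fun hb => ?_⟩⟩
      simp only [colored, blocked, mem_filter, mem_biUnion] at hb
      obtain ⟨u, ⟨hu, huc⟩, huv⟩ := hb
      exact hp u (Finset.mem_range.1 (hH hu)) v huv huc
  · rintro ⟨χ, hχ, hok, f, hf, hp⟩
    have hmem : ∀ v < I.n, v ∉ H → v ∈ range I.n \ H := fun v hv hvH =>
      Finset.mem_sdiff.2 ⟨Finset.mem_range.2 hv, hvH⟩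
    have hcross : ∀ u ∈ H, ∀ v < I.n, v ∉ H → v ∈ I.nbr u → χ u ≠ f v := by
      intro u hu v hv hvH huv h
      refine (Finset.mem_sdiff.1 (hf v (hmem v hv hvH)).2).2 ?_
      exact mem_biUnion.2 ⟨u, mem_filter.2 ⟨hu, h⟩, huv⟩
    refine ⟨fun v => if v ∈ H then χ v else f v, fun v hv => ?_, fun u hu v huv => ?_⟩
    · dsimp only
      split_ifs with h
      · exact hχ v h
      · exact (mem_filter.1 (Finset.mem_sdiff.1 (hf v (hmem v hv h)).2).1).2
    · have hv := Finset.mem_range.1 (hI.nbr_subset u huv)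
      dsimp only
      split_ifs with h1 h2 h2
      · intro h
        have hc : χ u ∈ I.allColors := mem_biUnion.2 ⟨u, hH h1, hχ u h1⟩
        refine disjoint_left.1 (hok _ hc) (mem_filter.2 ⟨h2, h.symm⟩ : v ∈ _) ?_
        exact mem_biUnion.2 ⟨u, mem_filter.2 ⟨h1, rfl⟩, huv⟩
      · exact hcross u h1 v hv h2 huv
      · exact (hcross v h2 u hu h1 (hI.isNbhd.symm huv)).symm
      · exact hp u (hmem u hu h1) v (hmem v hv h2) huv

/-- The exponent is bounded by the number of pairs of a vertex and a color in its list. Consequently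
a number of covers that is not zero is also not zero modulo 2^w. -/
theorem card_covers_le (hI : I.Valid k) :
    (stableCovers I.nbr I.allColors
          (fun c => I.having c \ I.blocked χ H c) (range I.n \ H)).card ≤ 2 ^ (k * I.n) := by
  refine (card_stableCovers_le _ _ _ _).trans (Nat.pow_le_pow_right (by norm_num) ?_)
  calc ∑ c ∈ I.allColors, ((range I.n \ H) ∩ (I.having c \ I.blocked χ H c)).card
      ≤ ∑ c ∈ I.allColors, ∑ v ∈ range I.n, if c ∈ I.colors v then 1 else 0 := by
        refine sum_le_sum fun c _ => ?_
        rw [← card_filter]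
        exact card_le_card (inter_subset_right.trans sdiff_subset)
    _ = ∑ v ∈ range I.n, ∑ c ∈ I.allColors, if c ∈ I.colors v then 1 else 0 := sum_comm
    _ ≤ ∑ v ∈ range I.n, k := by
        refine sum_le_sum fun v _ => ?_
        rw [← card_filter]
        calc _ ≤ (I.colors v).card := card_le_card fun c hc => (mem_filter.1 hc).2
          _ ≤ (range (I.len v)).card := card_image_le
          _ ≤ k := by rw [card_range]; exact hI.len_le v
    _ = k * I.n := by rw [sum_const, card_range, smul_eq_mul, mul_comm]

end ListInstance

end

/-! ### Loop-free programs and counting the elements of a set. -/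

namespace WordRAM

open Finset

variable {w : ℕ}

/-- Programs without loops. -/
def Prog.straight : Prog → Bool
  | .skip => true
  | .assign _ _ => true
  | .store _ _ _ => true
  | .seq p q => p.straight && q.straight
  | .cond _ p q => p.straight && q.straight
  | .loop _ _ => false

/-- The effect of a program without loops. -/
def Prog.exec : Prog → State w → State w
  | .skip, σ => σ
  | .assign x e, σ => σ.setReg x (e.eval σ)
  | .store b a e, σ => σ.setMem b (a.eval σ) (e.eval σ)
  | .seq p q, σ => q.exec (p.exec σ)
  | .cond e p q, σ => if e.eval σ = 0#w then q.exec σ else p.exec σ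
  | .loop _ _, σ => σ

/-- A bound on the number of steps of a program without loops. -/
def Prog.maxCost : Prog → ℕ
  | .skip => 1
  | .assign _ e => e.cost + 1
  | .store _ a e => a.cost + e.cost + 1
  | .seq p q => p.maxCost + q.maxCost
  | .cond e p q => e.cost + 1 + (p.maxCost + q.maxCost)
  | .loop _ _ => 0

theorem WP.exec {p : Prog} {Q : State w → Prop} {σ : State w} (hp : p.straight = true)
    (hQ : Q (p.exec σ)) : WP p p.maxCost Q σ := by
  induction p generalizing σ Q with
  | skip => exact .skip hQ
  | assign => exact .assign hQ
  | store => exact .store hQ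
  | seq p q ihp ihq =>
    simp only [Prog.straight, Bool.and_eq_true] at hp
    exact .seq (ihp hp.1 (ihq hp.2 hQ))
  | cond e p q ihp ihq =>
    simp only [Prog.straight, Bool.and_eq_true] at hp
    refine .cond (fun h => ihp hp.1 ?_) (fun h => ihq hp.2 ?_)
    · rwa [Prog.exec, if_neg h] at hQ
    · rwa [Prog.exec, if_pos h] at hQ
  | loop => simp [Prog.straight] at hp

theorem WP.straight {p : Prog} {T : ℕ} {Q : State w → Prop} {σ : State w}
    (hp : p.straight = true) (hT : p.maxCost ≤ T) (hQ : Q (p.exec σ)) : WP p T Q σ :=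
  (WP.exec hp hQ).mono hT fun _ h => h

theorem WP.seqT {p q : Prog} (T₁ T₂ : ℕ) {T : ℕ} {Q : State w → Prop} {σ : State w}
    (hT : T₁ + T₂ ≤ T) (h : WP p T₁ (fun τ => WP q T₂ Q τ) σ) : WP (p ;; q) T Q σ :=
  (WP.seq h).mono hT fun _ h => h

theorem WP.forLoopT {i : ℕ} {b : Expr} {body : Prog} {Q : State w → Prop} {σ : State w} {T' : ℕ}
    (Inv : ℕ → State w → Prop) (N T : ℕ) (hT : N * (T + b.cost + 7) + b.cost + 5 ≤ T')
    (hN : N < 2 ^ w) (hw : 0 < w)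
    (hb : ∀ m ≤ N, ∀ τ, Inv m τ → τ.reg i = BitVec.ofNat w m → b.eval τ = BitVec.ofNat w N)
    (h0 : Inv 0 (σ.setReg i 0#w))
    (hstep : ∀ m < N, ∀ τ, Inv m τ → τ.reg i = BitVec.ofNat w m →
      WP body T (fun τ' => τ'.reg i = BitVec.ofNat w m ∧
        Inv (m + 1) (τ'.setReg i (BitVec.ofNat w (m + 1)))) τ)
    (hQ : ∀ τ, Inv N τ → τ.reg i = BitVec.ofNat w N → Q τ) :
    WP (WordRAM.forLoop i b body) T' Q σ :=
  (WP.forLoop Inv N T hN hw hb h0 hstep hQ).mono hT fun _ h => h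

/-- Count the elements of the set in register `20`. -/
def popcount : Prog :=
  21 ::= ♭0 ;; forLoop 22 ♯0 (21 ::= ♯21 +ᵣ ((♯20 >>ᵣ ♯22) &ᵣ ♭1))

theorem lt_two_pow {m w : ℕ} (h : m ≤ w) : m < 2 ^ w :=
  lt_of_le_of_lt h Nat.lt_two_pow_self

theorem popcount_spec {n : ℕ} {S : Finset ℕ} {σ : State w} (hn : n < w) (hS : S ⊆ range n)
    (h0 : σ.reg 0 = BitVec.ofNat w n) (h20 : σ.reg 20 = enc w S) :
    WP popcount (20 * (n + 1)) (fun τ => Frame 21 σ τ ∧ τ.reg 21 = BitVec.ofNat w S.card) σ := by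
  refine .seqT 2 (20 * n + 6) (by omega) (.straight rfl le_rfl ?_)
  refine .forLoopT
    (fun m τ => Frame 21 σ τ ∧ τ.reg 21 = BitVec.ofNat w (S ∩ range m).card) n 8
    (by simp only [Expr.cost]; omega) (lt_two_pow hn.le) (by omega) ?_ ?_ ?_ ?_
  · intro m _ τ h _
    simp [Expr.eval, h.1.1, h0]
  · refine ⟨((Frame.refl _ _).setReg (by omega) _).setReg (by omega) _, ?_⟩
    simp [Prog.exec, Expr.eval]
  · intro m hm τ ⟨hF, h21⟩ h22
    refine .straight rfl le_rfl ⟨?_, ((hF.setReg (by omega) _).setReg (by omega) _), ?_⟩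
    · simp [Prog.exec, h22]
    · simp only [Prog.exec, Expr.eval, Op.apply, State.setReg_reg]
      rw [hF.1 20 (by omega), h20, h21, h22, bit_test _ (by omega), range_add_one]
      by_cases h : m ∈ S
      · rw [inter_insert_of_mem h, card_insert_of_notMem (by simp)]
        simp [h, BitVec.ofNat_add]
      · rw [inter_insert_of_notMem h]
        simp [h]
  · intro τ ⟨hF, h21⟩ _
    exact ⟨hF, by rwa [inter_eq_left.2 hS] at h21⟩

end WordRAM

namespace WordRAM

open Finset

variable {w : ℕ}

/-! ### Evaluation of operations on encoded numbers and sets -/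

theorem lt_apply {a b : ℕ} (ha : a < 2 ^ w) (hb : b < 2 ^ w) :
    Op.lt.apply (BitVec.ofNat w a) (BitVec.ofNat w b) = if a < b then 1#w else 0#w := by
  simp only [Op.apply, ofNat_lt_ofNat ha hb]; rfl

theorem eq_zero_apply {S : Finset ℕ} (hS : S ⊆ range w) :
    Op.eq.apply (enc w S) 0#w = if S = ∅ then 1#w else 0#w := by
  simp only [Op.apply, enc_eq_zero hS]; rfl

theorem ite_shl (p : Prop) [Decidable p] {v : ℕ} (hv : v < w) :
    (if p then 1#w else 0#w) <<< BitVec.ofNat w v = enc w (if p then {v} else ∅) := by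
  split_ifs
  · exact bit_eq hv
  · simp [enc_empty]

theorem ite_and_ite (p q : Prop) [Decidable p] [Decidable q] :
    (if p then 1#w else 0#w) &&& (if q then 1#w else 0#w) = if p ∧ q then 1#w else 0#w := by
  by_cases hp : p <;> by_cases hq : q <;> simp [hp, hq]

theorem ite_or_ite (p q : Prop) [Decidable p] [Decidable q] :
    (if p then 1#w else 0#w) ||| (if q then 1#w else 0#w) = if p ∨ q then 1#w else 0#w := by
  by_cases hp : p <;> by_cases hq : q <;> simp [hp, hq]

theorem ite_eq_zero (hw : 0 < w) (p : Prop) [Decidable p] :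
    (if p then 1#w else 0#w) = 0#w ↔ ¬p := by
  have := one_ne_zero_of_pos hw
  by_cases hp : p
  · simp only [hp, if_true, not_true, iff_false]; exact this
  · simp [hp]

theorem _root_.Finset.inter_range_succ (S : Finset ℕ) (m : ℕ) :
    S ∩ range (m + 1) = (S ∩ range m) ∪ if m ∈ S then {m} else ∅ := by
  rw [range_add_one]
  split_ifs with h
  · rw [inter_insert_of_mem h, insert_eq, union_comm]
  · rw [inter_insert_of_notMem h, union_empty]

theorem subset_range_of_le {S : Finset ℕ} {n : ℕ} (hS : S ⊆ range n) (hn : n < w) :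
    S ⊆ range w :=
  hS.trans (range_subset_range.2 hn.le)

/-! ### Reading the graph -/

/-- Store the neighborhood of each vertex in bank `3` and collect the vertices of degree at most
`d` in register `1`. -/
def readGraph (d : ℕ) : Prog :=
  1 ::= ♭0 ;; forLoop 10 ♯0 (
    20 ::= ♭0 ;;
    forLoop 11 ♯0 (20 ::= ♯20 |ᵣ (.load 0 (♯0 *ᵣ ♯10 +ᵣ ♯11) <<ᵣ ♯11)) ;;
    .store 3 ♯10 ♯20 ;;
    popcount ;;
    1 ::= ♯1 |ᵣ ((♯21 <ᵣ ♭(d + 1)) <<ᵣ ♯10))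

end WordRAM

namespace ListInstance

open Finset

variable {κ : Type*} (I : ListInstance κ)

/-- The vertices of degree at most `d`. -/
def low (d : ℕ) : Finset ℕ := (range I.n).filter fun v => (I.nbr v).card ≤ d

/-- The vertices with at least `D` neighbors in `L`. -/
def heavy (L : Finset ℕ) (D : ℕ) : Finset ℕ :=
  (range I.n).filter fun v => D ≤ (I.nbr v ∩ L).card

/-- The closed neighborhood of `v` outside of `H`. -/
def closedNbr (H : Finset ℕ) (v : ℕ) : Finset ℕ := insert v (I.nbr v) \ H

end ListInstance

namespace WordRAM

open Finset

variable {w : ℕ}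

theorem readGraph_spec {I : ListInstance (BitVec w)} {σ : State w} {d : ℕ} (hn : I.n < w)
    (hd : d + 1 < 2 ^ w) (hsub : ∀ v, I.nbr v ⊆ range I.n)
    (h0 : σ.reg 0 = BitVec.ofNat w I.n)
    (hadj : ∀ u < I.n, ∀ v < I.n, σ.mem 0 (BitVec.ofNat w (I.n * u + v)) =
      if v ∈ I.nbr u then 1#w else 0#w) :
    WP (readGraph d) (100 * (I.n + 1) ^ 2) (fun τ => τ.reg 0 = BitVec.ofNat w I.n ∧
      τ.reg 1 = enc w (I.low d) ∧ (∀ v < I.n, τ.mem 3 (BitVec.ofNat w v) = enc w (I.nbr v)) ∧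
      ∀ b ≠ 3, τ.mem b = σ.mem b) σ := by
  have hw : 0 < w := by omega
  refine .seqT 2 (I.n * (60 * (I.n + 1)) + 10) (by nlinarith) (.straight rfl le_rfl ?_)
  refine .forLoopT (fun m τ => τ.reg 0 = BitVec.ofNat w I.n ∧
      τ.reg 1 = enc w (I.low d ∩ range m) ∧
      (∀ v < m, τ.mem 3 (BitVec.ofNat w v) = enc w (I.nbr v)) ∧
      ∀ b ≠ 3, τ.mem b = σ.mem b) I.n (50 * (I.n + 1))
    (by simp only [Expr.cost]; nlinarith) (lt_two_pow hn.le) hw ?_ ?_ ?_ ?_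
  · intro m _ τ h _
    simp [Expr.eval, h.1]
  · refine ⟨by simp [Prog.exec, h0], by simp [Prog.exec, Expr.eval, enc_empty], by simp, ?_⟩
    simp [Prog.exec]
  · rintro m hm τ ⟨hr0, hr1, hr3, hmem⟩ h10
    refine .seqT 2 (40 * I.n + 48) (by omega) (.straight rfl le_rfl ?_)
    refine .seqT (20 * I.n + 6) (20 * I.n + 40) (by omega) ?_
    refine .forLoopT (fun j ρ => Frame 11 τ ρ ∧ ρ.reg 20 = enc w (I.nbr m ∩ range j)) I.n 12
      (by simp only [Expr.cost]; omega) (lt_two_pow hn.le) hw ?_ ?_ ?_ ?_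
    · intro j _ ρ h _
      simp [Expr.eval, h.1.1, hr0]
    · refine ⟨((Frame.refl _ _).setReg (by omega) _).setReg (by omega) _, ?_⟩
      simp [Prog.exec, Expr.eval, enc_empty]
    · rintro j hj ρ ⟨hF, h20⟩ h11
      refine .straight rfl (by simp [Prog.maxCost, Expr.cost])
        ⟨?_, ((hF.setReg (by omega) _).setReg (by omega) _), ?_⟩
      · simp [Prog.exec, h11]
      · have : ρ.mem 0 (BitVec.ofNat w I.n * BitVec.ofNat w m + BitVec.ofNat w j) =
            if j ∈ I.nbr m then 1#w else 0#w := by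
          rw [← BitVec.ofNat_mul, ← BitVec.ofNat_add, hF.2, hmem 0 (by decide)]
          exact hadj m hm j hj
        simp only [Prog.exec, Expr.eval, Op.apply, State.setReg_reg]
        simp only [hF.1 0 (by omega), hF.1 10 (by omega), hr0, h10, h11, h20, this,
          show ¬ (20 = 11) by decide, if_true, if_false]
        rw [ite_shl _ (by omega), enc_union, inter_range_succ]
    · rintro ρ ⟨hF, h20⟩ -
      rw [inter_eq_left.2 (hsub m)] at h20
      refine .seqT 3 (20 * I.n + 35) (by omega) (.straight rfl le_rfl ?_)
      refine .seqT (20 * (I.n + 1)) 12 (by omega)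
        ((popcount_spec hn (hsub m) ?_ ?_).mono le_rfl ?_)
      · simp [Prog.exec, hF.1, hr0]
      · simp [Prog.exec, h20]
      · rintro π ⟨hF', h21⟩
        have hm3 : π.mem = (ρ.setMem 3 (BitVec.ofNat w m) (enc w (I.nbr m))).mem := by
          rw [hF'.2]; simp [Prog.exec, Expr.eval, hF.1, h10, h20]
        refine .straight rfl (by simp [Prog.maxCost, Expr.cost]) ⟨?_, ?_, ?_, ?_, ?_⟩
        · simp [Prog.exec, hF'.1, hF.1, h10]
        · simp [Prog.exec, hF'.1, hF.1, hr0]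
        · have hc : (I.nbr m).card ≤ I.n := by simpa using card_le_card (hsub m)
          -- The condition `≤ d` is tested as `< d + 1`, the machine comparison being strict; `hd`
          -- ensures that `d + 1` fits into a word.
          have e : (if (I.nbr m).card < d + 1 then {m} else ∅ : Finset ℕ) =
              if m ∈ I.low d then {m} else ∅ := by
            simp [ListInstance.low, hm]
          simp only [Prog.exec, Expr.eval, State.setReg_reg, if_true,
            show ¬ (1 = 10) by decide, if_false, h21]
          rw [lt_apply (lt_two_pow (by omega)) hd]
          simp only [Op.apply, hF'.1 10 (by omega), hF'.1 1 (by omega), State.setMem_reg, Prog.exec,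
            hF.1 10 (by omega), hF.1 1 (by omega), h10, hr1]
          rw [ite_shl _ (by omega), enc_union, e, inter_range_succ]
        · intro v hv
          simp only [Prog.exec, State.setReg_mem, hm3, State.setMem_mem, true_and]
          by_cases h : v = m
          · simp [h]
          · rw [if_neg (by rwa [ofNat_inj (lt_two_pow (by omega)) (lt_two_pow (by omega))])]
            rw [hF.2]; exact hr3 v (by omega)
        · intro b hb
          simp only [Prog.exec, State.setReg_mem, hm3]
          rw [State.setMem_mem_ne _ hb, hF.2, hmem b hb]
  · rintro τ ⟨hr0, hr1, hr3, hmem⟩ _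
    refine ⟨hr0, ?_, hr3, hmem⟩
    rwa [inter_eq_left.2 (show I.low d ⊆ range I.n from filter_subset _ _)] at hr1

/-- The input and the neighborhoods, as they are stored during the computation. -/
structure Stores (I : ListInstance (BitVec w)) (k : ℕ) (σ : State w) : Prop where
  reg0 : σ.reg 0 = BitVec.ofNat w I.n
  len : ∀ v < I.n, σ.mem 1 (BitVec.ofNat w v) = BitVec.ofNat w (I.len v)
  col : ∀ v < I.n, ∀ j < I.len v, σ.mem 2 (BitVec.ofNat w (k * v + j)) = I.col v j
  nbr : ∀ v < I.n, σ.mem 3 (BitVec.ofNat w v) = enc w (I.nbr v)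

theorem Stores.of_eq {I : ListInstance (BitVec w)} {k : ℕ} {σ τ : State w} (h : Stores I k σ)
    (h0 : τ.reg 0 = σ.reg 0) (h1 : τ.mem 1 = σ.mem 1) (h2 : τ.mem 2 = σ.mem 2)
    (h3 : τ.mem 3 = σ.mem 3) : Stores I k τ where
  reg0 := h0.trans h.reg0
  len := by rw [h1]; exact h.len
  col := by rw [h2]; exact h.col
  nbr := by rw [h3]; exact h.nbr

theorem Stores.frame {I : ListInstance (BitVec w)} {k b : ℕ} {σ τ : State w} (h : Stores I k σ)
    (hF : Frame b σ τ) (hb : 0 < b) : Stores I k τ :=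
  h.of_eq (hF.1 0 hb) (by rw [hF.2]) (by rw [hF.2]) (by rw [hF.2])

/-! ### Choosing the heavy and the scattered vertices. -/

/-- Collect in register `2` the vertices with at least `D * 2 ^ j` neighbors in the set in
register `1`, for the last `j < J` for which there are few of them. -/
def chooseHeavy (D J M : ℕ) : Prog :=
  5 ::= ♭D ;; 2 ::= ♭0 ;; forLoop 10 ♭J (
    12 ::= ♭0 ;;
    forLoop 11 ♯0 (
      20 ::= .load 3 ♯11 &ᵣ ♯1 ;;
      popcount ;;
      12 ::= ♯12 |ᵣ ((♯5 <ᵣ ♯21 +ᵣ ♭1) <<ᵣ ♯11)) ;;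
    20 ::= ♯12 ;;
    popcount ;;
    .cond (♯21 *ᵣ ♯5 *ᵣ ♭M <ᵣ ♯0 +ᵣ ♭1) (2 ::= ♯12) .skip ;;
    5 ::= ♯5 +ᵣ ♯5)

/-- Register `5` runs through the scales by doubling. The invariant says that register `2` holds the
heavy set of some good scale, or that no scale so far was good; `hex` rules out the second case at
the end. The bound `hbig` prevents an overflow in the products that are compared with `n`. -/
theorem chooseHeavy_spec {I : ListInstance (BitVec w)} {k : ℕ} {σ : State w} {D J M : ℕ}
    {L : Finset ℕ} (hn : I.n < w) (hJ : J < 2 ^ w)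
    (hsub : ∀ v, I.nbr v ⊆ range I.n) (hbig : (I.n + 1) * (D * 2 ^ J) * (M + 1) < 2 ^ w)
    (hS : Stores I k σ) (h1 : σ.reg 1 = enc w L)
    (hex : ∃ j < J, (I.heavy L (D * 2 ^ j)).card * (D * 2 ^ j) * M ≤ I.n) :
    WP (chooseHeavy D J M) ((J + 1) * (200 * (I.n + 1) ^ 2)) (fun τ => Frame 2 σ τ ∧ ∃ j < J,
      (I.heavy L (D * 2 ^ j)).card * (D * 2 ^ j) * M ≤ I.n ∧
        τ.reg 2 = enc w (I.heavy L (D * 2 ^ j))) σ := by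
  have hw : 0 < w := by omega
  have hDj : ∀ j ≤ J, D * 2 ^ j ≤ D * 2 ^ J := fun j hj =>
    Nat.mul_le_mul_left _ (Nat.pow_le_pow_right (by norm_num) hj)
  have hDj' : ∀ j ≤ J, D * 2 ^ j < 2 ^ w := fun j hj => by
    refine lt_of_le_of_lt (hDj j hj) (lt_of_le_of_lt ?_ hbig)
    calc D * 2 ^ J ≤ (I.n + 1) * (D * 2 ^ J) := Nat.le_mul_of_pos_left _ (by omega)
      _ ≤ _ := Nat.le_mul_of_pos_right _ (by omega)
  set n := I.n with hndef
  have hn2 : n + 1 < 2 ^ w := by have := @Nat.lt_two_pow_self w; omega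
  refine .seqT 2 (4 + (J * (200 * (n + 1) ^ 2)) + 5) (by nlinarith) (.straight rfl le_rfl ?_)
  refine .seqT 2 (J * (200 * (n + 1) ^ 2) + 6) (by omega) (.straight rfl le_rfl ?_)
  refine .forLoopT (fun m τ => Frame 2 σ τ ∧ τ.reg 5 = BitVec.ofNat w (D * 2 ^ m) ∧
      ((∃ j < m, (I.heavy L (D * 2 ^ j)).card * (D * 2 ^ j) * M ≤ n ∧
        τ.reg 2 = enc w (I.heavy L (D * 2 ^ j))) ∨
        ∀ j < m, ¬(I.heavy L (D * 2 ^ j)).card * (D * 2 ^ j) * M ≤ n))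
    J (20 * (n + 1) ^ 2 + 100 * (n + 1)) ?_ hJ hw ?_ ?_ ?_ ?_
  · simp only [Expr.cost]
    have : 20 * (n + 1) ^ 2 + 100 * (n + 1) + 1 + 7 ≤ 200 * (n + 1) ^ 2 := by
      have h1 : n + 1 ≤ (n + 1) ^ 2 := Nat.le_self_pow (by norm_num) _
      linarith
    have := Nat.mul_le_mul_left J this
    omega
  · intro m _ τ h _
    simp [Expr.eval]
  · refine ⟨(((Frame.refl _ _).setReg (by omega) _).setReg (by omega) _).setReg (by omega) _, ?_,
      Or.inr (by simp)⟩
    simp [Prog.exec, Expr.eval]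
  · rintro m hm τ ⟨hF, h5, hG⟩ h10
    refine .seqT 2 (20 * (n + 1) ^ 2 + 100 * (n + 1) - 2) (by omega) (.straight rfl le_rfl ?_)
    refine .seqT (20 * (n + 1) ^ 2 + 40 * (n + 1)) (50 * (n + 1)) (by omega) ?_
    refine .forLoopT (fun u ρ => Frame 11 τ ρ ∧
        ρ.reg 12 = enc w (I.heavy L (D * 2 ^ m) ∩ range u)) n (20 * (n + 1) + 20)
      (by simp only [Expr.cost]; nlinarith) (lt_two_pow hn.le) hw ?_ ?_ ?_ ?_
    · intro u _ ρ h _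
      simp [Expr.eval, h.1.1, hF.1, hS.reg0, hndef]
    · refine ⟨((Frame.refl _ _).setReg (by omega) _).setReg (by omega) _, ?_⟩
      simp [Prog.exec, Expr.eval, enc_empty]
    · rintro u hu ρ ⟨hF₁, h12⟩ h11
      have hsub' : I.nbr u ∩ L ⊆ range n := inter_subset_left.trans (hsub u)
      have hc : (I.nbr u ∩ L).card ≤ n := by simpa using card_le_card hsub'
      refine .seqT 5 (20 * (n + 1) + 12) (by omega) (.straight rfl le_rfl ?_)
      refine .seqT (20 * (n + 1)) 12 (by omega)
        ((popcount_spec (n := n) (S := I.nbr u ∩ L) hn hsub' ?_ ?_).mono le_rfl ?_)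
      · simp [Prog.exec, hF₁.1, hF.1, hS.reg0, hndef]
      · simp [Prog.exec, Expr.eval, Op.apply, hF₁.1, hF.1, h1, hF₁.2, hF.2, h11, hS.nbr u hu,
          enc_inter]
      · rintro π ⟨hF₂, h21⟩
        have hF₃ : Frame 11 τ π := (hF₁.setReg (by omega) _).trans (hF₂.mono (by omega))
        refine .straight rfl (by simp [Prog.maxCost, Expr.cost])
          ⟨?_, (hF₃.setReg (by omega) _).setReg (by omega) _, ?_⟩
        · simp [Prog.exec, hF₂.1, h11]
        · have e : (if D * 2 ^ m < (I.nbr u ∩ L).card + 1 then {u} else ∅ : Finset ℕ) =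
              if u ∈ I.heavy L (D * 2 ^ m) then {u} else ∅ := by
            simp [ListInstance.heavy, ← hndef, hu]
          have h11' : π.reg 11 = BitVec.ofNat w u := by
            rw [hF₂.1 11 (by omega)]; simp [Prog.exec, h11]
          have h12' : π.reg 12 = enc w (I.heavy L (D * 2 ^ m) ∩ range u) := by
            rw [hF₂.1 12 (by omega)]; simp [Prog.exec, h12]
          have h5' : π.reg 5 = BitVec.ofNat w (D * 2 ^ m) := by
            rw [hF₃.1 5 (by omega), h5]
          have hadd : Op.add.apply (BitVec.ofNat w (I.nbr u ∩ L).card) (BitVec.ofNat w 1) =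
            BitVec.ofNat w ((I.nbr u ∩ L).card + 1) := by simp [Op.apply, BitVec.ofNat_add]
          simp only [Prog.exec, Expr.eval, State.setReg_reg, if_true,
            show ¬ (12 = 11) by decide, if_false, h21, h11', h12', h5', hadd]
          rw [lt_apply (hDj' m hm.le) (by omega)]
          simp only [Op.apply]
          rw [ite_shl _ (by omega), enc_union, e, inter_range_succ]
    · rintro ρ ⟨hF₁, h12⟩ -
      have hHsub : I.heavy L (D * 2 ^ m) ⊆ range n := filter_subset _ _
      rw [inter_eq_left.2 hHsub] at h12
      have hc : (I.heavy L (D * 2 ^ m)).card ≤ n := by simpa using card_le_card hHsub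
      refine .seqT 2 (50 * (n + 1) - 2) (by omega) (.straight rfl le_rfl ?_)
      refine .seqT (20 * (n + 1)) 20 (by omega)
        ((popcount_spec (n := n) (S := I.heavy L (D * 2 ^ m)) hn hHsub ?_ ?_).mono le_rfl ?_)
      · simp [Prog.exec, hF₁.1, hF.1, hS.reg0, hndef]
      · simp [Prog.exec, Expr.eval, h12]
      rintro π ⟨hF₂, h21⟩
      have hF₃ : Frame 11 τ π := (hF₁.setReg (by omega) _).trans (hF₂.mono (by omega))
      have h12' : π.reg 12 = enc w (I.heavy L (D * 2 ^ m)) := by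
        rw [hF₂.1 12 (by omega)]; simp [Prog.exec, h12]
      have h5' : π.reg 5 = BitVec.ofNat w (D * 2 ^ m) := by rw [hF₃.1 5 (by omega), h5]
      have h0' : π.reg 0 = BitVec.ofNat w n := by
        rw [hF₃.1 0 (by omega), hF.1 0 (by omega), hS.reg0]
      have hval : Expr.eval π (♯21 *ᵣ ♯5 *ᵣ ♭M <ᵣ ♯0 +ᵣ ♭1) =
          if (I.heavy L (D * 2 ^ m)).card * (D * 2 ^ m) * M ≤ n then 1#w else 0#w := by
        have hmul : Op.mul.apply (Op.mul.apply (BitVec.ofNat w (I.heavy L (D * 2 ^ m)).card)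
            (BitVec.ofNat w (D * 2 ^ m))) (BitVec.ofNat w M) =
            BitVec.ofNat w ((I.heavy L (D * 2 ^ m)).card * (D * 2 ^ m) * M) := by
          simp [Op.apply, BitVec.ofNat_mul]
        have hadd : Op.add.apply (BitVec.ofNat w n) (BitVec.ofNat w 1) =
            BitVec.ofNat w (n + 1) := by simp [Op.apply, BitVec.ofNat_add]
        simp only [Expr.eval, h21, h5', h0', hmul, hadd]
        rw [lt_apply _ hn2]
        · simp only [Nat.lt_succ_iff]
        · refine lt_of_le_of_lt ?_ hbig
          exact Nat.mul_le_mul (Nat.mul_le_mul (by omega) (hDj m hm.le)) (by omega)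
      have h2D : Op.add.apply (BitVec.ofNat w (D * 2 ^ m)) (BitVec.ofNat w (D * 2 ^ m)) =
          BitVec.ofNat w (D * 2 ^ (m + 1)) := by
        simp only [Op.apply]; rw [← BitVec.ofNat_add]; congr 1; ring
      have hFπ : Frame 2 σ π := hF.trans (hF₃.mono (by omega))
      refine .straight rfl (by simp [Prog.maxCost, Expr.cost]) ?_
      simp only [Prog.exec, hval, ite_eq_zero hw]
      split_ifs with hg
      · refine ⟨?_, ?_, ?_, Or.inl ⟨m, by omega, hg, ?_⟩⟩
        · simp [hF₃.1, h10]
        · exact ((hFπ.setReg (by omega) _).setReg (by omega) _).setReg (by omega) _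
        · simp [Expr.eval, h5', h2D]
        · simp [Expr.eval, h12']
      · refine ⟨?_, (hFπ.setReg (by omega) _).setReg (by omega) _, ?_, ?_⟩
        · simp [hF₃.1, h10]
        · simp [Expr.eval, h5', h2D]
        · rcases hG with ⟨j, hj, hg', h2⟩ | hG
          · refine Or.inl ⟨j, by omega, hg', ?_⟩
            simp [hF₃.1, h2]
          · refine Or.inr fun j hj => ?_
            rcases Nat.lt_succ_iff_lt_or_eq.1 hj with h | rfl
            · exact hG j h
            · exact hg
  · rintro τ ⟨hF, h5, h⟩ _
    refine ⟨hF, h.resolve_right fun h' => ?_⟩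
    obtain ⟨j, hj, hg⟩ := hex
    exact h' j hj hg

/-- Collect greedily in register `3` vertices of the set in register `1` with disjoint closed
neighborhoods outside of the set in register `2`. -/
def chooseScattered : Prog :=
  3 ::= ♭0 ;; 13 ::= ♭0 ;; forLoop 10 ♯0 (
    14 ::= .load 3 ♯10 |ᵣ (♭1 <<ᵣ ♯10) ;;
    14 ::= ♯14 ^ᵣ (♯14 &ᵣ ♯2) ;;
    .cond (((♯1 >>ᵣ ♯10) &ᵣ ♭1) &ᵣ (((♯2 >>ᵣ ♯10) &ᵣ ♭1) =ᵣ ♭0) &ᵣ ((♯14 &ᵣ ♯13) =ᵣ ♭0))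
      (3 ::= ♯3 |ᵣ (♭1 <<ᵣ ♯10) ;; 13 ::= ♯13 |ᵣ ♯14) .skip)

/-- Register `13` accumulates the union of the closed neighborhoods of the chosen vertices. A
rejected vertex meets this union, and the union only grows, so one pass yields a maximal set. -/
theorem chooseScattered_spec {I : ListInstance (BitVec w)} {k : ℕ} {σ : State w}
    {L H : Finset ℕ} (hn : I.n < w) (hsub : ∀ v, I.nbr v ⊆ range I.n)
    (hS : Stores I k σ) (h1 : σ.reg 1 = enc w L) (h2 : σ.reg 2 = enc w H)
    (hL : L ⊆ range I.n) :
    WP chooseScattered (100 * (I.n + 1)) (fun τ => Frame 3 σ τ ∧ ∃ A, τ.reg 3 = enc w A ∧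
      A ⊆ L \ H ∧
      (∀ u ∈ A, ∀ v ∈ A, u ≠ v → Disjoint (I.closedNbr H u) (I.closedNbr H v)) ∧
      ∀ v ∈ L \ H, ∃ u ∈ A, ¬Disjoint (I.closedNbr H u) (I.closedNbr H v)) σ := by
  have hw : 0 < w := by omega
  refine .seqT 2 (98 * (I.n + 1)) (by nlinarith) (.straight rfl le_rfl ?_)
  refine .seqT 2 (96 * (I.n + 1)) (by omega) (.straight rfl le_rfl ?_)
  refine .forLoopT (fun m τ => Frame 3 σ τ ∧ ∃ A, τ.reg 3 = enc w A ∧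
      τ.reg 13 = enc w (A.biUnion (I.closedNbr H)) ∧
      A ⊆ L \ H ∧ A ⊆ range m ∧
      (∀ u ∈ A, ∀ v ∈ A, u ≠ v → Disjoint (I.closedNbr H u) (I.closedNbr H v)) ∧
      ∀ v ∈ L \ H, v < m → ∃ u ∈ A, ¬Disjoint (I.closedNbr H u) (I.closedNbr H v)) I.n 60
    (by simp only [Expr.cost]; omega) (lt_two_pow hn.le) hw ?_ ?_ ?_ ?_
  · intro m _ τ h _
    simp [Expr.eval, h.1.1, hS.reg0]
  · refine ⟨(((Frame.refl _ _).setReg (by omega) _).setReg (by omega) _).setReg (by omega) _,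
      ∅, ?_⟩
    simp [Prog.exec, Expr.eval, enc_empty]
  · rintro m hm τ ⟨hF, A, h3, h13, hA, hAm, hd, hmax⟩ h10
    have hcsub : ∀ v < I.n, I.closedNbr H v ⊆ range w := fun v hv =>
      sdiff_subset.trans (insert_subset (Finset.mem_range.2 (by omega))
        (subset_range_of_le (hsub v) hn))
    have hbit : Op.shl.apply 1#w (BitVec.ofNat w m) = enc w {m} := bit_eq (by omega)
    have h14 : Op.or.apply (τ.mem 3 (BitVec.ofNat w m)) (enc w {m}) =
        enc w (insert m (I.nbr m)) := by
      rw [hF.2, hS.nbr m hm, Op.apply, enc_union, union_comm, insert_eq]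
    have h14' : Op.xor.apply (enc w (insert m (I.nbr m)))
        (Op.and.apply (enc w (insert m (I.nbr m))) (enc w H)) = enc w (I.closedNbr H m) := by
      rw [Op.apply, Op.apply, enc_sdiff, ListInstance.closedNbr]
    set τ' := ((τ.setReg 14 (enc w (insert m (I.nbr m)))).setReg 14
      (enc w (I.closedNbr H m))) with hτ'
    have hval : Expr.eval τ' (((♯1 >>ᵣ ♯10) &ᵣ ♭1) &ᵣ (((♯2 >>ᵣ ♯10) &ᵣ ♭1) =ᵣ ♭0) &ᵣ
        ((♯14 &ᵣ ♯13) =ᵣ ♭0)) = if (m ∈ L ∧ m ∉ H) ∧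
          I.closedNbr H m ∩ A.biUnion (I.closedNbr H) = ∅ then 1#w else 0#w := by
      have e1 : τ'.reg 1 = enc w L := by simp [hτ', hF.1, h1]
      have e2 : τ'.reg 2 = enc w H := by simp [hτ', hF.1, h2]
      have e3 : τ'.reg 10 = BitVec.ofNat w m := by simp [hτ', h10]
      have e4 : τ'.reg 13 = enc w (A.biUnion (I.closedNbr H)) := by simp [hτ', h13]
      have e5 : τ'.reg 14 = enc w (I.closedNbr H m) := by simp [hτ']
      have e6 : Op.eq.apply (Op.and.apply (Op.shr.apply (enc w H) (BitVec.ofNat w m)) 1#w) 0#w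
          = if m ∉ H then 1#w else 0#w := by
        have : Op.and.apply (Op.shr.apply (enc w H) (BitVec.ofNat w m)) 1#w = _ :=
          bit_test H (show m < w by omega)
        rw [this]
        simp only [Op.apply, ite_eq_zero hw]; rfl
      have e7 : Op.eq.apply (Op.and.apply (enc w (I.closedNbr H m))
          (enc w (A.biUnion (I.closedNbr H)))) 0#w =
          if I.closedNbr H m ∩ A.biUnion (I.closedNbr H) = ∅ then 1#w else 0#w := by
        rw [← eq_zero_apply (inter_subset_left.trans (hcsub m hm)), ← enc_inter]; rfl
      have e8 : Op.and.apply (Op.shr.apply (enc w L) (BitVec.ofNat w m)) 1#w = _ :=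
          bit_test L (show m < w by omega)
      simp only [Expr.eval, e1, e2, e3, e4, e5, e6, e7, e8]
      simp only [Op.apply]
      rw [ite_and_ite, ite_and_ite]
    have hex : Prog.exec (14 ::= .load 3 ♯10 |ᵣ (♭1 <<ᵣ ♯10) ;;
        14 ::= ♯14 ^ᵣ (♯14 &ᵣ ♯2)) τ = τ' := by
      simp [Prog.exec, Expr.eval, h10, hbit, h14, hF.1, h2, h14', hτ']
    have hFτ' : Frame 3 σ τ' := (hF.setReg (by omega) _).setReg (by omega) _
    refine .straight rfl (by simp [Prog.maxCost, Expr.cost]) ?_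
    have hex' : ∀ p : Prog, Prog.exec (14 ::= .load 3 ♯10 |ᵣ (♭1 <<ᵣ ♯10) ;;
        14 ::= ♯14 ^ᵣ (♯14 &ᵣ ♯2) ;; p) τ = p.exec τ' := fun p => by
      rw [← hex]; rfl
    rw [hex']
    simp only [Prog.exec, hval, ite_eq_zero hw]
    split_ifs with hg
    · obtain ⟨hmL, hdis⟩ := hg
      rw [← disjoint_iff_inter_eq_empty, disjoint_biUnion_right] at hdis
      -- A chosen vertex is its own witness for maximality: being outside `H`, it lies in its closed
      -- neighborhood.
      have hmself : ¬Disjoint (I.closedNbr H m) (I.closedNbr H m) := by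
        rw [disjoint_self, bot_eq_empty, ← ne_eq, ← nonempty_iff_ne_empty]
        exact ⟨m, Finset.mem_sdiff.2 ⟨mem_insert_self _ _, hmL.2⟩⟩
      refine ⟨by simp [hτ', h10],
        ((hFτ'.setReg (by omega) _).setReg (by omega) _).setReg (by omega) _, insert m A,
        ?_, ?_, ?_, ?_, ?_, ?_⟩
      · simp [Expr.eval, hτ', h3, h10, hbit]
        rw [Op.apply, enc_union, union_comm, ← insert_eq]
      · simp [Expr.eval, hτ', h13]
        simp [Op.apply, enc_union, union_comm]
      · exact insert_subset (Finset.mem_sdiff.2 hmL) hA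
      · exact insert_subset (by simp) (hAm.trans (range_subset_range.2 (by omega)))
      · intro u hu v hv huv
        rcases mem_insert.1 hu with rfl | hu' <;> rcases mem_insert.1 hv with rfl | hv'
        · exact absurd rfl huv
        · exact hdis v hv'
        · exact (hdis u hu').symm
        · exact hd u hu' v hv' huv
      · intro v hv hvm
        rcases Nat.lt_succ_iff_lt_or_eq.1 hvm with h | rfl
        · obtain ⟨u, hu, h'⟩ := hmax v hv h
          exact ⟨u, mem_insert_of_mem hu, h'⟩
        · exact ⟨v, mem_insert_self _ _, hmself⟩
    · refine ⟨by simp [hτ', h10], hFτ'.setReg (by omega) _, A, ?_, ?_, hA, ?_, hd, ?_⟩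
      · simp [hτ', h3]
      · simp [hτ', h13]
      · exact hAm.trans (range_subset_range.2 (by omega))
      · intro v hv hvm
        rcases Nat.lt_succ_iff_lt_or_eq.1 hvm with h | rfl
        · exact hmax v hv h
        · by_contra hcon
          push Not at hcon
          refine hg ⟨Finset.mem_sdiff.1 hv, ?_⟩
          rw [← disjoint_iff_inter_eq_empty, disjoint_biUnion_right]
          exact fun u hu => (hcon u hu).symm
  · rintro τ ⟨hF, A, h3, h13, hA, hAm, hd, hmax⟩ _
    exact ⟨hF, A, h3, hA, hd, fun v hv =>
      hmax v hv (Finset.mem_range.1 (hL (Finset.mem_sdiff.1 hv).1))⟩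

end WordRAM

/-! ### Listing the trimmed family with its stable set counts. -/

section

open Finset

theorem trimmed_mono {N : ℕ → Finset ℕ} {A P P' : Finset ℕ} (h : P ⊆ P') :
    trimmed N A P ⊆ trimmed N A P' := fun _ hS =>
  mem_trimmed.2 ⟨(mem_trimmed.1 hS).1.trans h, (mem_trimmed.1 hS).2⟩

/-- The sets that are obtained from those in `l` by adding `u`, unless `u ∈ A` gets isolated. -/
def addVertex (N : ℕ → Finset ℕ) (A : Finset ℕ) (u : ℕ) (l : List (Finset ℕ)) :
    List (Finset ℕ) :=
  (l.filter fun X => u ∈ A → (X ∩ N u).Nonempty).map (insert u)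

/-- `l` lists the subsets of `P` in which no element of `A` is isolated. -/
def Enumerates (N : ℕ → Finset ℕ) (A P : Finset ℕ) (l : List (Finset ℕ)) : Prop :=
  l.Nodup ∧ ∀ X, X ∈ l ↔ X ∈ trimmed N A P

theorem Enumerates.length_eq {N : ℕ → Finset ℕ} {A P : Finset ℕ} {l : List (Finset ℕ)}
    (h : Enumerates N A P l) : l.length = (trimmed N A P).card := by
  rw [← List.toFinset_card_of_nodup h.1]
  congr 1
  ext X
  simp [h.2]

/-- The new sets are the old ones with `u` added. By `hA`, `u` is not a neighbor of any element of
`A` in `P`, so deleting `u` from a trimmed set isolates none of them, and the result was listed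
before. Without this, sets dropped earlier would have to come back. -/
theorem Enumerates.addVertex {N : ℕ → Finset ℕ} (hN : IsNbhd N) {A P : Finset ℕ} {u : ℕ}
    {l : List (Finset ℕ)} (hl : Enumerates N A P l) (hu : u ∉ P) (hA : ∀ v ∈ A, v ∈ P → u ∉ N v) :
    Enumerates N A (insert u P) (l ++ addVertex N A u l) := by
  have huX : ∀ X ∈ l, u ∉ X := fun X hX h => hu ((mem_trimmed.1 ((hl.2 X).1 hX)).1 h)
  constructor
  · refine List.nodup_append'.2 ⟨hl.1, ?_, ?_⟩
    · refine List.Nodup.map_on ?_ (hl.1.filter _)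
      intro X hX Y hY h
      rw [← erase_insert (huX X (List.mem_filter.1 hX).1),
        ← erase_insert (huX Y (List.mem_filter.1 hY).1), h]
    · intro X hX hX'
      obtain ⟨Y, _, rfl⟩ := List.mem_map.1 hX'
      exact huX _ hX (mem_insert_self _ _)
  · intro X
    simp only [_root_.addVertex, List.mem_append, List.mem_map, List.mem_filter, hl.2,
      decide_eq_true_eq]
    constructor
    · rintro (h | ⟨Y, ⟨hY, hc⟩, rfl⟩)
      · exact trimmed_mono (subset_insert _ _) h
      · obtain ⟨hYP, hY⟩ := mem_trimmed.1 hY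
        refine mem_trimmed.2 ⟨insert_subset_insert _ hYP, fun v hv hvX => ?_⟩
        rcases mem_insert.1 hvX with rfl | hvY
        · rw [insert_inter_of_notMem (hN.irrefl _)]
          exact hc hv
        · exact (hY v hv hvY).mono (inter_subset_inter (subset_insert _ _) le_rfl)
    · intro h
      obtain ⟨hXP, hX⟩ := mem_trimmed.1 h
      by_cases huX : u ∈ X
      · refine Or.inr ⟨X.erase u, ⟨mem_trimmed.2 ⟨?_, fun v hv hvX => ?_⟩, fun huA => ?_⟩,
          insert_erase huX⟩
        · rwa [← subset_insert_iff]
        · have hvP : v ∈ P := (mem_insert.1 (hXP (mem_of_mem_erase hvX))).resolve_left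
            (ne_of_mem_erase hvX)
          have := hX v hv (mem_of_mem_erase hvX)
          rwa [← insert_erase huX, insert_inter_of_notMem (hA v hv hvP)] at this
        · have := hX u huA huX
          rwa [← insert_erase huX, insert_inter_of_notMem (hN.irrefl _)] at this
      · exact Or.inl (mem_trimmed.2 ⟨(subset_insert_iff_of_notMem huX).1 hXP, hX⟩)

/-- The recursion for stable set counts looks up `X \ N u`, which must already be in the table. The
elements of `A` keep their neighbors in `X` because none of these lies in `N u`. -/
theorem sdiff_mem_trimmed {N : ℕ → Finset ℕ} {A P : Finset ℕ} {u : ℕ} {X : Finset ℕ}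
    (hX : X ∈ trimmed N A P) (hA : ∀ v ∈ A, v ∈ P → Disjoint (N u ∩ P) (N v)) :
    X \ N u ∈ trimmed N A P := by
  obtain ⟨hXP, hX⟩ := mem_trimmed.1 hX
  refine mem_trimmed.2 ⟨sdiff_subset.trans hXP, fun v hv hvX => ?_⟩
  have hvX := (Finset.mem_sdiff.1 hvX).1
  obtain ⟨x, hx⟩ := hX v hv hvX
  rw [mem_inter] at hx
  refine ⟨x, mem_inter.2 ⟨Finset.mem_sdiff.2 ⟨hx.1, fun hxu => ?_⟩, hx.2⟩⟩
  exact disjoint_left.1 (hA v hv (hXP hvX)) (mem_inter.2 ⟨hxu, hXP hx.1⟩) hx.2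

namespace WordRAM

variable {w : ℕ}

/-- The states `σ` and `τ` agree except in the registers `R` and in the memory banks `B`. -/
def Keeps (R B : Finset ℕ) (σ τ : State w) : Prop :=
  (∀ x ∉ R, τ.reg x = σ.reg x) ∧ ∀ b ∉ B, τ.mem b = σ.mem b

theorem Keeps.refl (R B : Finset ℕ) (σ : State w) : Keeps R B σ σ :=
  ⟨fun _ _ => rfl, fun _ _ => rfl⟩

theorem Keeps.trans {R B : Finset ℕ} {σ τ ρ : State w} (h : Keeps R B σ τ) (h' : Keeps R B τ ρ) :
    Keeps R B σ ρ :=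
  ⟨fun x hx => (h'.1 x hx).trans (h.1 x hx), fun x hx => (h'.2 x hx).trans (h.2 x hx)⟩

theorem Keeps.mono {R B R' B' : Finset ℕ} {σ τ : State w} (h : Keeps R B σ τ) (hR : R ⊆ R')
    (hB : B ⊆ B') : Keeps R' B' σ τ :=
  ⟨fun x hx => h.1 x fun h' => hx (hR h'), fun x hx => h.2 x fun h' => hx (hB h')⟩

theorem Keeps.setReg {R B : Finset ℕ} {x : ℕ} {σ τ : State w} (h : Keeps R B σ τ) (hx : x ∈ R)
    (v : BitVec w) : Keeps R B σ (τ.setReg x v) :=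
  ⟨fun y hy => by
    rw [State.setReg_reg, if_neg (fun e => hy (by rw [e]; exact hx)), h.1 y hy], h.2⟩

theorem Keeps.setMem {R B : Finset ℕ} {b : ℕ} {σ τ : State w} (h : Keeps R B σ τ) (hb : b ∈ B)
    (a v : BitVec w) : Keeps R B σ (τ.setMem b a v) :=
  ⟨h.1, fun c hc => by
    rw [State.setMem_mem_ne _ (fun e => hc (by rw [e]; exact hb)), h.2 c hc]⟩

/-- The list `l` is stored in bank `4`, and the numbers of stable subsets of its elements are in
bank `5`. -/
structure StoresList (N : ℕ → Finset ℕ) (l : List (Finset ℕ)) (σ : State w) : Prop where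
  length : σ.reg 4 = BitVec.ofNat w l.length
  list : ∀ i (h : i < l.length), σ.mem 4 (BitVec.ofNat w i) = enc w l[i]
  count : ∀ X ∈ l, σ.mem 5 (enc w X) = (stableCount N X : BitVec w)

theorem StoresList.of_eq {N : ℕ → Finset ℕ} {l : List (Finset ℕ)} {σ τ : State w}
    (h : StoresList N l σ) (h4 : τ.reg 4 = σ.reg 4) (hm4 : τ.mem 4 = σ.mem 4)
    (hm5 : τ.mem 5 = σ.mem 5) : StoresList N l τ where
  length := h4.trans h.length
  list := by rw [hm4]; exact h.list
  count := by rw [hm5]; exact h.count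

theorem StoresList.append {N : ℕ → Finset ℕ} {l : List (Finset ℕ)} {σ τ : State w}
    (h : StoresList N l σ) {X : Finset ℕ} (hl : l.length + 1 < 2 ^ w)
    (hsub : ∀ Y ∈ l, Y ⊆ range w) (hX : X ⊆ range w)
    (h4 : τ.reg 4 = BitVec.ofNat w (l.length + 1))
    (hm4 : τ.mem 4 = Function.update (σ.mem 4) (BitVec.ofNat w l.length) (enc w X))
    (hm5 : τ.mem 5 = Function.update (σ.mem 5) (enc w X) (stableCount N X : BitVec w)) :
    StoresList N (l ++ [X]) τ where
  length := by simpa using h4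
  list := by
    intro i hi
    simp only [List.length_append, List.length_singleton] at hi
    rw [hm4, Function.update_apply]
    by_cases h' : i = l.length
    · subst h'; simp
    · rw [if_neg (by rwa [ofNat_inj (by omega) (by omega)]), List.getElem_append_left (by omega)]
      exact h.list i (by omega)
  count := by
    intro Y hY
    rw [hm5, Function.update_apply]
    by_cases h' : Y = X
    · subst h'; simp
    · have hY : Y ∈ l := by simpa [h'] using hY
      rw [if_neg (by rwa [enc_inj (hsub Y hY) hX])]
      exact h.count Y hY

/-- Extend the stored list by the vertex in register `10`. -/
def extendStep : Prog :=
  15 ::= ♯4 ;; forLoop 11 ♯15 (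
    16 ::= .load 4 ♯11 ;;
    .cond ((((♯3 >>ᵣ ♯10) &ᵣ ♭1) =ᵣ ♭0) |ᵣ (((♯16 &ᵣ .load 3 ♯10) =ᵣ ♭0) =ᵣ ♭0))
      (.store 5 (♯16 |ᵣ (♭1 <<ᵣ ♯10))
        (.load 5 ♯16 +ᵣ .load 5 (♯16 ^ᵣ (♯16 &ᵣ .load 3 ♯10))) ;;
       .store 4 ♯4 (♯16 |ᵣ (♭1 <<ᵣ ♯10)) ;;
       4 ::= ♯4 +ᵣ ♭1) .skip)

theorem eq_zero_ite (hw : 0 < w) (p : Prop) [Decidable p] :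
    Op.eq.apply (if p then 1#w else 0#w) 0#w = if ¬p then 1#w else 0#w := by
  simp only [Op.apply, ite_eq_zero hw]; rfl

/-- The length is saved in register `15` beforehand, so the loop visits only the old sets while new
ones are appended. Bank `5` is indexed by the words of the sets; by `hcl` both entries needed for
`insert u X` are present. -/
theorem extendStep_spec {N : ℕ → Finset ℕ} (hN : IsNbhd N) {A : Finset ℕ} {n u : ℕ}
    {l : List (Finset ℕ)} {σ : State w} (hn : n < w) (hu : u < n) (hlen : 2 * l.length < 2 ^ w)
    (hsub : ∀ X ∈ l, X ⊆ range n) (huX : ∀ X ∈ l, u ∉ X) (hcl : ∀ X ∈ l, X \ N u ∈ l)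
    (h3 : σ.reg 3 = enc w A) (h10 : σ.reg 10 = BitVec.ofNat w u)
    (hm3 : σ.mem 3 (BitVec.ofNat w u) = enc w (N u)) (hl : StoresList N l σ) :
    WP extendStep (100 * (l.length + 1)) (fun τ => Keeps {4, 11, 15, 16} {4, 5} σ τ ∧
      StoresList N (l ++ addVertex N A u l) τ) σ := by
  have hw : 0 < w := by omega
  refine .seqT 2 (100 * l.length + 10) (by omega) (.straight rfl le_rfl ?_)
  refine .forLoopT (fun t τ => Keeps {4, 11, 15, 16} {4, 5} σ τ ∧
      τ.reg 15 = BitVec.ofNat w l.length ∧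
      StoresList N (l ++ addVertex N A u (l.take t)) τ) l.length 80
    (by simp only [Expr.cost]; omega) (by omega) hw ?_ ?_ ?_ ?_
  · intro m _ τ h _
    simp [Expr.eval, h.2.1]
  · refine ⟨((Keeps.refl _ _ _).setReg (by decide) _).setReg (by decide) _, ?_, ?_⟩
    · simp [Prog.exec, Expr.eval, hl.length]
    · simp only [List.take_zero, addVertex, List.filter_nil, List.map_nil, List.append_nil]
      exact hl.of_eq (by simp [Prog.exec]) rfl rfl
  · rintro t ht τ ⟨hK, h15, hS⟩ h11
    set X := l[t] with hX
    have hXl : X ∈ l := List.getElem_mem _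
    set l' := l ++ addVertex N A u (l.take t) with hl'
    have hlen' : l'.length ≤ l.length + t := by
      simp only [hl', List.length_append, addVertex, List.length_map]
      have := List.length_filter_le (fun X => decide (u ∈ A → (X ∩ N u).Nonempty)) (l.take t)
      simp only [List.length_take] at this
      omega
    have h16 : τ.mem 4 (BitVec.ofNat w t) = enc w X := by
      rw [hS.list t (by rw [hl', List.length_append]; omega)]
      simp [hl', hX, List.getElem_append_left ht]
    have hadd : addVertex N A u (l.take (t + 1)) = addVertex N A u (l.take t) ++
        if u ∈ A → (X ∩ N u).Nonempty then [insert u X] else [] := by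
      rw [List.take_add_one, List.getElem?_eq_getElem ht]
      simp only [addVertex, List.filter_append, List.map_append, Option.toList_some, ← hX,
        List.filter_cons, List.filter_nil]
      congr 1
      by_cases hc : u ∈ A → (X ∩ N u).Nonempty
      · rw [if_pos hc, if_pos (decide_eq_true hc)]; rfl
      · rw [if_neg hc, if_neg (by simpa using hc)]; rfl
    rw [hadd, ← List.append_assoc, ← hl']
    set τ' := τ.setReg 16 (enc w X) with hτ'
    have hKτ' : Keeps {4, 11, 15, 16} {4, 5} σ τ' := hK.setReg (by decide) _
    have e3 : τ'.reg 3 = enc w A := by rw [hKτ'.1 3 (by decide), h3]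
    have e10 : τ'.reg 10 = BitVec.ofNat w u := by rw [hKτ'.1 10 (by decide), h10]
    have e16 : τ'.reg 16 = enc w X := by simp [hτ']
    have em3 : τ'.mem 3 (BitVec.ofNat w u) = enc w (N u) := by rw [hKτ'.2 3 (by decide), hm3]
    have e4 : τ'.reg 4 = BitVec.ofNat w l'.length := by simp [hτ', hS.length]
    have hXw : X ⊆ range w := subset_range_of_le (hsub X hXl) hn
    have hval : Expr.eval τ' ((((♯3 >>ᵣ ♯10) &ᵣ ♭1) =ᵣ ♭0) |ᵣ
        (((♯16 &ᵣ .load 3 ♯10) =ᵣ ♭0) =ᵣ ♭0)) =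
        if u ∈ A → (X ∩ N u).Nonempty then 1#w else 0#w := by
      have e6 : Op.and.apply (Op.shr.apply (enc w A) (BitVec.ofNat w u)) 1#w = _ :=
        bit_test A (show u < w by omega)
      have e7 : Op.eq.apply (Op.and.apply (enc w X) (enc w (N u))) 0#w =
          if X ∩ N u = ∅ then 1#w else 0#w := by
        rw [← eq_zero_apply (inter_subset_left.trans hXw), ← enc_inter]; rfl
      simp only [Expr.eval, e3, e10, e16, em3, e6, e7, eq_zero_ite hw]
      simp only [Op.apply]
      rw [ite_or_ite]
      simp only [← ne_eq, ← nonempty_iff_ne_empty, imp_iff_not_or]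
    have hins : Op.or.apply (enc w X) (Op.shl.apply (BitVec.ofNat w 1) (BitVec.ofNat w u)) =
        enc w (insert u X) := by
      have : Op.shl.apply (BitVec.ofNat w 1) (BitVec.ofNat w u) = enc w {u} := bit_eq (by omega)
      rw [this, Op.apply, enc_union, union_comm, ← insert_eq]
    have hdiff : Op.xor.apply (enc w X) (Op.and.apply (enc w X) (enc w (N u))) =
        enc w (X \ N u) := by rw [Op.apply, Op.apply, enc_sdiff]
    have hcnt : ∀ Y ∈ l, τ'.mem 5 (enc w Y) = (stableCount N Y : BitVec w) := fun Y hY =>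
      hS.count Y (by simp [hl', hY])
    refine .straight rfl (by simp [Prog.maxCost, Expr.cost]) ?_
    have hexec : ∀ p : Prog, Prog.exec (16 ::= .load 4 ♯11 ;; p) τ = p.exec τ' := fun p => by
      simp [Prog.exec, Expr.eval, h11, h16, hτ']
    rw [hexec]
    simp only [Prog.exec, hval, ite_eq_zero hw]
    have h11' : τ'.reg 11 = BitVec.ofNat w t := by simp [hτ', h11]
    have h15' : τ'.reg 15 = BitVec.ofNat w l.length := by simp [hτ', h15]
    by_cases hc : u ∈ A → (X ∩ N u).Nonempty
    · rw [if_neg (not_not.2 hc), if_pos hc]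
      refine ⟨by simp [h11'], ?_, by simp [h15'], ?_⟩
      · exact (((hKτ'.setMem (by decide) _ _).setMem (by decide) _ _).setReg
          (by decide) _).setReg (by decide) _
      · refine hS.append (by omega) ?_ ?_ ?_ ?_ ?_
        · intro Y hY
          rcases List.mem_append.1 hY with hY | hY
          · exact subset_range_of_le (hsub Y hY) hn
          · obtain ⟨Z, hZ, rfl⟩ := List.mem_map.1 hY
            exact insert_subset (Finset.mem_range.2 (by omega))
              (subset_range_of_le (hsub Z (List.mem_of_mem_take (List.mem_filter.1 hZ).1)) hn)
        · exact insert_subset (Finset.mem_range.2 (by omega)) hXw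
        · simp [Expr.eval, Op.apply, e4, BitVec.ofNat_add]
        · simp only [State.setReg_mem, Expr.eval, State.setMem_reg, e16, e10, hins, e4]
          simp [State.setMem, hτ']
        · simp only [State.setReg_mem, Expr.eval, State.setMem_reg, e16, e10, hins, em3, hdiff,
            hcnt X hXl, hcnt _ (hcl X hXl)]
          rw [State.setMem_mem_ne _ (by decide), hN.stableCount_insert (huX X hXl)]
          simp [State.setMem, hτ', Op.apply]
    · rw [if_pos hc, if_neg hc, List.append_nil]
      refine ⟨by simp [h11'], hKτ'.setReg (by decide) _, by simp [h15'],
        hS.of_eq (by simp [hτ']) rfl rfl⟩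
  · rintro τ ⟨hK, -, hS⟩ -
    rw [List.take_length] at hS
    exact ⟨hK, hS⟩

/-- Extend the stored list by the vertices of the set in register `r`. -/
def extendBy (r : ℕ) : Prog :=
  forLoop 10 ♯0 (.cond ((♯r >>ᵣ ♯10) &ᵣ ♭1) extendStep .skip)

/-- The trimmed family grows with the ground set, so every intermediate list is at most as long as
the final one, which gives the cost. `h1` keeps the enumeration complete when a vertex is added, and
`h2` keeps the recursive lookups inside the table. -/
theorem extendBy_spec {I : ListInstance (BitVec w)} (hN : IsNbhd I.nbr)
    {A P B : Finset ℕ} {k r : ℕ} {l : List (Finset ℕ)}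
    {σ : State w} (hn : I.n + 1 < w) (hP : P ⊆ range I.n) (hB : B ⊆ range I.n)
    (hPB : Disjoint P B) (h1 : ∀ u ∈ B, ∀ v ∈ A, v ∈ P ∪ B → u ∉ I.nbr v)
    (h2 : ∀ u ∈ B, ∀ v ∈ A, v ∈ P ∪ B → v ≠ u → Disjoint (I.nbr u ∩ (P ∪ B)) (I.nbr v))
    (hr : r ∉ ({4, 10, 11, 15, 16} : Finset ℕ)) (hS : Stores I k σ)
    (h3 : σ.reg 3 = enc w A) (hrB : σ.reg r = enc w B) (hl : Enumerates I.nbr A P l)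
    (hSl : StoresList I.nbr l σ) :
    WP (extendBy r) (200 * (I.n + 1) * ((trimmed I.nbr A (P ∪ B)).card + 1))
      (fun τ => Keeps {4, 10, 11, 15, 16} {4, 5} σ τ ∧
        ∃ l, Enumerates I.nbr A (P ∪ B) l ∧ StoresList I.nbr l τ) σ := by
  have hw : 0 < w := by omega
  obtain ⟨F, hF⟩ : ∃ F, F = (trimmed I.nbr A (P ∪ B)).card := ⟨_, rfl⟩
  rw [← hF]
  refine .forLoopT (fun m τ => Keeps {4, 10, 11, 15, 16} {4, 5} σ τ ∧
        ∃ l, Enumerates I.nbr A (P ∪ (B ∩ range m)) l ∧ StoresList I.nbr l τ)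
    I.n (100 * (F + 1) + 10)
    (by
      simp only [Expr.cost]
      have h1 : I.n * (100 * (F + 1) + 10 + 1 + 7) ≤ I.n * (118 * (F + 1)) :=
        Nat.mul_le_mul_left _ (by omega)
      have h2 : 1 ≤ (I.n + 1) * (F + 1) := Nat.mul_pos (by omega) (by omega)
      have h3 : I.n * (F + 1) ≤ (I.n + 1) * (F + 1) := Nat.mul_le_mul_right _ (by omega)
      rw [Nat.mul_left_comm] at h1
      rw [mul_assoc]
      omega) (lt_two_pow (by omega)) hw ?_ ?_ ?_ ?_
  · intro m _ τ h _
    simp [Expr.eval, h.1.1 0 (by decide), hS.reg0]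
  · refine ⟨(Keeps.refl _ _ _).setReg (by decide) _, l, by simpa using hl, ?_⟩
    exact hSl.of_eq (by simp) rfl rfl
  · rintro m hm τ ⟨hK, l, hl, hSl⟩ h10
    have hval : Expr.eval τ ((♯r >>ᵣ ♯10) &ᵣ ♭1) = if m ∈ B then 1#w else 0#w := by
      simp only [Expr.eval, Op.apply]
      rw [hK.1 r hr, hrB, h10]
      exact bit_test B (by omega)
    refine (WP.cond (T₁ := 100 * (F + 1)) (T₂ := 1) ?_ ?_).mono
      (by simp only [Expr.cost]; omega) (fun _ h => h)
    · rw [hval, ne_eq, ite_eq_zero hw, not_not]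
      intro hmB
      have hsubP : P ∪ (B ∩ range m) ⊆ P ∪ B := union_subset_union_right inter_subset_left
      have hmP : m ∉ P ∪ (B ∩ range m) := by
        rw [mem_union, not_or]
        exact ⟨fun h => disjoint_left.1 hPB h hmB, by simp⟩
      have hlen : l.length ≤ F := by
        rw [hl.length_eq, hF]
        exact card_le_card (trimmed_mono hsubP)
      have hFn : F ≤ 2 ^ I.n := by
        calc F ≤ (P ∪ B).powerset.card := hF ▸ card_filter_le _ _
          _ = 2 ^ (P ∪ B).card := card_powerset _
          _ ≤ 2 ^ I.n := Nat.pow_le_pow_right (by norm_num)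
            (by simpa using card_le_card (union_subset hP hB))
      -- A step at most doubles a list of at most 2^n sets; this is where `n + 1 < w` is needed.
      have hpow : 2 * 2 ^ I.n < 2 ^ w := by
        rw [← pow_succ']
        exact Nat.pow_lt_pow_right (by norm_num) (by omega)
      have hlP : ∀ X ∈ l, X ⊆ P ∪ (B ∩ range m) := fun X hX =>
        (mem_trimmed.1 ((hl.2 X).1 hX)).1
      refine (extendStep_spec (n := I.n) (A := A) (u := m) hN (by omega) hm (by omega)
        (fun X hX => (hlP X hX).trans (hsubP.trans (union_subset hP hB)))
        (fun X hX h => hmP (hlP X hX h)) (fun X hX => ?_) ?_ h10 ?_ hSl).mono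
        (by omega) ?_
      · rw [hl.2] at hX ⊢
        refine sdiff_mem_trimmed hX fun v hv hvP => ?_
        exact (h2 m hmB v hv (hsubP hvP) fun h => hmP (h ▸ hvP)).mono_left
          (inter_subset_inter le_rfl hsubP)
      · rw [hK.1 3 (by decide), h3]
      · rw [hK.2 3 (by decide), hS.nbr m hm]
      · rintro ρ ⟨hK', hSl'⟩
        refine ⟨by rw [hK'.1 10 (by decide), h10], (hK.trans (hK'.mono (by decide)
          (by decide))).setReg (by decide) _, _, ?_, hSl'.of_eq (by simp) rfl rfl⟩
        have := hl.addVertex hN hmP fun v hv hvP => h1 m hmB v hv (hsubP hvP)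
        rwa [range_add_one, inter_insert_of_mem hmB, union_insert]
    · rw [hval, ite_eq_zero hw]
      intro hmB
      refine .skip ⟨h10, hK.setReg (by decide) _, l, ?_, hSl.of_eq (by simp) rfl rfl⟩
      rwa [range_add_one, inter_insert_of_notMem hmB]
  · rintro τ ⟨hK, l, hl, hSl⟩ -
    rw [inter_eq_left.2 hB] at hl
    exact ⟨hK, l, hl, hSl⟩

/-- List the sets of vertices outside of the set in register `2` in which no element of the set in
register `3` is isolated. -/
def listTrimmed : Prog :=
  (14 ::= (♭1 <<ᵣ ♯0) -ᵣ ♭1 ;;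
   14 ::= ♯14 ^ᵣ (♯14 &ᵣ (♯2 |ᵣ ♯3)) ;;
   .store 4 ♭0 ♭0 ;;
   .store 5 ♭0 ♭1 ;;
   4 ::= ♭1) ;;
  extendBy 14 ;;
  extendBy 3

/-- The order matters: the vertices of `A` come last. While the others are added, no element of `A`
is in the ground set and the side conditions are void. For `A` itself they follow from its stability
and the disjointness of the neighborhoods outside `H`. -/
theorem listTrimmed_spec {I : ListInstance (BitVec w)} (hN : IsNbhd I.nbr)
    {A H : Finset ℕ} {k : ℕ} {σ : State w}
    (hn : I.n + 1 < w) (hA : A ⊆ range I.n \ H)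
    (hdis : ∀ u ∈ A, ∀ v ∈ A, u ≠ v → Disjoint (I.closedNbr H u) (I.closedNbr H v))
    (hS : Stores I k σ) (h2 : σ.reg 2 = enc w H) (h3 : σ.reg 3 = enc w A) :
    WP listTrimmed (500 * (I.n + 1) * ((trimmed I.nbr A (range I.n \ H)).card + 1))
      (fun τ => Keeps {4, 10, 11, 14, 15, 16} {4, 5} σ τ ∧
        ∃ l, Enumerates I.nbr A (range I.n \ H) l ∧ StoresList I.nbr l τ) σ := by
  have hw : 0 < w := by omega
  obtain ⟨F, hF⟩ : ∃ F, F = (trimmed I.nbr A (range I.n \ H)).card := ⟨_, rfl⟩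
  rw [← hF]
  have hst : ∀ u ∈ A, ∀ v ∈ A, u ∉ I.nbr v := by
    intro u hu v hv huv
    by_cases h : u = v
    · subst h; exact hN.irrefl _ huv
    · have huH := (Finset.mem_sdiff.1 (hA hu)).2
      exact disjoint_left.1 (hdis u hu v hv h)
        (Finset.mem_sdiff.2 ⟨mem_insert_self _ _, huH⟩)
        (Finset.mem_sdiff.2 ⟨mem_insert_of_mem huv, huH⟩)
  refine .seqT 40 (400 * (I.n + 1) * (F + 1)) (by
    have h2 : 1 ≤ (I.n + 1) * (F + 1) := Nat.mul_pos (by omega) (by omega)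
    rw [mul_assoc, mul_assoc]
    omega) (.straight rfl
    (by simp [Prog.maxCost, Expr.cost]) ?_)
  set B := range I.n \ (H ∪ A) with hB
  have hBA : B ∪ A = range I.n \ H := by
    ext x
    have := @hA x
    simp only [hB, mem_union, Finset.mem_sdiff] at this ⊢
    tauto
  have hBdis : Disjoint B A := by
    rw [disjoint_left]
    intro x hx hx'
    simp [hB, hx'] at hx
  set τ : State w := Prog.exec (14 ::= (♭1 <<ᵣ ♯0) -ᵣ ♭1 ;;
   14 ::= ♯14 ^ᵣ (♯14 &ᵣ (♯2 |ᵣ ♯3)) ;;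
   .store 4 ♭0 ♭0 ;;
   .store 5 ♭0 ♭1 ;;
   4 ::= ♭1) σ with hτ
  have hK : Keeps {4, 10, 11, 14, 15, 16} {4, 5} σ τ :=
    (((((Keeps.refl _ _ _).setReg (by decide) _).setReg (by decide) _).setMem
      (by decide) _ _).setMem (by decide) _ _).setReg (by decide) _
  have hSτ : Stores I k τ := hS.of_eq (hK.1 0 (by decide)) (hK.2 1 (by decide))
    (hK.2 2 (by decide)) (hK.2 3 (by decide))
  have h3τ : τ.reg 3 = enc w A := by rw [hK.1 3 (by decide), h3]
  have h14τ : τ.reg 14 = enc w B := by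
    have e : Op.sub.apply (Op.shl.apply (BitVec.ofNat w 1) (BitVec.ofNat w I.n))
        (BitVec.ofNat w 1) = enc w (range I.n) := by
      rw [enc_range (by omega), ← bit_eq (by omega)]; rfl
    simp only [hτ, Prog.exec, Expr.eval, State.setReg_reg, State.setMem_reg, if_true,
      show ¬ (14 = 4) by decide, show ¬ (2 = 14) by decide, show ¬ (3 = 14) by decide, if_false,
      hS.reg0, e, h2, h3]
    simp only [Op.apply]
    rw [enc_union, enc_sdiff]
  have hSl : StoresList I.nbr [∅] τ := by
    refine ⟨by simp [hτ, Prog.exec, Expr.eval], ?_, ?_⟩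
    · intro i hi
      have : i = 0 := by simpa using hi
      subst this
      simp [hτ, Prog.exec, Expr.eval, State.setMem_mem, enc_empty]
    · intro X hX
      have : X = ∅ := by simpa using hX
      subst this
      simp [hτ, Prog.exec, Expr.eval, State.setMem_mem, enc_empty, stableCount_empty]
  have hl : Enumerates I.nbr A ∅ [∅] := by
    refine ⟨by simp, fun X => ?_⟩
    simp only [List.mem_singleton, mem_trimmed, subset_empty]
    exact ⟨by rintro rfl; simp, fun h => h.1⟩
  refine .seqT (200 * (I.n + 1) * (F + 1)) (200 * (I.n + 1) * (F + 1)) (by ring_nf; rfl) ?_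
  refine (extendBy_spec (A := A) (P := ∅) (B := B) (r := 14) hN hn (by simp) sdiff_subset
    (by simp) ?_ ?_ (by decide) hSτ h3τ h14τ hl hSl).mono ?_ ?_
  · intro u hu v hv hv'
    rw [empty_union] at hv'
    exact absurd hv (disjoint_left.1 hBdis hv')
  · intro u hu v hv hv'
    rw [empty_union] at hv'
    exact absurd hv (disjoint_left.1 hBdis hv')
  · rw [empty_union]
    rw [hF]
    refine Nat.mul_le_mul_left _ (Nat.succ_le_succ (card_le_card (trimmed_mono ?_)))
    rw [← hBA]; exact subset_union_left
  · rw [empty_union]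
    rintro ρ ⟨hK', l, hl, hSl⟩
    have hSρ : Stores I k ρ := hSτ.of_eq (hK'.1 0 (by decide)) (hK'.2 1 (by decide))
      (hK'.2 2 (by decide)) (hK'.2 3 (by decide))
    have h3ρ : ρ.reg 3 = enc w A := by rw [hK'.1 3 (by decide), h3τ]
    refine (extendBy_spec (A := A) (P := B) (B := A) (r := 3) hN hn sdiff_subset
      (hA.trans sdiff_subset) hBdis ?_ ?_ (by decide) hSρ h3ρ h3ρ hl hSl).mono
      (by rw [hBA, hF]) ?_
    · exact fun u hu v hv _ => hst u hu v hv
    · intro u hu v hv _ hne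
      rw [hBA, disjoint_left]
      intro x hx hxv
      obtain ⟨hxu, hxP⟩ := mem_inter.1 hx
      have hxH := (Finset.mem_sdiff.1 hxP).2
      exact disjoint_left.1 (hdis u hu v hv hne.symm)
        (Finset.mem_sdiff.2 ⟨mem_insert_of_mem hxu, hxH⟩)
        (Finset.mem_sdiff.2 ⟨mem_insert_of_mem hxv, hxH⟩)
    · rintro π ⟨hK'', l, hl, hSl⟩
      rw [hBA] at hl
      exact ⟨hK.trans ((hK'.trans hK'').mono (by decide) (by decide)), l, hl, hSl⟩

end WordRAM

end

/-! ### Evaluating and adding up the terms of the sum. -/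

namespace WordRAM

open Finset

variable {w : ℕ}

/-- The data on which the evaluation of the terms relies. -/
structure Ready (I : ListInstance (BitVec w)) (k : ℕ) (H A : Finset ℕ) (l : List (Finset ℕ))
    (σ : State w) : Prop where
  stores : Stores I k σ
  reg2 : σ.reg 2 = enc w H
  reg3 : σ.reg 3 = enc w A
  list : StoresList I.nbr l σ

/-- Bank `6` holds the colors that `χ` gives to the vertices in `H`. -/
def StoresColoring (χ : ℕ → BitVec w) (H : Finset ℕ) (σ : State w) : Prop :=
  ∀ h ∈ H, σ.mem 6 (BitVec.ofNat w h) = χ h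

theorem Ready.frame {I : ListInstance (BitVec w)} {k b : ℕ} {H A : Finset ℕ}
    {l : List (Finset ℕ)} {σ τ : State w} (h : Ready I k H A l σ) (hF : Frame b σ τ)
    (hb : 4 < b) : Ready I k H A l τ where
  stores := h.stores.frame hF (by omega)
  reg2 := (hF.1 2 (by omega)).trans h.reg2
  reg3 := (hF.1 3 (by omega)).trans h.reg3
  list := h.list.of_eq (hF.1 4 hb) (by rw [hF.2]) (by rw [hF.2])

theorem StoresColoring.frame {χ : ℕ → BitVec w} {H : Finset ℕ} {b : ℕ} {σ τ : State w}
    (h : StoresColoring χ H σ) (hF : Frame b σ τ) : StoresColoring χ H τ := by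
  intro v hv
  rw [hF.2, h v hv]

/-- For the color in register `30`, collect in the registers `31`, `32` and `33` the vertices that
have it in their list, the vertices to which it has been given, and their neighbors. -/
def colorSets (k : ℕ) : Prog :=
  (31 ::= ♭0 ;; 32 ::= ♭0 ;; 33 ::= ♭0) ;; forLoop 34 ♯0 (
    forLoop 35 (.load 1 ♯34)
      (31 ::= ♯31 |ᵣ ((.load 2 (♭k *ᵣ ♯34 +ᵣ ♯35) =ᵣ ♯30) <<ᵣ ♯34)) ;;
    .cond (((♯2 >>ᵣ ♯34) &ᵣ ♭1) &ᵣ (.load 6 ♯34 =ᵣ ♯30))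
      (32 ::= ♯32 |ᵣ (♭1 <<ᵣ ♯34) ;; 33 ::= ♯33 |ᵣ .load 3 ♯34) .skip)

theorem eq_apply (x y : BitVec w) : Op.eq.apply x y = if x = y then 1#w else 0#w := rfl

theorem bit_test_apply (S : Finset ℕ) {v : ℕ} (hv : v < w) :
    Op.and.apply (Op.shr.apply (enc w S) (BitVec.ofNat w v)) (BitVec.ofNat w 1) =
      if v ∈ S then 1#w else 0#w := bit_test S hv

theorem bit_apply {v : ℕ} (hv : v < w) :
    Op.shl.apply (BitVec.ofNat w 1) (BitVec.ofNat w v) = enc w {v} := bit_eq hv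

theorem ofNat_mul_add (a b c : ℕ) : Op.add.apply (Op.mul.apply (BitVec.ofNat w a)
    (BitVec.ofNat w b)) (BitVec.ofNat w c) = BitVec.ofNat w (a * b + c) := by
  simp [Op.apply, BitVec.ofNat_mul, BitVec.ofNat_add]

theorem colorSets_spec {I : ListInstance (BitVec w)} {k : ℕ} (hI : I.Valid k) {H A : Finset ℕ}
    {l : List (Finset ℕ)} {χ : ℕ → BitVec w} {c : BitVec w} {σ : State w} (hn : I.n < w)
    (hk : k < 2 ^ w) (hH : H ⊆ range I.n) (hR : Ready I k H A l σ) (hχ : StoresColoring χ H σ)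
    (hc : σ.reg 30 = c) :
    WP (colorSets k) (100 * (k + 1) * (I.n + 1)) (fun τ => Frame 31 σ τ ∧
      τ.reg 31 = enc w (I.having c) ∧ τ.reg 32 = enc w (ListInstance.colored χ H c) ∧
      τ.reg 33 = enc w (I.blocked χ H c)) σ := by
  have hw : 0 < w := by omega
  refine .seqT 6 (90 * (k + 1) * (I.n + 1)) (by nlinarith) (.straight rfl le_rfl ?_)
  refine .forLoopT (fun m τ => Frame 31 σ τ ∧ τ.reg 31 = enc w (I.having c ∩ range m) ∧
      τ.reg 32 = enc w (ListInstance.colored χ H c ∩ range m) ∧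
      τ.reg 33 = enc w ((ListInstance.colored χ H c ∩ range m).biUnion I.nbr)) I.n
    (22 * k + 40) (by simp only [Expr.cost]; nlinarith) (lt_two_pow (by omega)) hw ?_ ?_ ?_ ?_
  · intro m _ τ h _
    simp [Expr.eval, h.1.1 0 (by decide), hR.stores.reg0]
  · refine ⟨((((Frame.refl _ _).setReg (by omega) _).setReg (by omega) _).setReg
      (by omega) _).setReg (by omega) _, ?_, ?_, ?_⟩ <;>
    simp [Prog.exec, Expr.eval, enc_empty]
  · rintro m hm τ ⟨hF, h31, h32, h33⟩ h34
    have hmw : m < w := by omega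
    have hlen := hI.len_le m
    refine .seqT (22 * k + 10) 30 (by omega) ?_
    -- `Frame 31` says nothing about the registers `32`, `33`, `34` of the outer loop, so their
    -- preservation is carried separately.
    refine .forLoopT (fun j ρ => Frame 31 τ ρ ∧ (∀ x ≥ 32, x ≠ 35 → ρ.reg x = τ.reg x) ∧
        ρ.reg 31 = enc w ((I.having c ∩ range m) ∪
          if ∃ i < j, I.col m i = c then {m} else ∅)) (I.len m) 13
      (by simp only [Expr.cost]; nlinarith) (by omega) hw ?_ ?_ ?_ ?_
    · intro j _ ρ h _
      simp only [Expr.eval, h.2.1 34 (by omega) (by omega), h34, h.1.2, hF.2]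
      exact hR.stores.len m hm
    · refine ⟨(Frame.refl _ _).setReg (by omega) _, fun x _ hx => by simp [hx], ?_⟩
      simp [h31]
    · rintro j hj ρ ⟨hF₁, hx₁, h31₁⟩ h35
      refine .straight rfl (by simp [Prog.maxCost, Expr.cost]) ⟨by simp [Prog.exec, h35],
        (hF₁.setReg (by omega) _).setReg (by omega) _, fun x hx hx' => ?_, ?_⟩
      · simp [Prog.exec, hx', show x ≠ 31 by omega, hx₁ x hx hx']
      · simp only [Prog.exec, State.setReg_reg, if_true, show ¬(31 = 35) by decide, if_false,
          Expr.eval, hx₁ 34 (by omega) (by omega), h34, h35, ofNat_mul_add, hF₁.2, hF.2,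
          hR.stores.col m hm j hj, hF₁.1 30 (by omega), hF.1 30 (by omega), hc, h31₁, eq_apply]
        simp only [Op.apply]
        rw [ite_shl _ hmw, enc_union, union_assoc]
        congr 2
        by_cases h1 : I.col m j = c
        · have : ∃ i < j + 1, I.col m i = c := ⟨j, by omega, h1⟩
          simp only [h1, if_true, this]
          split_ifs <;> simp
        · have : (∃ i < j + 1, I.col m i = c) ↔ ∃ i < j, I.col m i = c := by
            constructor
            · rintro ⟨i, hi, hic⟩
              rcases Nat.lt_succ_iff_lt_or_eq.1 hi with h | rfl
              · exact ⟨i, h, hic⟩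
              · exact absurd hic h1
            · rintro ⟨i, hi, hic⟩
              exact ⟨i, by omega, hic⟩
          simp only [h1, this, if_false, union_empty]
    · rintro ρ ⟨hF₁, hx₁, h31₁⟩ -
      have h31₂ : ρ.reg 31 = enc w (I.having c ∩ range (m + 1)) := by
        rw [h31₁, inter_range_succ]
        congr 3
        simp [ListInstance.having, ListInstance.colors, hm]
      have h34₁ : ρ.reg 34 = BitVec.ofNat w m := by rw [hx₁ 34 (by omega) (by omega), h34]
      have h32₁ := hx₁ 32 (by omega) (by omega)
      have h33₁ := hx₁ 33 (by omega) (by omega)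
      rw [h32] at h32₁
      rw [h33] at h33₁
      have hF₂ := hF.trans hF₁
      have hval : Expr.eval ρ (((♯2 >>ᵣ ♯34) &ᵣ ♭1) &ᵣ (.load 6 ♯34 =ᵣ ♯30)) =
          if m ∈ ListInstance.colored χ H c then 1#w else 0#w := by
        simp only [Expr.eval, h34₁, hF₂.1 2 (by omega), hR.reg2, bit_test_apply _ hmw, eq_apply,
          hF₂.2, hF₂.1 30 (by omega), hc]
        simp only [Op.apply]
        rw [ite_and_ite]
        congr 1
        simp only [ListInstance.colored, mem_filter, eq_iff_iff]
        exact and_congr_right fun h => by rw [hχ m h]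
      refine .straight rfl (by simp [Prog.maxCost, Expr.cost]) ?_
      simp only [Prog.exec, hval, ite_eq_zero hw]
      split_ifs with hg
      · refine ⟨by simp [h34₁], ((hF₂.setReg (by omega) _).setReg (by omega) _).setReg
          (by omega) _, by simp [h31₂], ?_, ?_⟩
        · simp only [State.setReg_reg, if_true, show ¬(32 = 34) by decide, if_false,
            show ¬(32 = 33) by decide, Expr.eval, h34₁, bit_apply hmw, h32₁]
          rw [Op.apply, enc_union, inter_range_succ, if_pos hg]
        · simp only [State.setReg_reg, if_true, show ¬(33 = 34) by decide, if_false,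
            show ¬(33 = 32) by decide, show ¬(34 = 32) by decide, Expr.eval, h34₁, h33₁,
            State.setReg_mem, hF₂.2, hR.stores.nbr m hm]
          rw [Op.apply, enc_union, inter_range_succ, if_pos hg, union_biUnion, singleton_biUnion]
      · refine ⟨h34₁, hF₂.setReg (by omega) _, by simp [h31₂], ?_, ?_⟩ <;>
        simp [h32₁, h33₁, inter_range_succ, hg]
  · rintro τ ⟨hF, h31, h32, h33⟩ -
    rw [inter_eq_left.2 (show I.having c ⊆ range I.n from filter_subset _ _)] at h31
    rw [inter_eq_left.2 (show ListInstance.colored χ H c ⊆ range I.n from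
      (filter_subset _ _).trans hH)] at h32 h33
    exact ⟨hF, h31, h32, h33⟩

/-- Count in register `37` the stable subsets of the set in register `36`. -/
def countStable : Prog :=
  37 ::= ♭1 ;; forLoop 38 ♯0 (
    39 ::= .load 3 ♯38 |ᵣ (♭1 <<ᵣ ♯38) ;;
    .cond (((♯3 >>ᵣ ♯38) &ᵣ ♭1) &ᵣ ((♯36 &ᵣ ♯39) =ᵣ (♭1 <<ᵣ ♯38)))
      (36 ::= ♯36 ^ᵣ (♯36 &ᵣ (♭1 <<ᵣ ♯38)) ;; 37 ::= ♯37 +ᵣ ♯37) .skip) ;;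
  37 ::= ♯37 *ᵣ .load 5 ♯36

/-- `Y` need not belong to the trimmed family, so its count need not be in the table. Deleting an
isolated vertex halves the count, which is compensated by doubling register `37`. Such a deletion
isolates no other vertex, so after one pass over `A` the remaining set is trimmed and its count can
be looked up. -/
theorem countStable_spec {I : ListInstance (BitVec w)} {k : ℕ} (hI : I.Valid k)
    {H A Y : Finset ℕ} {l : List (Finset ℕ)} {σ : State w} (hn : I.n < w)
    (hA : A ⊆ range I.n) (hl : Enumerates I.nbr A (range I.n \ H) l) (hR : Ready I k H A l σ)
    (hY : Y ⊆ range I.n \ H) (h36 : σ.reg 36 = enc w Y) :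
    WP countStable (100 * (I.n + 1)) (fun τ => Frame 36 σ τ ∧
      τ.reg 37 = (stableCount I.nbr Y : BitVec w)) σ := by
  have hw : 0 < w := by omega
  refine .seqT 2 (90 * (I.n + 1)) (by omega) (.straight rfl le_rfl ?_)
  refine .seqT (80 * (I.n + 1)) 10 (by omega) ?_
  refine .forLoopT (fun m τ => Frame 36 σ τ ∧ ∃ Z ⊆ Y, τ.reg 36 = enc w Z ∧
      τ.reg 37 * (stableCount I.nbr Z : BitVec w) = (stableCount I.nbr Y : BitVec w) ∧
      ∀ v ∈ A, v < m → v ∈ Z → (Z ∩ I.nbr v).Nonempty) I.n 60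
    (by simp only [Expr.cost]; omega) (lt_two_pow (by omega)) hw ?_ ?_ ?_ ?_
  · intro m _ τ h _
    simp [Expr.eval, h.1.1 0 (by decide), hR.stores.reg0]
  · refine ⟨((Frame.refl _ _).setReg (by omega) _).setReg (by omega) _, Y, le_rfl, ?_, ?_, ?_⟩
    · simp [Prog.exec, h36]
    · have : ((1#w : BitVec w)) = 1 := rfl
      simp only [Prog.exec, Expr.eval, State.setReg_reg, if_true, show ¬(37 = 38) by decide,
        if_false, this, one_mul]
    · simp
  · rintro m hm τ ⟨hF, Z, hZY, h36, h37, hZ⟩ h38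
    have hmw : m < w := by omega
    have hZn : Z ⊆ range w := subset_range_of_le (hZY.trans (hY.trans sdiff_subset)) hn
    set τ' := τ.setReg 39 (enc w (insert m (I.nbr m))) with hτ'
    have h39 : Expr.eval τ (.load 3 ♯38 |ᵣ (♭1 <<ᵣ ♯38)) = enc w (insert m (I.nbr m)) := by
      simp only [Expr.eval, h38, bit_apply hmw, hF.2, hR.stores.nbr m hm]
      rw [Op.apply, enc_union, union_comm, ← insert_eq]
    have hF' : Frame 36 σ τ' := hF.setReg (by omega) _
    have e36 : τ'.reg 36 = enc w Z := by simp [hτ', h36]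
    have e37 : τ'.reg 37 = τ.reg 37 := by simp [hτ']
    have e38 : τ'.reg 38 = BitVec.ofNat w m := by simp [hτ', h38]
    have e39 : τ'.reg 39 = enc w (insert m (I.nbr m)) := by simp [hτ']
    -- One comparison with the closed neighborhood tests membership and isolation together.
    have hiff : Z ∩ insert m (I.nbr m) = {m} ↔ m ∈ Z ∧ Z ∩ I.nbr m = ∅ := by
      constructor
      · intro h
        have hmZ : m ∈ Z := by
          have : m ∈ Z ∩ insert m (I.nbr m) := by rw [h]; simp
          exact (mem_inter.1 this).1
        refine ⟨hmZ, ?_⟩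
        rw [inter_insert_of_mem hmZ] at h
        refine eq_empty_of_forall_notMem fun x hx => ?_
        have hxm : x = m := by
          have : x ∈ insert m (Z ∩ I.nbr m) := mem_insert_of_mem hx
          rw [h] at this
          simpa using this
        subst hxm
        exact hI.isNbhd.irrefl _ (mem_inter.1 hx).2
      · rintro ⟨h, h'⟩
        rw [inter_insert_of_mem h, h']
        rfl
    have hval : Expr.eval τ' (((♯3 >>ᵣ ♯38) &ᵣ ♭1) &ᵣ ((♯36 &ᵣ ♯39) =ᵣ (♭1 <<ᵣ ♯38))) =
        if m ∈ A ∧ m ∈ Z ∧ Z ∩ I.nbr m = ∅ then 1#w else 0#w := by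
      have e1 : Op.eq.apply (Op.and.apply (enc w Z) (enc w (insert m (I.nbr m)))) (enc w {m}) =
          if m ∈ Z ∧ Z ∩ I.nbr m = ∅ then 1#w else 0#w := by
        have e2 : Op.and.apply (enc w Z) (enc w (insert m (I.nbr m))) =
          enc w (Z ∩ insert m (I.nbr m)) := enc_inter _ _
        have e3 : ({m} : Finset ℕ) ⊆ range w := by simpa using hmw
        simp only [e2, eq_apply, enc_inj (inter_subset_left.trans hZn) e3, hiff]
      simp only [Expr.eval, hF'.1 3 (by omega), hR.reg3, e36, e38, e39, bit_test_apply _ hmw,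
        bit_apply hmw, e1]
      simp only [Op.apply]
      rw [ite_and_ite]
    refine .straight rfl (by simp [Prog.maxCost, Expr.cost]) ?_
    have hexec : ∀ p : Prog, Prog.exec (39 ::= .load 3 ♯38 |ᵣ (♭1 <<ᵣ ♯38) ;; p) τ =
        p.exec τ' := fun p => by rw [hτ', ← h39]; rfl
    rw [hexec]
    simp only [Prog.exec, hval, ite_eq_zero hw]
    split_ifs with hg
    · obtain ⟨hmA, hmZ, hiso⟩ := hg
      refine ⟨by simp [e38], ((hF'.setReg (by omega) _).setReg (by omega) _).setReg (by omega) _,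
        Z \ {m}, sdiff_subset.trans hZY, ?_, ?_, ?_⟩
      · simp only [State.setReg_reg, if_true, show ¬(36 = 38) by decide, if_false,
            show ¬(36 = 37) by decide, Expr.eval, e36, e38, bit_apply hmw]
        rw [Op.apply, Op.apply, enc_sdiff]
      · simp only [State.setReg_reg, if_true, show ¬(37 = 38) by decide, if_false,
            show ¬(37 = 36) by decide, Expr.eval, e37]
        have h1 : insert m (Z \ {m}) = Z := by
          rw [sdiff_singleton_eq_erase, insert_erase hmZ]
        have h2 := hI.isNbhd.stableCount_insert_isolated (u := m) (S := Z \ {m}) (by simp)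
          (subset_empty.1 (hiso ▸ inter_subset_inter sdiff_subset le_rfl))
        rw [h1] at h2
        rw [← h37, h2]
        simp only [Op.apply]
        push_cast
        ring
      · intro v hv hvm hvZ
        obtain ⟨hvZ', hvm'⟩ := Finset.mem_sdiff.1 hvZ
        obtain ⟨x, hx⟩ := hZ v hv (by
          rcases Nat.lt_succ_iff_lt_or_eq.1 hvm with h | rfl
          · exact h
          · simp at hvm') hvZ'
        rw [mem_inter] at hx
        refine ⟨x, mem_inter.2 ⟨Finset.mem_sdiff.2 ⟨hx.1, fun hxm => ?_⟩, hx.2⟩⟩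
        rw [Finset.mem_singleton] at hxm
        subst hxm
        have : v ∈ Z ∩ I.nbr x := mem_inter.2 ⟨hvZ', hI.isNbhd.symm hx.2⟩
        rw [hiso] at this
        simp at this
    · refine ⟨by simp [e38], hF'.setReg (by omega) _, Z, hZY, by simp [e36], by simpa [e37], ?_⟩
      intro v hv hvm hvZ
      rcases Nat.lt_succ_iff_lt_or_eq.1 hvm with h | rfl
      · exact hZ v hv h hvZ
      · rw [nonempty_iff_ne_empty]
        exact fun h => hg ⟨hv, hvZ, h⟩
  · rintro τ ⟨hF, Z, hZY, h36, h37, hZ⟩ -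
    refine .straight rfl (by simp [Prog.maxCost, Expr.cost]) ⟨hF.setReg (by omega) _, ?_⟩
    have hZl : Z ∈ l := (hl.2 Z).2 (mem_trimmed.2 ⟨hZY.trans hY, fun v hv hvZ =>
      hZ v hv (Finset.mem_range.1 (hA hv)) hvZ⟩)
    simp only [Prog.exec, State.setReg_reg, if_true, Expr.eval, h36, hF.2]
    rw [hR.list.count Z hZl, ← h37]
    rfl

end WordRAM

namespace WordRAM

open Finset

variable {w : ℕ}

/-- Multiply register `24` by the factor of the color number `28` of the vertex in register `26`,
and double register `27` unless this color is forbidden to the vertex. -/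
def slotStep (k : ℕ) : Prog :=
  30 ::= .load 2 (♭k *ᵣ ♯26 +ᵣ ♯28) ;;
  colorSets k ;;
  .cond ((♯33 >>ᵣ ♯26) &ᵣ ♭1) .skip (27 ::= ♯27 +ᵣ ♯27) ;;
  .cond (♯31 &ᵣ ((♭1 <<ᵣ ♯26) -ᵣ ♭1)) .skip (
    .cond (♯32 &ᵣ ♯33) (24 ::= ♭0) (
      36 ::= ♯25 &ᵣ (♯31 ^ᵣ (♯31 &ᵣ ♯33)) ;;
      countStable ;;
      24 ::= ♯24 *ᵣ ♯37))

/-- The two effects are independent. The color's factor is multiplied in only at the first vertex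
that lists the color, whereas register `27` counts, as a power of two, all colors left to the
present vertex. -/
theorem slotStep_spec {I : ListInstance (BitVec w)} {k : ℕ} (hI : I.Valid k)
    {H A S : Finset ℕ} {l : List (Finset ℕ)} {χ : ℕ → BitVec w} {σ : State w} {v j : ℕ}
    {a e : BitVec w} (hn : I.n < w) (hk : k < 2 ^ w) (hH : H ⊆ range I.n) (hA : A ⊆ range I.n)
    (hl : Enumerates I.nbr A (range I.n \ H) l) (hR : Ready I k H A l σ)
    (hχ : StoresColoring χ H σ) (hS : S ⊆ range I.n \ H) (hv : v < I.n) (hj : j < I.len v)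
    (h24 : σ.reg 24 = a) (h25 : σ.reg 25 = enc w S) (h26 : σ.reg 26 = BitVec.ofNat w v)
    (h27 : σ.reg 27 = e) (h28 : σ.reg 28 = BitVec.ofNat w j) :
    WP (slotStep k) (300 * (k + 1) * (I.n + 1)) (fun τ => Frame 24 σ τ ∧
      τ.reg 25 = enc w S ∧ τ.reg 26 = BitVec.ofNat w v ∧ τ.reg 28 = BitVec.ofNat w j ∧
      τ.reg 24 = a * (if I.having (I.col v j) ∩ range v = ∅ then
        I.factor χ H S (I.col v j) else 1) ∧
      τ.reg 27 = if v ∈ I.blocked χ H (I.col v j) then e else e + e) σ := by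
  have hw : 0 < w := by omega
  have hvw : v < w := by omega
  have hX : I.n + 1 ≤ (k + 1) * (I.n + 1) := Nat.le_mul_of_pos_left _ (by omega)
  set c := I.col v j with hc
  refine .seqT 8 (280 * (k + 1) * (I.n + 1)) (by rw [mul_assoc, mul_assoc]; omega)
    (.straight rfl (by simp [Prog.maxCost, Expr.cost]) ?_)
  have he : Expr.eval σ (.load 2 (♭k *ᵣ ♯26 +ᵣ ♯28)) = c := by
    simp only [Expr.eval, h26, h28, ofNat_mul_add, hR.stores.col v hv j hj, hc]
  simp only [Prog.exec, he]
  have hF₀ : Frame 29 σ (σ.setReg 30 c) := (Frame.refl _ _).setReg (by omega) _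
  refine .seqT (100 * (k + 1) * (I.n + 1)) (180 * (k + 1) * (I.n + 1))
    (by simp only [mul_assoc]; omega)
    ((colorSets_spec (c := c) hI hn hk hH (hR.frame hF₀ (by omega)) (hχ.frame hF₀)
      (by simp)).mono le_rfl
      ?_)
  rintro τ ⟨hF₁, h31, h32, h33⟩
  have hF : Frame 29 σ τ := hF₀.trans (hF₁.mono (by omega))
  refine .seqT 12 (160 * (k + 1) * (I.n + 1)) (by simp only [mul_assoc]; omega)
    (.straight rfl (by simp [Prog.maxCost, Expr.cost]) ?_)
  have hb : Expr.eval τ ((♯33 >>ᵣ ♯26) &ᵣ ♭1) =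
      if v ∈ I.blocked χ H c then 1#w else 0#w := by
    simp only [Expr.eval, h33, hF.1 26 (by omega), h26, bit_test_apply _ hvw]
  set τ' : State w := if v ∈ I.blocked χ H c then τ else τ.setReg 27 (e + e) with hτ'
  have hexec : Prog.exec (.cond ((♯33 >>ᵣ ♯26) &ᵣ ♭1) .skip (27 ::= ♯27 +ᵣ ♯27)) τ = τ' := by
    simp only [Prog.exec, hb, ite_eq_zero hw, hτ']
    by_cases h : v ∈ I.blocked χ H c
    · simp [h]
    · simp [h, Expr.eval, Op.apply, hF.1, h27]
  rw [hexec]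
  have hreg : ∀ x ≠ 27, τ'.reg x = τ.reg x := by
    intro x hx
    simp only [hτ']
    split_ifs <;> simp [hx]
  have hF' : Frame 24 σ τ' := by
    simp only [hτ']
    split_ifs
    · exact hF.mono (by omega)
    · exact (hF.mono (by omega)).setReg (by omega) _
  have e27 : τ'.reg 27 = if v ∈ I.blocked χ H c then e else e + e := by
    simp only [hτ']
    split_ifs
    · rw [hF.1 27 (by omega), h27]
    · simp
  have e24 : τ'.reg 24 = a := by rw [hreg 24 (by omega), hF.1 24 (by omega), h24]
  have e25 : τ'.reg 25 = enc w S := by rw [hreg 25 (by omega), hF.1 25 (by omega), h25]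
  have e26 : τ'.reg 26 = BitVec.ofNat w v := by
    rw [hreg 26 (by omega), hF.1 26 (by omega), h26]
  have e28 : τ'.reg 28 = BitVec.ofNat w j := by
    rw [hreg 28 (by omega), hF.1 28 (by omega), h28]
  have e31 : τ'.reg 31 = enc w (I.having c) := by rw [hreg 31 (by omega), h31]
  have e32 : τ'.reg 32 = enc w (ListInstance.colored χ H c) := by rw [hreg 32 (by omega), h32]
  have e33 : τ'.reg 33 = enc w (I.blocked χ H c) := by rw [hreg 33 (by omega), h33]
  have hhav : I.having c ⊆ range w := subset_range_of_le (filter_subset _ _) hn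
  have hfirst : Expr.eval τ' (♯31 &ᵣ ((♭1 <<ᵣ ♯26) -ᵣ ♭1)) =
      enc w (I.having c ∩ range v) := by
    have : Op.sub.apply (enc w {v}) (BitVec.ofNat w 1) = enc w (range v) :=
      (enc_range hvw).symm
    simp only [Expr.eval, e31, e26, bit_apply hvw, this]
    rw [Op.apply, enc_inter]
  have hokv : Expr.eval τ' (♯32 &ᵣ ♯33) =
      enc w (ListInstance.colored χ H c ∩ I.blocked χ H c) := by
    simp only [Expr.eval, e32, e33]
    rw [Op.apply, enc_inter]
  have hcol : ListInstance.colored χ H c ⊆ range w :=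
    subset_range_of_le ((filter_subset _ _).trans hH) hn
  refine (WP.cond (T₁ := 1) (T₂ := 150 * (I.n + 1)) ?_ ?_).mono
    (by simp only [Expr.cost, mul_assoc]; omega) (fun _ h => h)
  · rw [hfirst, ne_eq, enc_eq_zero (inter_subset_left.trans hhav)]
    intro h
    refine .skip ⟨hF', e25, e26, e28, ?_, e27⟩
    rw [if_neg h, mul_one, e24]
  · rw [hfirst, enc_eq_zero (inter_subset_left.trans hhav)]
    intro h
    simp only [if_pos h, ListInstance.factor]
    refine (WP.cond (T₁ := 2) (T₂ := 120 * (I.n + 1)) ?_ ?_).mono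
      (by simp only [Expr.cost]; omega) (fun _ h => h)
    · rw [hokv, ne_eq, enc_eq_zero (inter_subset_left.trans hcol), ← disjoint_iff_inter_eq_empty]
      intro hok
      refine .straight rfl le_rfl ⟨hF'.setReg (by omega) _, ?_⟩
      simp [Prog.exec, Expr.eval, e25, e26, e28, e27, hok]
    · rw [hokv, enc_eq_zero (inter_subset_left.trans hcol), ← disjoint_iff_inter_eq_empty]
      intro hok
      rw [if_pos hok]
      refine .seqT 8 (100 * (I.n + 1) + 4) (by omega) (.straight rfl le_rfl ?_)
      have hY : Expr.eval τ' (♯25 &ᵣ (♯31 ^ᵣ (♯31 &ᵣ ♯33))) =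
          enc w (S ∩ (I.having c \ I.blocked χ H c)) := by
        simp only [Expr.eval, e25, e31, e33]
        simp only [Op.apply]
        rw [enc_sdiff, enc_inter]
      simp only [Prog.exec, hY]
      have hF₂ : Frame 24 σ (τ'.setReg 36 (enc w (S ∩ (I.having c \ I.blocked χ H c)))) :=
        hF'.setReg (by omega) _
      refine .seqT (100 * (I.n + 1)) 4 le_rfl ((countStable_spec
        (Y := S ∩ (I.having c \ I.blocked χ H c)) hI hn hA hl
        (hR.frame hF₂ (by omega)) (inter_subset_left.trans hS) (by simp)).mono le_rfl ?_)
      rintro ρ ⟨hF₃, h37⟩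
      refine .straight rfl le_rfl ⟨(hF₂.trans (hF₃.mono (by omega))).setReg (by omega) _, ?_⟩
      simp [Prog.exec, Expr.eval, h37, hF₃.1, e25, e26, e28, e27, e24, Op.apply]

/-- Multiply register `24` by the term of the set in register `25`. -/
def computeTerm (k : ℕ) : Prog :=
  forLoop 26 ♯0 (
    (.cond ((♯25 >>ᵣ ♯26) &ᵣ ♭1) (24 ::= ♭0 -ᵣ ♯24) .skip ;; 27 ::= ♭1) ;;
    forLoop 28 (.load 1 ♯26) (slotStep k) ;;
    .cond (((♯3 >>ᵣ ♯26) &ᵣ ♭1) &ᵣ ((♯25 &ᵣ (.load 3 ♯26 |ᵣ (♭1 <<ᵣ ♯26))) =ᵣ ♭0))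
      (24 ::= ♯24 *ᵣ (♭1 -ᵣ ♯27)) .skip)

theorem computeTerm_spec {I : ListInstance (BitVec w)} {k : ℕ} (hI : I.Valid k)
    {H A S : Finset ℕ} {l : List (Finset ℕ)} {χ : ℕ → BitVec w} {σ : State w}
    (hn : I.n < w) (hk : k < 2 ^ w) (hH : H ⊆ range I.n) (hA : A ⊆ range I.n)
    (hl : Enumerates I.nbr A (range I.n \ H) l) (hR : Ready I k H A l σ)
    (hχ : StoresColoring χ H σ) (hS : S ⊆ range I.n \ H)
    (h24 : σ.reg 24 = 1#w) (h25 : σ.reg 25 = enc w S) :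
    WP (computeTerm k) (500 * ((k + 1) ^ 2 * (I.n + 1) ^ 2)) (fun τ => Frame 24 σ τ ∧
      τ.reg 24 = I.term χ H A S) σ := by
  have hw : 0 < w := by omega
  obtain ⟨T, hT⟩ : ∃ T, T = (k + 1) ^ 2 * (I.n + 1) := ⟨_, rfl⟩
  have hT1 : k * (300 * (k + 1) * (I.n + 1)) ≤ 300 * T := by
    rw [hT]
    calc k * (300 * (k + 1) * (I.n + 1)) = k * ((k + 1) * (300 * (I.n + 1))) := by ring
      _ ≤ (k + 1) * ((k + 1) * (300 * (I.n + 1))) := Nat.mul_le_mul_right _ (by omega)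
      _ = _ := by ring
  have hT2 : k + 1 ≤ T := by
    rw [hT]
    calc k + 1 ≤ (k + 1) ^ 2 := Nat.le_self_pow (by norm_num) _
      _ ≤ _ := Nat.le_mul_of_pos_right _ (by omega)
  have hfin : I.n * (400 * T) + 6 ≤ 500 * ((k + 1) ^ 2 * (I.n + 1) ^ 2) := by
    have : (k + 1) ^ 2 * (I.n + 1) ^ 2 = I.n * T + T := by rw [hT]; ring
    rw [this, Nat.mul_left_comm]
    omega
  refine .forLoopT (fun m τ => Frame 24 σ τ ∧ τ.reg 25 = enc w S ∧
    τ.reg 24 = ∏ v ∈ range m, I.vertexTerm χ H A S v) I.n (400 * T - 8)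
    (by
      have : 400 * T - 8 + Expr.cost ♯0 + 7 = 400 * T := by simp only [Expr.cost]; omega
      rw [this]; simp only [Expr.cost]; omega) (lt_two_pow (by omega)) hw ?_ ?_ ?_ ?_
  · intro m _ τ h _
    simp [Expr.eval, h.1.1 0 (by decide), hR.stores.reg0]
  · refine ⟨(Frame.refl _ _).setReg (by omega) _, by simp [h25], ?_⟩
    simp only [State.setReg_reg, show ¬(24 = 26) by decide, if_false, h24, range_zero, prod_empty]
    rfl
  · rintro m hm τ ⟨hF, h25, h24⟩ h26
    have hmw : m < w := by omega
    have hlen := hI.len_le m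
    set a := ∏ v ∈ range m, I.vertexTerm (R := BitVec w) χ H A S v with ha
    refine .seqT 14 (400 * T - 22) (by omega)
      (.straight rfl (by simp [Prog.maxCost, Expr.cost]) ?_)
    set τ' : State w := (τ.setReg 24 (a * if m ∈ S then -1 else 1)).setReg 27 1#w with hτ'
    have hsign : Expr.eval τ ((♯25 >>ᵣ ♯26) &ᵣ ♭1) = if m ∈ S then 1#w else 0#w := by
      simp only [Expr.eval, h25, h26, bit_test_apply _ hmw]
    have hexec : Prog.exec (.cond ((♯25 >>ᵣ ♯26) &ᵣ ♭1) (24 ::= ♭0 -ᵣ ♯24) .skip ;;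
        27 ::= ♭1) τ = τ' := by
      simp only [Prog.exec, hsign, ite_eq_zero hw, hτ']
      by_cases h : m ∈ S
      · simp only [h, not_true, if_false, if_true, Expr.eval, h24]
        congr 2
        simp [Op.apply]
      · simp only [h, not_false_iff, if_true, if_false, mul_one, Expr.eval]
        congr 1
        simp only [State.setReg]
        rw [← h24, Function.update_eq_self]
    rw [hexec]
    have hF' : Frame 24 σ τ' := (hF.setReg (by omega) _).setReg (by omega) _
    refine .seqT (300 * T + 9 * k + 7) 25 (by omega) ?_
    refine .forLoopT (fun j ρ => Frame 24 σ ρ ∧ ρ.reg 25 = enc w S ∧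
        ρ.reg 26 = BitVec.ofNat w m ∧
        ρ.reg 24 = (a * if m ∈ S then -1 else 1) * ∏ i ∈ range j,
          (if I.having (I.col m i) ∩ range m = ∅ then I.factor χ H S (I.col m i) else 1) ∧
        ρ.reg 27 = 2 ^ ((range j).filter fun i => m ∉ I.blocked χ H (I.col m i)).card)
      (I.len m) (300 * (k + 1) * (I.n + 1)) ?_ (by omega) hw ?_ ?_ ?_ ?_
    · simp only [Expr.cost]
      generalize 300 * (k + 1) * (I.n + 1) = X at hT1 ⊢
      have h1 := Nat.mul_le_mul_right (X + (1 + 1) + 7) hlen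
      have h2 : k * (X + (1 + 1) + 7) = k * X + 9 * k := by ring
      omega
    · intro j _ ρ h _
      simp only [Expr.eval, h.2.2.1, h.1.2]
      exact hR.stores.len m hm
    · refine ⟨hF'.setReg (by omega) _, ?_, ?_, ?_, ?_⟩
      · simp [hτ', h25]
      · simp [hτ', h26]
      · simp [hτ']
      · simp [hτ']
    · rintro j hj ρ ⟨hF₁, h25₁, h26₁, h24₁, h27₁⟩ h28
      refine (slotStep_spec hI hn hk hH hA hl (hR.frame hF₁ (by omega)) (hχ.frame hF₁) hS hm hj
        h24₁ h25₁ h26₁ h27₁ h28).mono le_rfl ?_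
      rintro π ⟨hF₂, h25₂, h26₂, h28₂, h24₂, h27₂⟩
      refine ⟨h28₂, (hF₁.trans hF₂).setReg (by omega) _, by simp [h25₂], by simp [h26₂], ?_, ?_⟩
      · simp only [State.setReg_reg, show ¬(24 = 28) by decide, if_false, h24₂]
        rw [prod_range_succ, mul_assoc]
      · simp only [State.setReg_reg, show ¬(27 = 28) by decide, if_false, h27₂]
        rw [range_add_one, filter_insert]
        by_cases h1 : m ∈ I.blocked χ H (I.col m j)
        · rw [if_pos h1, if_neg (not_not.2 h1)]
        · rw [if_neg h1, if_pos h1, card_insert_of_notMem (by simp), pow_succ, mul_two]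
    · rintro ρ ⟨hF₁, h25₁, h26₁, h24₁, h27₁⟩ -
      have hval : Expr.eval ρ (((♯3 >>ᵣ ♯26) &ᵣ ♭1) &ᵣ
          ((♯25 &ᵣ (.load 3 ♯26 |ᵣ (♭1 <<ᵣ ♯26))) =ᵣ ♭0)) =
          if m ∈ A ∧ m ∉ S ∧ S ∩ I.nbr m = ∅ then 1#w else 0#w := by
        have e1 : Op.or.apply (enc w (I.nbr m)) (enc w {m}) = enc w (insert m (I.nbr m)) := by
          rw [Op.apply, enc_union, union_comm, ← insert_eq]
        have e2 : Op.and.apply (enc w S) (enc w (insert m (I.nbr m))) =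
            enc w (S ∩ insert m (I.nbr m)) := enc_inter _ _
        have hSw : S ⊆ range w := subset_range_of_le (hS.trans sdiff_subset) hn
        have e3 : S ∩ insert m (I.nbr m) = ∅ ↔ m ∉ S ∧ S ∩ I.nbr m = ∅ := by
          simp only [← disjoint_iff_inter_eq_empty, disjoint_insert_right]
        simp only [Expr.eval, h25₁, h26₁, bit_test_apply _ hmw, bit_apply hmw, hF₁.2,
          hR.stores.nbr m hm, hF₁.1 3 (by omega), hR.reg3, e1, e2]
        rw [eq_zero_apply (inter_subset_left.trans hSw)]
        simp only [Op.apply, e3]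
        rw [ite_and_ite]
      refine .straight rfl (by simp [Prog.maxCost, Expr.cost]) ?_
      simp only [Prog.exec, hval, ite_eq_zero hw, range_add_one]
      rw [prod_insert (by simp), ← ha, ListInstance.vertexTerm]
      have hrem : (2 : BitVec w) ^ I.remaining χ H m = ρ.reg 27 := h27₁.symm
      by_cases hg : m ∈ A ∧ m ∉ S ∧ S ∩ I.nbr m = ∅
      · rw [if_neg (not_not.2 hg), if_pos hg]
        refine ⟨by simp [h26₁], (hF₁.setReg (by omega) _).setReg (by omega) _, by simp [h25₁], ?_⟩
        simp only [State.setReg_reg, show ¬(24 = 26) by decide, if_true, if_false, Expr.eval,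
          h24₁, hrem]
        simp only [Op.apply]
        have : (BitVec.ofNat w 1) = 1 := rfl
        rw [this]
        generalize (if m ∈ S then (-1 : BitVec w) else 1) = s
        ring
      · rw [if_pos hg, if_neg hg]
        refine ⟨by simp [h26₁], hF₁.setReg (by omega) _, by simp [h25₁], ?_⟩
        simp only [State.setReg_reg, show ¬(24 = 26) by decide, if_false, h24₁]
        generalize (if m ∈ S then (-1 : BitVec w) else 1) = s
        ring
  · rintro τ ⟨hF, h25, h24⟩ -
    exact ⟨hF, h24⟩

/-- Add up in register `20` the terms of all sets in the stored list. -/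
def sumTerms (k : ℕ) : Prog :=
  20 ::= ♭0 ;; forLoop 21 ♯4 (
    (25 ::= .load 4 ♯21 ;; 24 ::= ♭1) ;;
    computeTerm k ;;
    20 ::= ♯20 +ᵣ ♯24)

theorem sumTerms_spec {I : ListInstance (BitVec w)} {k : ℕ} (hI : I.Valid k)
    {H A : Finset ℕ} {l : List (Finset ℕ)} {χ : ℕ → BitVec w} {σ : State w}
    (hn : I.n < w) (hk : k < 2 ^ w) (hH : H ⊆ range I.n) (hA : A ⊆ range I.n)
    (hl : Enumerates I.nbr A (range I.n \ H) l) (hR : Ready I k H A l σ)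
    (hχ : StoresColoring χ H σ) :
    WP (sumTerms k) (600 * ((k + 1) ^ 2 * (I.n + 1) ^ 2) * (l.length + 1)) (fun τ =>
      Frame 20 σ τ ∧ τ.reg 20 = ∑ S ∈ trimmed I.nbr A (range I.n \ H), I.term χ H A S) σ := by
  have hw : 0 < w := by omega
  obtain ⟨T, hT⟩ : ∃ T, T = (k + 1) ^ 2 * (I.n + 1) ^ 2 := ⟨_, rfl⟩
  have hT1 : 1 ≤ T := by rw [hT]; exact Nat.mul_pos (by positivity) (by positivity)
  rw [← hT]
  have hlen : l.length < 2 ^ w := by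
    rw [hl.length_eq]
    refine lt_of_le_of_lt (card_filter_le _ _) ?_
    rw [card_powerset]
    refine Nat.pow_lt_pow_right (by norm_num) (lt_of_le_of_lt (card_le_card sdiff_subset) ?_)
    simpa using hn
  refine .seqT 2 (l.length * (600 * T) + 6) (by
    have : 600 * T * (l.length + 1) = l.length * (600 * T) + 600 * T := by ring
    omega) (.straight rfl le_rfl ?_)
  refine .forLoopT (fun m τ => Frame 20 σ τ ∧
    τ.reg 20 = ((l.take m).map (I.term χ H A)).sum) l.length (500 * T + 20)
    (by
      have : l.length * (500 * T + 20 + Expr.cost ♯4 + 7) ≤ l.length * (600 * T) :=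
        Nat.mul_le_mul_left _ (by simp only [Expr.cost]; omega)
      simp only [Expr.cost] at this ⊢; omega) hlen hw ?_ ?_ ?_ ?_
  · intro m _ τ h _
    simp [Expr.eval, h.1.1 4 (by decide), hR.list.length]
  · refine ⟨((Frame.refl _ _).setReg (by omega) _).setReg (by omega) _, ?_⟩
    simp [Prog.exec, Expr.eval]
  · rintro m hm τ ⟨hF, h20⟩ h21
    refine .seqT 5 (500 * T + 10) (by omega) (.straight rfl le_rfl ?_)
    have hload : Expr.eval τ (.load 4 ♯21) = enc w l[m] := by
      simp only [Expr.eval, h21, hF.2, hR.list.list m hm]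
    simp only [Prog.exec, hload]
    have hF₁ : Frame 20 σ ((τ.setReg 25 (enc w l[m])).setReg 24
        (Expr.eval (τ.setReg 25 (enc w l[m])) ♭1)) :=
      (hF.setReg (by omega) _).setReg (by omega) _
    have hml : l[m] ⊆ range I.n \ H := (mem_trimmed.1 ((hl.2 _).1 (List.getElem_mem hm))).1
    refine .seqT (500 * T) 4 (by omega) ((computeTerm_spec hI hn hk hH hA hl
      (hR.frame hF₁ (by omega)) (hχ.frame hF₁) hml (by simp [Expr.eval]) (by simp)).mono
      (by rw [hT]) ?_)
    rintro ρ ⟨hF₂, h24⟩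
    refine .straight rfl le_rfl ⟨by simp [Prog.exec, hF₂.1, h21],
      ((hF₁.trans (hF₂.mono (by omega))).setReg (by omega) _).setReg (by omega) _, ?_⟩
    simp only [Prog.exec, State.setReg_reg, show ¬(20 = 21) by decide, if_true, if_false,
      Expr.eval, h24, hF₂.1 20 (by omega), show ¬(20 = 24) by decide, show ¬(20 = 25) by decide,
      h20]
    rw [List.take_add_one, List.getElem?_eq_getElem hm, List.map_append, List.sum_append]
    simp only [Op.apply, Option.toList_some, List.map_cons, List.map_nil, List.sum_cons,
      List.sum_nil, add_zero]
  · rintro τ ⟨hF, h20⟩ -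
    refine ⟨hF, ?_⟩
    rw [h20, List.take_length, ← List.sum_toFinset _ hl.1]
    congr 1
    ext X
    simp [hl.2]

end WordRAM

/-! ### Trying all colorings of the heavy set. -/

section

open Finset

namespace ListInstance

variable {κ : Type*}

/-- The number of ways to choose colors for the elements of `H` below `m`. -/
def choices (I : ListInstance κ) (H : Finset ℕ) (m : ℕ) : ℕ := ∏ h ∈ H ∩ range m, I.len h

/-- The coloring of `H` with the number `q`. -/
def decode (I : ListInstance κ) (H : Finset ℕ) (q h : ℕ) : κ :=
  I.col h (q / I.choices H h % I.len h)

theorem choices_succ (I : ListInstance κ) (H : Finset ℕ) (m : ℕ) :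
    I.choices H (m + 1) = I.choices H m * if m ∈ H then I.len m else 1 := by
  rw [choices, choices, range_add_one]
  split_ifs with h
  · rw [inter_insert_of_mem h, prod_insert (by simp), mul_comm]
  · rw [inter_insert_of_notMem h, mul_one]

theorem choices_dvd (I : ListInstance κ) {H : Finset ℕ} {h m : ℕ} (hh : h ∈ H) (hm : h < m) :
    I.choices H h * I.len h ∣ I.choices H m := by
  rw [← Nat.add_sub_cancel' (Nat.succ_le_of_lt hm)]
  generalize m - h.succ = d
  induction d with
  | zero => rw [Nat.add_zero, choices_succ, if_pos hh]
  | succ d ih =>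
    rw [← Nat.add_assoc, choices_succ]
    exact ih.trans (dvd_mul_right _ _)

/-- Mixed radix expansion: the digit of `h ∈ H` has base `I.len h` and place value `I.choices H h`.
Adding a multiple of `I.choices H m` leaves the lower digits unchanged, since by `choices_dvd` it is
divisible by each lower place value times its base. -/
theorem exists_decode_eq (I : ListInstance κ) {H : Finset ℕ} {m : ℕ} (d : ℕ → ℕ)
    (hd : ∀ h ∈ H, d h < I.len h) :
    ∃ q < I.choices H m, ∀ h ∈ H, h < m → q / I.choices H h % I.len h = d h := by
  induction m with
  | zero => exact ⟨0, by simp [choices], by simp⟩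
  | succ m ih =>
    obtain ⟨q, hq, hqd⟩ := ih
    by_cases hm : m ∈ H
    · refine ⟨q + I.choices H m * d m, ?_, fun h hh hhm => ?_⟩
      · rw [choices_succ, if_pos hm]
        calc q + I.choices H m * d m < I.choices H m * (d m + 1) := by rw [mul_add]; omega
          _ ≤ _ := Nat.mul_le_mul_left _ (hd m hm)
      · rcases Nat.lt_succ_iff_lt_or_eq.1 hhm with h' | rfl
        · obtain ⟨c, hc⟩ := I.choices_dvd hh h'
          have hpos : 0 < I.choices H h := by
            by_contra h0
            have h0 : I.choices H h = 0 := by omega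
            rw [h0, zero_mul, zero_mul] at hc
            omega
          rw [hc, mul_assoc, mul_assoc, Nat.add_mul_div_left _ _ hpos,
            Nat.add_mul_mod_self_left]
          exact hqd h hh h'
        · rw [Nat.add_mul_div_left _ _ (by omega), Nat.div_eq_of_lt hq, zero_add,
            Nat.mod_eq_of_lt (hd h hh)]
    · refine ⟨q, by rwa [choices_succ, if_neg hm, mul_one], fun h hh hhm => ?_⟩
      rcases Nat.lt_succ_iff_lt_or_eq.1 hhm with h' | rfl
      · exact hqd h hh h'
      · exact absurd hh hm

theorem len_pos_of_choices_pos (I : ListInstance κ) {H : Finset ℕ} {m : ℕ}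
    (hH : H ⊆ range m) (h : 0 < I.choices H m) : ∀ h ∈ H, 0 < I.len h := by
  intro v hv
  rw [choices, inter_eq_left.2 hH] at h
  by_contra h0
  have : ∏ h ∈ H, I.len h = 0 := prod_eq_zero hv (by omega)
  omega

theorem choices_le (I : ListInstance κ) {H : Finset ℕ} {k : ℕ} (hI : I.Valid k) (m : ℕ) :
    I.choices H m ≤ k ^ (H ∩ range m).card := by
  rw [choices, ← prod_const]
  exact prod_le_prod' fun v _ => hI.len_le v

variable [DecidableEq κ]

theorem decode_mem_colors (I : ListInstance κ) {H : Finset ℕ} {h : ℕ} (q : ℕ)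
    (hpos : 0 < I.len h) : I.decode H q h ∈ I.colors h :=
  mem_image_of_mem _ (Finset.mem_range.2 (Nat.mod_lt _ hpos))

/-- Both conditions on `χ` depend only on its values on `H`, and each choice of these values from
the lists is given by some number. If a list in `H` is empty, there is no admissible number. -/
theorem colorable_iff_exists_decode [Nonempty κ] {I : ListInstance κ} {H : Finset ℕ} {k : ℕ}
    (hI : I.Valid k) (hH : H ⊆ range I.n) :
    I.Colorable ↔ ∃ q < I.choices H I.n,
      (∀ c ∈ I.allColors, Disjoint (colored (I.decode H q) H c) (I.blocked (I.decode H q) H c)) ∧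
      (stableCovers I.nbr I.allColors
        (fun c => I.having c \ I.blocked (I.decode H q) H c) (range I.n \ H)).Nonempty := by
  rw [colorable_iff hI hH]
  constructor
  · rintro ⟨χ, hχ, hok, hc⟩
    have : ∀ h ∈ H, ∃ j < I.len h, I.col h j = χ h := fun h hh => by
      simpa [colors] using hχ h hh
    choose! d hd hdχ using this
    obtain ⟨q, hq, hqd⟩ := I.exists_decode_eq (m := I.n) d hd
    have hdec : ∀ h ∈ H, I.decode H q h = χ h := fun h hh => by
      rw [decode, hqd h hh (Finset.mem_range.1 (hH hh)), hdχ h hh]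
    have hcol : ∀ c, colored (I.decode H q) H c = colored χ H c := fun c =>
      filter_congr fun h hh => by rw [hdec h hh]
    refine ⟨q, hq, ?_⟩
    simp only [blocked, hcol] at hok hc ⊢
    exact ⟨hok, hc⟩
  · rintro ⟨q, hq, hok, hc⟩
    have hpos := I.len_pos_of_choices_pos hH (by omega : 0 < I.choices H I.n)
    exact ⟨_, fun h hh => I.decode_mem_colors q (hpos h hh), hok, hc⟩

end ListInstance

namespace WordRAM

variable {w : ℕ}

/-- Store in bank `6` the coloring of the set in register `2` whose number is in register `8`. -/
def decodeColoring (k : ℕ) : Prog :=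
  9 ::= ♯8 ;; forLoop 10 ♯0 (
    .cond ((♯2 >>ᵣ ♯10) &ᵣ ♭1)
      (.store 6 ♯10 (.load 2 (♭k *ᵣ ♯10 +ᵣ (♯9 %ᵣ .load 1 ♯10))) ;;
       9 ::= ♯9 /ᵣ .load 1 ♯10) .skip)

theorem mod_apply {a b : ℕ} (ha : a < 2 ^ w) (hb : b < 2 ^ w) :
    Op.mod.apply (BitVec.ofNat w a) (BitVec.ofNat w b) = BitVec.ofNat w (a % b) := by
  simp only [Op.apply, ← BitVec.toNat_inj, BitVec.toNat_umod, BitVec.toNat_ofNat,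
    Nat.mod_eq_of_lt ha, Nat.mod_eq_of_lt hb,
    Nat.mod_eq_of_lt (lt_of_le_of_lt (Nat.mod_le a b) ha)]

theorem div_apply {a b : ℕ} (ha : a < 2 ^ w) (hb : b < 2 ^ w) :
    Op.div.apply (BitVec.ofNat w a) (BitVec.ofNat w b) = BitVec.ofNat w (a / b) := by
  simp only [Op.apply, ← BitVec.toNat_inj, BitVec.toNat_udiv, BitVec.toNat_ofNat,
    Nat.mod_eq_of_lt ha, Nat.mod_eq_of_lt hb,
    Nat.mod_eq_of_lt (lt_of_le_of_lt (Nat.div_le_self a b) ha)]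

theorem decodeColoring_spec {I : ListInstance (BitVec w)} {k q : ℕ} (hI : I.Valid k)
    {H : Finset ℕ} {σ : State w} (hn : I.n < w) (hk : k < 2 ^ w) (hS : Stores I k σ)
    (h2 : σ.reg 2 = enc w H) (hH : H ⊆ range I.n) (hpos : ∀ h ∈ H, 0 < I.len h)
    (hq : q < 2 ^ w) (h8 : σ.reg 8 = BitVec.ofNat w q) :
    WP (decodeColoring k) (100 * (I.n + 1)) (fun τ => Keeps {9, 10} {6} σ τ ∧
      StoresColoring (I.decode H q) H τ) σ := by
  have hw : 0 < w := by omega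
  refine .seqT 2 (90 * (I.n + 1)) (by omega) (.straight rfl le_rfl ?_)
  refine .forLoopT (fun m τ => Keeps {9, 10} {6} σ τ ∧
      τ.reg 9 = BitVec.ofNat w (q / I.choices H m) ∧
      ∀ h ∈ H, h < m → τ.mem 6 (BitVec.ofNat w h) = I.decode H q h) I.n 40
    (by simp only [Expr.cost]; omega) (lt_two_pow (by omega)) hw ?_ ?_ ?_ ?_
  · intro m _ τ h _
    simp [Expr.eval, h.1.1 0 (by decide), hS.reg0]
  · refine ⟨((Keeps.refl _ _ _).setReg (by decide) _).setReg (by decide) _, ?_, by simp⟩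
    simp [Prog.exec, Expr.eval, h8, ListInstance.choices]
  · rintro m hm τ ⟨hK, h9, h6⟩ h10
    have hlen := hI.len_le m
    have hval : Expr.eval τ ((♯2 >>ᵣ ♯10) &ᵣ ♭1) = if m ∈ H then 1#w else 0#w := by
      simp only [Expr.eval, hK.1 2 (by decide), h2, h10, bit_test_apply _ (show m < w by omega)]
    have h1 : τ.mem 1 (BitVec.ofNat w m) = BitVec.ofNat w (I.len m) := by
      rw [hK.2 1 (by decide), hS.len m hm]
    have hqm : q / I.choices H m < 2 ^ w := lt_of_le_of_lt (Nat.div_le_self _ _) hq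
    refine .straight rfl (by simp [Prog.maxCost, Expr.cost]) ?_
    simp only [Prog.exec, hval, ite_eq_zero hw]
    by_cases hmH : m ∈ H
    · rw [if_neg (not_not.2 hmH)]
      have hload : Expr.eval τ (.load 2 (♭k *ᵣ ♯10 +ᵣ (♯9 %ᵣ .load 1 ♯10))) =
          I.decode H q m := by
        simp only [Expr.eval, h10, h9, h1, mod_apply hqm (show I.len m < 2 ^ w by omega),
          ofNat_mul_add]
        rw [hK.2 2 (by decide), hS.col m hm _ (Nat.mod_lt _ (hpos m hmH))]
        rfl
      refine ⟨by simp [h10], ((hK.setMem (by decide) _ _).setReg (by decide) _).setReg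
        (by decide) _, ?_, ?_⟩
      · simp only [State.setReg_reg, State.setMem_reg, if_true, show ¬(9 = 10) by decide, if_false,
          Expr.eval, h9, h10]
        rw [State.setMem_mem_ne _ (by decide), h1, div_apply hqm (by omega), Nat.div_div_eq_div_mul,
          ListInstance.choices_succ, if_pos hmH]
      · intro h hh hhm
        have h10' : Expr.eval τ ♯10 = BitVec.ofNat w m := h10
        simp only [State.setReg_mem, State.setMem_mem, true_and, hload, h10']
        by_cases hhm' : h = m
        · simp [hhm']
        · have := Finset.mem_range.1 (hH hh)
          rw [if_neg (by rwa [ofNat_inj (lt_two_pow (by omega)) (lt_two_pow (by omega))])]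
          exact h6 h hh (by omega)
    · rw [if_pos hmH]
      refine ⟨h10, hK.setReg (by decide) _, ?_, ?_⟩
      · simp [h9, ListInstance.choices_succ, hmH]
      · intro h hh hhm
        rcases Nat.lt_succ_iff_lt_or_eq.1 hhm with h' | rfl
        · exact h6 h hh h'
        · exact absurd hh hmH
  · rintro τ ⟨hK, -, h6⟩ -
    exact ⟨hK, fun h hh => h6 h hh (Finset.mem_range.1 (hH hh))⟩

/-- Count in register `6` the ways to choose colors for the set in register `2`. -/
def countChoices : Prog :=
  6 ::= ♭1 ;; forLoop 10 ♯0 (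
    .cond ((♯2 >>ᵣ ♯10) &ᵣ ♭1) (6 ::= ♯6 *ᵣ .load 1 ♯10) .skip)

theorem countChoices_spec {I : ListInstance (BitVec w)} {k : ℕ}
    {H : Finset ℕ} {σ : State w} (hn : I.n < w) (hS : Stores I k σ) (h2 : σ.reg 2 = enc w H) :
    WP countChoices (100 * (I.n + 1)) (fun τ => Frame 6 σ τ ∧
      τ.reg 6 = BitVec.ofNat w (I.choices H I.n)) σ := by
  have hw : 0 < w := by omega
  refine .seqT 2 (90 * (I.n + 1)) (by omega) (.straight rfl le_rfl ?_)
  refine .forLoopT (fun m τ => Frame 6 σ τ ∧ τ.reg 6 = BitVec.ofNat w (I.choices H m)) I.n 20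
    (by simp only [Expr.cost]; omega) (lt_two_pow (by omega)) hw ?_ ?_ ?_ ?_
  · intro m _ τ h _
    simp [Expr.eval, h.1.1 0 (by decide), hS.reg0]
  · refine ⟨((Frame.refl _ _).setReg (by omega) _).setReg (by omega) _, ?_⟩
    simp [Prog.exec, Expr.eval, ListInstance.choices]
  · rintro m hm τ ⟨hF, h6⟩ h10
    have hval : Expr.eval τ ((♯2 >>ᵣ ♯10) &ᵣ ♭1) = if m ∈ H then 1#w else 0#w := by
      simp only [Expr.eval, hF.1 2 (by omega), h2, h10, bit_test_apply _ (show m < w by omega)]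
    refine .straight rfl (by simp [Prog.maxCost, Expr.cost]) ?_
    simp only [Prog.exec, hval, ite_eq_zero hw]
    by_cases hmH : m ∈ H
    · rw [if_neg (not_not.2 hmH)]
      refine ⟨by simp [h10], (hF.setReg (by omega) _).setReg (by omega) _, ?_⟩
      simp [Expr.eval, h6, h10, hF.2, hS.len m hm, ListInstance.choices_succ, hmH, Op.apply,
        BitVec.ofNat_mul]
    · rw [if_pos hmH]
      refine ⟨h10, hF.setReg (by omega) _, ?_⟩
      simp [h6, ListInstance.choices_succ, hmH]
  · exact fun τ h _ => h

/-- Try all colorings of the set in register `2`. -/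
def search (k : ℕ) : Prog :=
  countChoices ;;
  7 ::= ♭0 ;;
  forLoop 8 ♯6 (
    decodeColoring k ;;
    sumTerms k ;;
    7 ::= ♯7 |ᵣ ♯20) ;;
  0 ::= ♯7

theorem natCast_ne_zero {m : ℕ} (hm : m < 2 ^ w) : (m : BitVec w) ≠ 0 ↔ m ≠ 0 := by
  have := ofNat_inj (w := w) hm (show 0 < 2 ^ w by positivity)
  exact not_congr this

/-- The sum is plus or minus the number of covers modulo 2^w, and this number is at most 2^(kn) <
2^w. -/
theorem sum_term_ne_zero {I : ListInstance (BitVec w)} {k : ℕ} (hI : I.Valid k)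
    {H A : Finset ℕ} {χ : ℕ → BitVec w} (hkn : k * I.n < w) (hA : A ⊆ range I.n \ H)
    (hst : IsStable I.nbr A) :
    ∑ S ∈ trimmed I.nbr A (range I.n \ H), (I.term χ H A S : BitVec w) ≠ 0 ↔
      (∀ c ∈ I.allColors, Disjoint (ListInstance.colored χ H c) (I.blocked χ H c)) ∧
      (stableCovers I.nbr I.allColors
        (fun c => I.having c \ I.blocked χ H c) (range I.n \ H)).Nonempty := by
  rw [ListInstance.sum_term hI hA hst]
  split_ifs with hok
  · have hlt := lt_of_le_of_lt (ListInstance.card_covers_le (χ := χ) (H := H) hI)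
      (Nat.pow_lt_pow_right (by norm_num) hkn)
    rw [← card_ne_zero, ← natCast_ne_zero hlt]
    rcases neg_one_pow_eq_or (BitVec w) (range I.n \ H).card with h | h <;> rw [h]
    · rw [one_mul]
      exact ⟨fun h => ⟨hok, h⟩, fun h => h.2⟩
    · rw [neg_one_mul, neg_ne_zero]
      exact ⟨fun h => ⟨hok, h⟩, fun h => h.2⟩
  · exact ⟨fun h => absurd rfl h, fun h => absurd h.1 hok⟩

/-- The sums for the different colorings are combined by a bitwise or, which unlike addition cannot
make nonzero words cancel. -/
theorem search_spec {I : ListInstance (BitVec w)} {k : ℕ} (hI : I.Valid k)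
    {H A : Finset ℕ} {l : List (Finset ℕ)} {σ : State w} (hn : I.n < w) (hk : k < 2 ^ w)
    (hkn : k * I.n < w) (hH : H ⊆ range I.n) (hA : A ⊆ range I.n \ H) (hst : IsStable I.nbr A)
    (hl : Enumerates I.nbr A (range I.n \ H) l) (hR : Ready I k H A l σ) :
    WP (search k) (1000 * ((k + 1) ^ 2 * (I.n + 1) ^ 2) * ((l.length + 1) *
      (I.choices H I.n + 1))) (fun τ => τ.reg 0 ≠ 0#w ↔ I.Colorable) σ := by
  have hw : 0 < w := by omega
  have hA' : A ⊆ range I.n := hA.trans sdiff_subset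
  obtain ⟨T, hT⟩ : ∃ T, T = (k + 1) ^ 2 * (I.n + 1) ^ 2 := ⟨_, rfl⟩
  have hT1 : I.n + 1 ≤ T := by
    rw [hT]
    calc I.n + 1 ≤ (I.n + 1) ^ 2 := Nat.le_self_pow (by norm_num) _
      _ ≤ _ := Nat.le_mul_of_pos_left _ (by positivity)
  obtain ⟨K, hK⟩ : ∃ K, K = I.choices H I.n := ⟨_, rfl⟩
  have hKw : K < 2 ^ w := by
    rw [hK]
    calc I.choices H I.n ≤ k ^ (H ∩ range I.n).card := I.choices_le hI _
      _ ≤ (2 ^ k) ^ (H ∩ range I.n).card := Nat.pow_le_pow_left Nat.lt_two_pow_self.le _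
      _ ≤ (2 ^ k) ^ I.n := Nat.pow_le_pow_right (by positivity)
        (by simpa using card_le_card (inter_subset_right : H ∩ range I.n ⊆ _))
      _ = 2 ^ (k * I.n) := by rw [pow_mul]
      _ < 2 ^ w := Nat.pow_lt_pow_right (by norm_num) hkn
  obtain ⟨E, hE⟩ : ∃ E, E = 600 * T * (l.length + 1) := ⟨_, rfl⟩
  have hE1 : 600 * T ≤ E := by rw [hE]; exact Nat.le_mul_of_pos_right _ (by omega)
  have hcost : 100 * (I.n + 1) + (2 + (K * (E + 100 * (I.n + 1) + 20) + 6 + 2)) ≤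
      1000 * T * ((l.length + 1) * (K + 1)) := by
    have h1 : 3 * (1000 * T * ((l.length + 1) * (K + 1))) = 5 * (K * E + E) := by rw [hE]; ring
    have h2 : K * (3 * (E + 100 * (I.n + 1) + 20)) ≤ K * (5 * E) :=
      Nat.mul_le_mul_left _ (by omega)
    rw [Nat.mul_left_comm, Nat.mul_left_comm K 5] at h2
    omega
  rw [← hT, ← hK]
  refine .seqT _ _ hcost ((countChoices_spec hn hR.stores hR.reg2).mono le_rfl ?_)
  rintro τ₀ ⟨hF₀, h6₀⟩
  rw [← hK] at h6₀
  refine .seqT _ _ le_rfl (.straight rfl le_rfl ?_)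
  refine .seqT _ _ le_rfl ?_
  refine .forLoopT (fun m τ => ((∀ x < 6, τ.reg x = σ.reg x) ∧ τ.reg 6 = BitVec.ofNat w K ∧
      ∀ b ≠ 6, τ.mem b = σ.mem b) ∧
      (τ.reg 7 ≠ 0#w ↔ ∃ q < m, ∑ S ∈ trimmed I.nbr A (range I.n \ H),
        (I.term (I.decode H q) H A S : BitVec w) ≠ 0)) K (E + 100 * (I.n + 1) + 12)
    (by simp only [Expr.cost]; ring_nf; omega) hKw hw ?_ ?_ ?_ ?_
  · intro m _ τ h _
    simp [Expr.eval, h.1.2.1]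
  · refine ⟨⟨fun x hx => ?_, ?_, fun b _ => ?_⟩, ?_⟩
    · simp [Prog.exec, show x ≠ 8 by omega, show x ≠ 7 by omega, hF₀.1 x hx]
    · simp [Prog.exec, h6₀]
    · simp [Prog.exec, hF₀.2]
    · simp [Prog.exec, Expr.eval]
  · rintro m hm τ ⟨⟨hr, h6, hb⟩, h7⟩ h8
    have hR₁ : ∀ ρ : State w, (∀ x < 6, ρ.reg x = σ.reg x) → (∀ b ≠ 6, ρ.mem b = σ.mem b) →
        Ready I k H A l ρ := fun ρ h1 h2 =>
      ⟨hR.stores.of_eq (h1 0 (by omega)) (h2 1 (by decide)) (h2 2 (by decide)) (h2 3 (by decide)),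
        (h1 2 (by omega)).trans hR.reg2, (h1 3 (by omega)).trans hR.reg3,
        hR.list.of_eq (h1 4 (by omega)) (h2 4 (by decide)) (h2 5 (by decide))⟩
    have hRτ := hR₁ τ hr hb
    -- The loop body runs only if there is at least one choice, so no list in `H` is empty and the
    -- divisors in the decoding are positive.
    have hpos := I.len_pos_of_choices_pos hH (by omega : 0 < I.choices H I.n)
    refine .seqT (100 * (I.n + 1)) (E + 8) (by omega) ((decodeColoring_spec hI hn hk hRτ.stores
      hRτ.reg2 hH hpos (by omega) h8).mono le_rfl ?_)
    rintro τ₁ ⟨hK₁, hχ⟩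
    have hr₁ : ∀ x < 6, τ₁.reg x = σ.reg x := fun x hx => by
      rw [hK₁.1 x (by simp; omega), hr x hx]
    have hb₁ : ∀ b ≠ 6, τ₁.mem b = σ.mem b := fun b hb' => by
      rw [hK₁.2 b (by simpa using hb'), hb b hb']
    refine .seqT E 6 (by omega) ((sumTerms_spec hI hn hk hH hA' hl (hR₁ τ₁ hr₁ hb₁) hχ).mono
      (by rw [hE, hT]) ?_)
    rintro τ₂ ⟨hF₂, h20⟩
    refine .straight rfl (by simp [Prog.maxCost, Expr.cost]) ⟨?_, ⟨?_, ?_, ?_⟩, ?_⟩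
    · simp [Prog.exec, hF₂.1, hK₁.1, h8]
    · intro x hx
      simp [Prog.exec, show x ≠ 8 by omega, show x ≠ 7 by omega, hF₂.1 x (by omega), hr₁ x hx]
    · simp [Prog.exec, hF₂.1, hK₁.1, h6]
    · intro b hb'
      simp [Prog.exec, hF₂.2, hb₁ b hb']
    · simp only [Prog.exec, State.setReg_reg, show ¬(7 = 8) by decide, if_true, if_false,
        Expr.eval, h20, hF₂.1 7 (by omega), hK₁.1 7 (by decide)]
      simp only [Op.apply]
      rw [ne_eq, BitVec.or_eq_zero_iff, not_and_or]
      constructor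
      · rintro (h | h)
        · obtain ⟨q, hq, h'⟩ := h7.1 h
          exact ⟨q, by omega, h'⟩
        · exact ⟨m, by omega, h⟩
      · rintro ⟨q, hq, h'⟩
        rcases Nat.lt_succ_iff_lt_or_eq.1 hq with h'' | rfl
        · exact Or.inl (h7.2 ⟨q, h'', h'⟩)
        · exact Or.inr h'
  · rintro τ ⟨-, h7⟩ -
    refine .straight rfl le_rfl ?_
    simp only [Prog.exec, State.setReg_reg, if_true, Expr.eval]
    rw [h7, ListInstance.colorable_iff_exists_decode hI hH, hK]
    simp only [sum_term_ne_zero hI hkn hA hst]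

end WordRAM

end

/-! ### The sizes of the heavy set, the scattered set and the trimmed family. -/

namespace ListInstance

open Finset

variable {κ : Type*} {I : ListInstance κ} {d D : ℕ}

/-- Double counting: a low vertex is a neighbor of at most `d` vertices. -/
theorem sum_card_nbr_inter_low_le (hN : IsNbhd I.nbr) :
    ∑ v ∈ range I.n, (I.nbr v ∩ I.low d).card ≤ d * I.n := by
  calc ∑ v ∈ range I.n, (I.nbr v ∩ I.low d).card
      = ∑ v ∈ range I.n, ∑ u ∈ I.low d, if u ∈ I.nbr v then 1 else 0 := by
        refine sum_congr rfl fun v _ => ?_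
        rw [← card_filter, filter_mem_eq_inter, inter_comm]
    _ = ∑ u ∈ I.low d, ∑ v ∈ range I.n, if u ∈ I.nbr v then 1 else 0 := sum_comm
    _ ≤ ∑ u ∈ I.low d, d := by
        refine sum_le_sum fun u hu => ?_
        rw [← card_filter]
        exact (card_le_card fun v hv => hN.symm (mem_filter.1 hv).2).trans (mem_filter.1 hu).2
    _ ≤ d * I.n := by
        rw [sum_const, smul_eq_mul, mul_comm]
        exact Nat.mul_le_mul_left _ ((card_filter_le _ _).trans (card_range _).le)

/-- The sum is geometric, hence less than twice its largest term, which is at most `x`. This makes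
the bound independent of the number of scales. -/
theorem sum_ite_two_pow_le (D x J : ℕ) :
    ∑ j ∈ range J, (if D * 2 ^ j ≤ x then D * 2 ^ j else 0) ≤ 2 * x := by
  have h : ∀ J, ∑ j ∈ range J, (if D * 2 ^ j ≤ x then D * 2 ^ j else 0) ≤ D * 2 ^ J := by
    intro J
    induction J with
    | zero => simp
    | succ J ih =>
      rw [sum_range_succ, pow_succ, ← mul_assoc]
      split_ifs <;> omega
  induction J with
  | zero => simp
  | succ J ih =>
    rw [sum_range_succ]
    have := h J
    split_ifs <;> omega

/-- By averaging over the scales, some scale has few heavy vertices. -/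
theorem exists_card_heavy_le (hN : IsNbhd I.nbr) (D : ℕ) {J M : ℕ} (hJ : 2 * d * M < J) :
    ∃ j < J, (I.heavy (I.low d) (D * 2 ^ j)).card * (D * 2 ^ j) * M ≤ I.n := by
  by_contra! h
  -- If every scale fails, each contributes at least `I.n + 1`. Exchanging the sums, a vertex
  -- contributes at most twice its number of low neighbors, in all at most 2dn; multiplied by `M`,
  -- this contradicts `J > 2dM`.
  have h1 : J * (I.n + 1) ≤ M * (2 * (d * I.n)) := by
    calc J * (I.n + 1) = ∑ j ∈ range J, (I.n + 1) := by simp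
      _ ≤ ∑ j ∈ range J, (I.heavy (I.low d) (D * 2 ^ j)).card * (D * 2 ^ j) * M :=
          sum_le_sum fun j hj => h j (Finset.mem_range.1 hj)
      _ = M * ∑ j ∈ range J, ∑ v ∈ range I.n,
            if D * 2 ^ j ≤ (I.nbr v ∩ I.low d).card then D * 2 ^ j else 0 := by
          rw [mul_comm M, sum_mul]
          refine sum_congr rfl fun j _ => ?_
          rw [← sum_filter, sum_const, smul_eq_mul, heavy]
      _ = M * ∑ v ∈ range I.n, ∑ j ∈ range J,
            if D * 2 ^ j ≤ (I.nbr v ∩ I.low d).card then D * 2 ^ j else 0 := by rw [sum_comm]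
      _ ≤ M * ∑ v ∈ range I.n, 2 * (I.nbr v ∩ I.low d).card :=
          Nat.mul_le_mul_left _ (sum_le_sum fun v _ => sum_ite_two_pow_le _ _ _)
      _ ≤ _ := by
          rw [← mul_sum]
          exact Nat.mul_le_mul_left _ (Nat.mul_le_mul_left _ (sum_card_nbr_inter_low_le hN))
  have h2 : (2 * d * M + 1) * (I.n + 1) ≤ J * (I.n + 1) := Nat.mul_le_mul_right _ hJ
  have h3 : M * (2 * (d * I.n)) = 2 * d * M * I.n := by ring
  rw [h3] at h1
  have h4 : (2 * d * M + 1) * (I.n + 1) = 2 * d * M * I.n + (I.n + 2 * d * M + 1) := by ring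
  omega

/-- A low vertex has at most `d < D` neighbors altogether, so it is never heavy. -/
theorem low_sdiff_heavy (hD : d < D) : I.low d \ I.heavy (I.low d) D = I.low d := by
  refine sdiff_eq_self_of_disjoint (disjoint_left.2 fun v hv hv' => ?_)
  have h1 := (mem_filter.1 hv).2
  have h2 := (mem_filter.1 hv').2
  have h3 := card_le_card (inter_subset_left : I.nbr v ∩ I.low d ⊆ _)
  omega

/-- By maximality every low `v` shares with some `u ∈ A` a point `x` of their closed neighborhoods
outside the heavy set. Given `u` there are at most `d + 1` such `x`; given `x`, which is not heavy,
`v` is `x` itself or one of fewer than `D` low neighbors of `x`. -/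
theorem card_low_le (hN : IsNbhd I.nbr) (hsub : ∀ v, I.nbr v ⊆ range I.n)
    {A : Finset ℕ} (hA : A ⊆ I.low d)
    (hmax : ∀ v ∈ I.low d, ∃ u ∈ A,
      ¬Disjoint (I.closedNbr (I.heavy (I.low d) D) u) (I.closedNbr (I.heavy (I.low d) D) v)) :
    (I.low d).card ≤ A.card * ((d + 1) * D) := by
  have hcov : I.low d ⊆ A.biUnion fun u => (I.closedNbr (I.heavy (I.low d) D) u).biUnion
      fun x => insert x (I.nbr x ∩ I.low d) := by
    intro v hv
    obtain ⟨u, hu, hd⟩ := hmax v hv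
    obtain ⟨x, hxu, hxv⟩ := not_disjoint_iff.1 hd
    refine mem_biUnion.2 ⟨u, hu, mem_biUnion.2 ⟨x, hxu, ?_⟩⟩
    rcases mem_insert.1 (Finset.mem_sdiff.1 hxv).1 with rfl | h
    · exact mem_insert_self _ _
    · exact mem_insert_of_mem (mem_inter.2 ⟨hN.symm h, hv⟩)
  refine (card_le_card hcov).trans (card_biUnion_le_card_mul _ _ _ fun u hu => ?_)
  have hu' := mem_filter.1 (hA hu)
  refine (card_biUnion_le_card_mul _ _ D fun x hx => ?_).trans (Nat.mul_le_mul_right _ ?_)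
  · obtain ⟨hx1, hx2⟩ := Finset.mem_sdiff.1 hx
    have hxn : x ∈ range I.n := by
      rcases mem_insert.1 hx1 with rfl | h
      · exact hu'.1
      · exact hsub _ h
    have : (I.nbr x ∩ I.low d).card < D := by
      by_contra! h
      exact hx2 (mem_filter.2 ⟨hxn, h⟩)
    exact (card_insert_le _ _).trans this
  · exact (card_le_card sdiff_subset).trans ((card_insert_le _ _).trans (Nat.succ_le_succ hu'.2))

theorem card_trimmed_low_le (hN : IsNbhd I.nbr) {A H : Finset ℕ} (hA : A ⊆ I.low d \ H)
    (hdis : ∀ u ∈ A, ∀ v ∈ A, u ≠ v → Disjoint (I.closedNbr H u) (I.closedNbr H v)) :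
    (trimmed I.nbr A (range I.n \ H)).card * (2 ^ (d + 1)) ^ A.card ≤
      2 ^ I.n * (2 ^ (d + 1) - 1) ^ A.card := by
  refine (card_trimmed_le hN (fun v hv => ?_) (fun v hv => ?_) fun u hu v hv huv => ?_).trans
    (Nat.mul_le_mul_right _ (Nat.pow_le_pow_right (by norm_num) ?_))
  · obtain ⟨h1, h2⟩ := Finset.mem_sdiff.1 (hA hv)
    exact Finset.mem_sdiff.2 ⟨(mem_filter.1 h1).1, h2⟩
  · exact (mem_filter.1 (Finset.mem_sdiff.1 (hA hv)).1).2
  · rw [disjoint_left]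
    intro x hx hxv
    obtain ⟨hxu, hxP⟩ := mem_inter.1 hx
    have hxH := (Finset.mem_sdiff.1 hxP).2
    exact disjoint_left.1 (hdis u hu v hv huv) (Finset.mem_sdiff.2 ⟨hxu, hxH⟩)
      (Finset.mem_sdiff.2 ⟨hxv, hxH⟩)
  · exact (card_le_card sdiff_subset).trans (card_range _).le

end ListInstance

/-! ### Exponential bounds for the running time. -/

open Real in
/-- The gain from the independent set outweighs the cost of the heavy vertices. -/
theorem mul_pow_le_of_trimmed {k d D E M n a h F : ℕ} {α : ℝ} (hk : 0 < k) (hα : 0 < α)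
    (hD : 0 < D) (hDE : D ≤ E) (hM : 0 < M)
    (hkM : 2 * Real.log k * (d + 1) ≤ -Real.log (1 - 1 / 2 ^ (d + 1)) * α * M)
    (hF : F * (2 ^ (d + 1)) ^ a ≤ 2 ^ n * (2 ^ (d + 1) - 1) ^ a)
    (hh : h * D * M ≤ n) (ha : α * n ≤ a * ((d + 1) * D)) :
    (F * k ^ h : ℝ) ≤
      (2 * Real.exp (Real.log (1 - 1 / 2 ^ (d + 1)) * α / (2 * (d + 1) * E))) ^ n := by
  have hq1 : (1 : ℝ) < 2 ^ (d + 1) := one_lt_pow₀ (by norm_num) (by omega)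
  have hq0 : (0 : ℝ) < 2 ^ (d + 1) := by positivity
  obtain ⟨q, hq⟩ : ∃ q : ℝ, q = 2 ^ (d + 1) := ⟨_, rfl⟩
  have hF' : (F : ℝ) * q ^ a ≤ 2 ^ n * (q - 1) ^ a := by
    have h1 : (1 : ℕ) ≤ 2 ^ (d + 1) := Nat.one_le_two_pow
    rw [hq]
    exact_mod_cast (by push_cast [h1]; exact_mod_cast hF :
      (F : ℝ) * ((2 ^ (d + 1) : ℕ) : ℝ) ^ a ≤ 2 ^ n * (((2 ^ (d + 1) - 1 : ℕ)) : ℝ) ^ a)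
  rw [← hq] at hq1 hq0 hkM ⊢
  have hρ0 : 0 < 1 - 1 / q := by
    rw [sub_pos, div_lt_one hq0]; exact hq1
  have hρ1 : Real.log (1 - 1 / q) < 0 :=
    Real.log_neg hρ0 (by have : 0 < 1 / q := by positivity
                         linarith)
  obtain ⟨ℓ, hℓ⟩ : ∃ ℓ, ℓ = -Real.log (1 - 1 / q) := ⟨_, rfl⟩
  have hℓ' : Real.log (1 - 1 / q) = -ℓ := by rw [hℓ]; ring
  have hρ : 1 - 1 / q = Real.exp (-ℓ) := by rw [← hℓ', Real.exp_log hρ0]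
  have hF2 : (F : ℝ) ≤ 2 ^ n * Real.exp (-ℓ * a) := by
    rw [mul_comm (-ℓ), Real.exp_nat_mul, ← hρ]
    rw [show 1 - 1 / q = (q - 1) / q by field_simp, div_pow, ← mul_div_assoc,
      le_div_iff₀ (by positivity)]
    exact hF'
  have hk' : (0 : ℝ) < k := by exact_mod_cast hk
  have hkh : (k : ℝ) ^ h = Real.exp (h * Real.log k) := by
    rw [Real.exp_nat_mul, Real.exp_log hk']
  have hD' : (0 : ℝ) < D := by exact_mod_cast hD
  have hE' : (0 : ℝ) < E := by exact_mod_cast hD.trans_le hDE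
  have hM' : (0 : ℝ) < M := by exact_mod_cast hM
  have hDE' : (D : ℝ) ≤ E := by exact_mod_cast hDE
  have hh' : (h : ℝ) * D * M ≤ n := by exact_mod_cast hh
  have hlog : 0 ≤ Real.log k := Real.log_nonneg (by exact_mod_cast hk)
  rw [hℓ'] at hkM hρ1 ⊢
  rw [neg_neg] at hkM
  have hℓ0 : 0 < ℓ := by linarith
  rw [hkh, mul_pow, ← Real.exp_nat_mul]
  calc (F : ℝ) * Real.exp (h * Real.log k)
      ≤ 2 ^ n * Real.exp (-ℓ * a) * Real.exp (h * Real.log k) :=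
        mul_le_mul_of_nonneg_right hF2 (Real.exp_pos _).le
    _ = 2 ^ n * Real.exp (-ℓ * a + h * Real.log k) := by rw [Real.exp_add]; ring
    _ ≤ _ := by
        refine mul_le_mul_of_nonneg_left (Real.exp_le_exp.2 ?_) (by positivity)
        have hd : (0 : ℝ) < d + 1 := by positivity
        -- The choice of `M` makes the cost of trying all colorings of the heavy set at most half of
        -- the gain in `h2`, whatever the scale `D`.
        have h1 : h * Real.log k ≤ n * (ℓ * α / (2 * (d + 1) * D)) := by
          have e1 : 2 * (d + 1) * D * M * (h * Real.log k) ≤ ℓ * α * M * n := by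
            calc 2 * (d + 1) * D * M * (h * Real.log k) =
                (2 * Real.log k * (d + 1)) * (h * D * M) := by ring
              _ ≤ (2 * Real.log k * (d + 1)) * n := by gcongr
              _ ≤ ℓ * α * M * n := by gcongr
          rw [← mul_div_assoc, le_div_iff₀ (by positivity)]
          refine le_of_mul_le_mul_right ?_ hM'
          linarith
        have h2 : n * (ℓ * α / ((d + 1) * D)) ≤ ℓ * a := by
          rw [← mul_div_assoc, div_le_iff₀ (by positivity)]
          calc n * (ℓ * α) = ℓ * (α * n) := by ring
            _ ≤ ℓ * (a * ((d + 1) * D)) := by gcongr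
            _ = _ := by ring
        -- The scale depends on the input; replacing `D` by its upper bound `E` gives a base that
        -- does not.
        have h3 : ℓ * α / (2 * (d + 1) * E) ≤ ℓ * α / (2 * (d + 1) * D) := by gcongr
        have h4 : n * (ℓ * α / (2 * (d + 1) * E)) ≤ n * (ℓ * α / (2 * (d + 1) * D)) := by gcongr
        have h5 : n * (ℓ * α / ((d + 1) * D)) = 2 * (n * (ℓ * α / (2 * (d + 1) * D))) := by
          field_simp
        have h6 : (n : ℝ) * (-ℓ * α / (2 * (d + 1) * E)) = -(n * (ℓ * α / (2 * (d + 1) * E))) := by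
          ring
        rw [h6]
        linarith

/-- Polynomial factors do not matter for exponential bounds. -/
theorem isBigO_floor_mul_pow {C : ℕ} {β δ : ℝ} (hβ : 0 ≤ β) (hβδ : β < δ) :
    (fun n : ℕ => ((⌊C * (n + 1 : ℝ) ^ 2 * β ^ n⌋₊ : ℕ) : ℝ)) =O[atTop] fun n => δ ^ n := by
  have h1 : (fun n : ℕ => ((⌊C * (n + 1 : ℝ) ^ 2 * β ^ n⌋₊ : ℕ) : ℝ)) =O[atTop]
      fun n : ℕ => (n : ℝ) ^ 2 * β ^ n := by
    -- The 4 comes from n + 1 ≤ 2n for n ≥ 1.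
    refine IsBigO.of_bound (4 * C) (eventually_atTop.2 ⟨1, fun n hn => ?_⟩)
    have hn' : (1 : ℝ) ≤ n := by exact_mod_cast hn
    rw [Real.norm_of_nonneg (by positivity), Real.norm_of_nonneg (by positivity)]
    refine (Nat.floor_le (by positivity)).trans ?_
    calc (C : ℝ) * (n + 1) ^ 2 * β ^ n ≤ C * (n + n) ^ 2 * β ^ n := by gcongr
      _ = _ := by ring
  exact h1.trans (isLittleO_pow_const_mul_const_pow_const_pow_of_norm_lt 2
    (by rwa [Real.norm_of_nonneg hβ])).isBigO

/-! ### The complete algorithm. -/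

namespace WordRAM

open Finset

variable {w : ℕ}

/-- The algorithm: `d` bounds the degrees of the low vertices, and the other parameters control
the choice of the set of heavy vertices. -/
def solve (k d J M : ℕ) : Prog :=
  readGraph d ;; chooseHeavy (d + 1) J M ;; chooseScattered ;; listTrimmed ;; search k

theorem solve_cost_le {n k J F K X : ℕ} (hF : 0 < F) (hX : 0 < X) (hK : K ≤ X) :
    100 * (n + 1) ^ 2 + ((J + 1) * (200 * (n + 1) ^ 2) + (100 * (n + 1) + (500 * (n + 1) * (F + 1) +
      1000 * ((k + 1) ^ 2 * (n + 1) ^ 2) * ((F + 1) * (K + 1))))) ≤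
      (1200 + 200 * (J + 1) + 4000 * (k + 1) ^ 2) * (n + 1) ^ 2 * (F * X) := by
  have h1 : n + 1 ≤ (n + 1) ^ 2 := Nat.le_self_pow (by norm_num) _
  have h2 : 1 ≤ F * X := Nat.mul_pos hF hX
  have h3 : F + 1 ≤ 2 * (F * X) := by
    have : F ≤ F * X := Nat.le_mul_of_pos_right _ hX
    omega
  have h4 : (F + 1) * (K + 1) ≤ 4 * (F * X) := by
    calc (F + 1) * (K + 1) ≤ (2 * F) * (2 * X) := Nat.mul_le_mul (by omega) (by omega)
      _ = _ := by ring
  obtain ⟨N, hN⟩ : ∃ N, N = (n + 1) ^ 2 := ⟨_, rfl⟩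
  rw [← hN] at h1 ⊢
  calc _ ≤ 100 * N * (F * X) + ((J + 1) * (200 * N) * (F * X) + (100 * N * (F * X) +
        (500 * N * (2 * (F * X)) + 1000 * ((k + 1) ^ 2 * N) * (4 * (F * X))))) := by
        refine Nat.add_le_add (Nat.le_mul_of_pos_right _ h2) (Nat.add_le_add
          (Nat.le_mul_of_pos_right _ h2) (Nat.add_le_add ?_ (Nat.add_le_add
          (Nat.mul_le_mul (Nat.mul_le_mul_left _ h1) h3) (Nat.mul_le_mul_left _ h4))))
        exact (Nat.mul_le_mul_left _ h1).trans (Nat.le_mul_of_pos_right _ h2)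
    _ = _ := by ring

/-- The cost is left as the size of the trimmed family times `k ^ H.card`, together with the
inequalities that bound this product. In the word length, the first summand covers the products
compared when the heavy set is chosen, `k` keeps the number of covers below 2^w, and the rest makes
the sets and the constants fit. -/
theorem solve_spec {I : ListInstance (BitVec w)} {k d J M : ℕ} (hI : I.Valid k) (hk : 0 < k)
    (hJ : 2 * d * M < J) (hw : ((d + 1) * 2 ^ J * (M + 1) + k + J + d + 3) * (I.n + 1) ≤ w)
    {σ : State w} (h0 : σ.reg 0 = BitVec.ofNat w I.n)
    (hadj : ∀ u < I.n, ∀ v < I.n, σ.mem 0 (BitVec.ofNat w (I.n * u + v)) =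
      if v ∈ I.nbr u then 1#w else 0#w)
    (hlen : ∀ v < I.n, σ.mem 1 (BitVec.ofNat w v) = BitVec.ofNat w (I.len v))
    (hcol : ∀ v < I.n, ∀ j < I.len v, σ.mem 2 (BitVec.ofNat w (k * v + j)) = I.col v j) :
    ∃ D A H, 0 < D ∧ D ≤ (d + 1) * 2 ^ J ∧ H.card * D * M ≤ I.n ∧
      (I.low d).card ≤ A.card * ((d + 1) * D) ∧
      0 < (trimmed I.nbr A (range I.n \ H)).card ∧
      (trimmed I.nbr A (range I.n \ H)).card * (2 ^ (d + 1)) ^ A.card ≤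
        2 ^ I.n * (2 ^ (d + 1) - 1) ^ A.card ∧
      WP (solve k d J M) ((1200 + 200 * (J + 1) + 4000 * (k + 1) ^ 2) * (I.n + 1) ^ 2 *
        ((trimmed I.nbr A (range I.n \ H)).card * k ^ H.card))
        (fun τ => τ.reg 0 ≠ 0#w ↔ I.Colorable) σ := by
  have hpow := @Nat.lt_two_pow_self w
  have hbig : (I.n + 1) * ((d + 1) * 2 ^ J) * (M + 1) < 2 ^ w := by
    refine lt_of_le_of_lt (le_trans ?_ hw) hpow
    calc _ = (d + 1) * 2 ^ J * (M + 1) * (I.n + 1) := by ring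
      _ ≤ _ := Nat.mul_le_mul_right _ (by omega)
  have hsum : k * I.n + k + J + d + 3 * (I.n + 1) ≤ w := by
    refine le_trans ?_ hw
    calc k * I.n + k + J + d + 3 * (I.n + 1) ≤ (k + J + d + 3) * (I.n + 1) := by nlinarith
      _ ≤ _ := Nat.mul_le_mul_right _ (by omega)
  have hn : I.n < w := by omega
  obtain ⟨t₁, τ₁, hr₁, ht₁, h0₁, h1₁, h3₁, hm₁⟩ :=
    readGraph_spec (d := d) hn (by omega) hI.nbr_subset h0 hadj
  have hS₁ : Stores I k τ₁ := ⟨h0₁, by rw [hm₁ 1 (by decide)]; exact hlen,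
    by rw [hm₁ 2 (by decide)]; exact hcol, h3₁⟩
  obtain ⟨t₂, τ₂, hr₂, ht₂, hF₂, j, hj, hH, h2₂⟩ := chooseHeavy_spec hn (by omega) hI.nbr_subset
    hbig hS₁ h1₁ (ListInstance.exists_card_heavy_le hI.isNbhd (d + 1) hJ)
  obtain ⟨D, hD⟩ : ∃ D, D = (d + 1) * 2 ^ j := ⟨_, rfl⟩
  rw [← hD] at hH h2₂
  have hdD : d < D := by
    have : 1 ≤ 2 ^ j := Nat.one_le_two_pow
    have := Nat.le_mul_of_pos_right (d + 1) this
    omega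
  have hDJ : D ≤ (d + 1) * 2 ^ J := by
    rw [hD]
    exact Nat.mul_le_mul_left _ (Nat.pow_le_pow_right (by norm_num) hj.le)
  have hS₂ := hS₁.frame hF₂ (by norm_num)
  obtain ⟨t₃, τ₃, hr₃, ht₃, hF₃, A, h3, hA, hdis, hmax⟩ := chooseScattered_spec hn hI.nbr_subset
    hS₂ ((hF₂.1 1 (by omega)).trans h1₁) h2₂ (filter_subset _ _)
  rw [ListInstance.low_sdiff_heavy hdD] at hmax
  obtain ⟨H, hHdef⟩ : ∃ H, H = I.heavy (I.low d) D := ⟨_, rfl⟩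
  have hlow := ListInstance.card_low_le (D := D) hI.isNbhd hI.nbr_subset
    (hA.trans sdiff_subset) hmax
  rw [← hHdef] at hH h2₂ hA hdis
  have hHn : H ⊆ range I.n := by rw [hHdef]; exact filter_subset _ _
  have hAn : A ⊆ range I.n \ H := hA.trans (sdiff_subset_sdiff (filter_subset _ _) le_rfl)
  have hS₃ := hS₂.frame hF₃ (by norm_num)
  have h2₃ : τ₃.reg 2 = enc w H := (hF₃.1 2 (by norm_num)).trans h2₂
  obtain ⟨t₄, τ₄, hr₄, ht₄, hK₄, l, hl, hSl⟩ :=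
    listTrimmed_spec hI.isNbhd (by omega) hAn hdis hS₃ h2₃ h3
  have hst : IsStable I.nbr A := by
    intro u hu v hv huv
    by_cases h : u = v
    · subst h; exact hI.isNbhd.irrefl _ huv
    · have hvH := (Finset.mem_sdiff.1 (hAn hv)).2
      exact disjoint_left.1 (hdis u hu v hv h)
        (Finset.mem_sdiff.2 ⟨mem_insert_of_mem huv, hvH⟩)
        (Finset.mem_sdiff.2 ⟨mem_insert_self _ _, hvH⟩)
  have hR : Ready I k H A l τ₄ := ⟨hS₃.of_eq (hK₄.1 0 (by decide)) (hK₄.2 1 (by decide))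
    (hK₄.2 2 (by decide)) (hK₄.2 3 (by decide)), (hK₄.1 2 (by decide)).trans h2₃,
    (hK₄.1 3 (by decide)).trans h3, hSl⟩
  obtain ⟨t₅, τ₅, hr₅, ht₅, h5⟩ := search_spec hI hn (by omega) (by omega) hHn hAn hst hl hR
  have hpos : 0 < (trimmed I.nbr A (range I.n \ H)).card :=
    card_pos.2 ⟨∅, mem_trimmed.2 ⟨empty_subset _, by simp⟩⟩
  refine ⟨D, A, H, by omega, hDJ, hH, hlow, hpos,
    ListInstance.card_trimmed_low_le hI.isNbhd hA hdis, _, τ₅,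
    .seq hr₁ (.seq hr₂ (.seq hr₃ (.seq hr₄ hr₅))), ?_, h5⟩
  rw [hl.length_eq] at ht₅
  refine le_trans (Nat.add_le_add ht₁ (Nat.add_le_add ht₂ (Nat.add_le_add ht₃
    (Nat.add_le_add ht₄ ht₅)))) (solve_cost_le hpos (by positivity) ?_)
  have := I.choices_le hI (H := H) I.n
  rwa [inter_eq_left.2 hHn] at this

end WordRAM

/-! ### From graphs with lists of colors to numbered instances. -/

namespace ListInstance

open Finset

variable {n : ℕ} {U : Type*} {κ : Type*}

open scoped Classical in
/-- The instance given by a graph and lists of colors, where colors are replaced by their names. -/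
noncomputable def ofGraph [Zero κ] (G : SimpleGraph (Fin n)) (L : Fin n → List U) (name : U → κ) :
    ListInstance κ where
  n := n
  nbr v := (range n).filter fun u => ∃ a b : Fin n, G.Adj a b ∧ a.1 = v ∧ b.1 = u
  len v := if h : v < n then (L ⟨v, h⟩).length else 0
  col v j := if h : v < n then ((L ⟨v, h⟩).map name).getD j 0 else 0

variable [Zero κ] {G : SimpleGraph (Fin n)} {L : Fin n → List U} {name : U → κ}

theorem mem_ofGraph_nbr {u v : ℕ} : u ∈ (ofGraph G L name).nbr v ↔
    ∃ a b : Fin n, G.Adj a b ∧ a.1 = v ∧ b.1 = u := by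
  simp only [ofGraph, mem_filter, Finset.mem_range, and_iff_right_iff_imp]
  rintro ⟨a, b, -, -, rfl⟩
  exact b.2

theorem mem_ofGraph_nbr_fin {a b : Fin n} : b.1 ∈ (ofGraph G L name).nbr a ↔ G.Adj a b := by
  rw [mem_ofGraph_nbr]
  constructor
  · rintro ⟨a', b', h, ha, hb⟩
    rwa [Fin.ext ha, Fin.ext hb] at h
  · exact fun h => ⟨a, b, h, rfl, rfl⟩

theorem ofGraph_len (v : Fin n) : (ofGraph G L name).len v = (L v).length := by
  simp [ofGraph]

theorem ofGraph_col (v : Fin n) (j : ℕ) :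
    (ofGraph G L name).col v j = ((L v).map name).getD j 0 := by
  simp [ofGraph]

theorem ofGraph_valid {k : ℕ} {C : Fin n → Finset U} (hC : ∀ v, (C v).card ≤ k)
    (hL : ∀ v, (L v).Nodup ∧ ∀ x, x ∈ L v ↔ x ∈ C v)
    (hname : Set.InjOn name {x | ∃ v, x ∈ C v}) : (ofGraph G L name).Valid k where
  isNbhd := by
    refine ⟨fun {u v} h => ?_, fun v h => ?_⟩
    · obtain ⟨a, b, h, ha, hb⟩ := mem_ofGraph_nbr.1 h
      exact mem_ofGraph_nbr.2 ⟨b, a, h.symm, hb, ha⟩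
    · obtain ⟨a, b, h, ha, hb⟩ := mem_ofGraph_nbr.1 h
      exact h.ne (Fin.ext (ha.trans hb.symm))
  nbr_subset v u hu := by
    obtain ⟨a, b, -, -, rfl⟩ := mem_ofGraph_nbr.1 hu
    exact Finset.mem_range.2 b.2
  len_le v := by
    by_cases h : v < n
    · classical
      rw [show v = (⟨v, h⟩ : Fin n).1 from rfl, ofGraph_len]
      have : (L ⟨v, h⟩).toFinset = C ⟨v, h⟩ := by
        ext x; rw [List.mem_toFinset, (hL _).2]
      rw [← List.toFinset_card_of_nodup (hL _).1, this]
      exact hC _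
    · simp [ofGraph, h]
  col_inj v := by
    by_cases h : v < n
    · rw [show v = (⟨v, h⟩ : Fin n).1 from rfl, ofGraph_len]
      intro i hi j hj hij
      simp only [coe_range, Set.mem_Iio] at hi hj
      rw [ofGraph_col, ofGraph_col, List.getD_eq_getElem _ _ (by simpa using hi),
        List.getD_eq_getElem _ _ (by simpa using hj), List.getElem_map, List.getElem_map] at hij
      have := hname ⟨_, ((hL ⟨v, h⟩).2 _).1 (List.getElem_mem hi)⟩
        ⟨_, ((hL ⟨v, h⟩).2 _).1 (List.getElem_mem hj)⟩ hij
      exact (hL ⟨v, h⟩).1.getElem_inj_iff.1 this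
    · simp [ofGraph, h]

theorem mem_ofGraph_colors [DecidableEq κ] {v : Fin n} {y : κ} :
    y ∈ (ofGraph G L name).colors v ↔ ∃ x ∈ L v, name x = y := by
  simp only [colors, mem_image, Finset.mem_range, ofGraph_len, ofGraph_col]
  constructor
  · rintro ⟨j, hj, rfl⟩
    rw [List.getD_eq_getElem _ _ (by simpa using hj), List.getElem_map]
    exact ⟨_, List.getElem_mem hj, rfl⟩
  · rintro ⟨x, hx, rfl⟩
    obtain ⟨j, hj, rfl⟩ := List.getElem_of_mem hx
    refine ⟨j, hj, ?_⟩
    rw [List.getD_eq_getElem _ _ (by simpa using hj), List.getElem_map]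

theorem ofGraph_colorable [DecidableEq κ] {C : Fin n → Finset U}
    (hL : ∀ v, (L v).Nodup ∧ ∀ x, x ∈ L v ↔ x ∈ C v)
    (hname : Set.InjOn name {x | ∃ v, x ∈ C v}) :
    (ofGraph G L name).Colorable ↔ IsListColorable G C := by
  constructor
  · rintro ⟨f, hf, hp⟩
    have : ∀ v : Fin n, ∃ x ∈ L v, name x = f v := fun v => mem_ofGraph_colors.1 (hf v v.2)
    choose c hc hcf using this
    refine ⟨c, fun v => ((hL v).2 _).1 (hc v), fun u v huv h => ?_⟩
    exact hp u u.2 v (mem_ofGraph_nbr_fin.2 huv) (by rw [← hcf, ← hcf, h])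
  · rintro ⟨c, hc, hp⟩
    refine ⟨fun v => if h : v < n then name (c ⟨v, h⟩) else 0, fun v hv => ?_, fun u _ v huv => ?_⟩
    · have hv : v < n := hv
      beta_reduce
      rw [dif_pos hv]
      exact (mem_ofGraph_colors (v := ⟨v, hv⟩)).2 ⟨_, ((hL _).2 _).2 (hc _), rfl⟩
    · obtain ⟨a, b, h, rfl, rfl⟩ := mem_ofGraph_nbr.1 huv
      beta_reduce
      rw [dif_pos a.2, dif_pos b.2]
      exact fun h' => hp a b h (hname ⟨_, hc _⟩ ⟨_, hc _⟩ h')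

open scoped Classical in
theorem le_card_ofGraph_low {α Δ : ℝ} (hG : IsAlphaDeltaBounded α Δ G) :
    α * n ≤ ((ofGraph G L name).low ⌊Δ⌋₊).card := by
  rw [IsAlphaDeltaBounded, Fintype.card_fin] at hG
  refine hG.trans (Nat.cast_le.2 (card_le_card_of_injOn Fin.val (fun v hv => ?_)
    (Fin.val_injective.injOn)))
  have hv := (mem_filter.1 hv).2
  refine mem_filter.2 ⟨Finset.mem_range.2 v.2, Nat.le_floor (le_trans (Nat.cast_le.2 ?_) hv)⟩
  rw [← SimpleGraph.card_neighborFinset_eq_degree]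
  have : (ofGraph G L name).nbr v ⊆ (G.neighborFinset v).image Fin.val := by
    intro u hu
    obtain ⟨a, b, h, ha, rfl⟩ := mem_ofGraph_nbr.1 hu
    rw [Fin.ext ha] at h
    exact mem_image_of_mem _ ((G.mem_neighborFinset _ _).2 h)
  exact (card_le_card this).trans card_image_le

end ListInstance

/-! ### Reading the instance off the initial memory. -/

section Input

variable {k n w : ℕ} {U : Type*} {G : SimpleGraph (Fin n)} {L : Fin n → List U}
  {name : U → BitVec w}

open ListInstance

theorem listColoringInput_reg_zero : (listColoringInput k n w G L name).reg 0 =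
    BitVec.ofNat w (ofGraph G L name).n := rfl

/-- Division with remainder by `n` recovers `u` and `v` from the address, which does not wrap around
as it is below `n * n`. -/
theorem listColoringInput_adj (hn : n * n ≤ 2 ^ w) {u v : ℕ} (hu : u < n) (hv : v < n) :
    (listColoringInput k n w G L name).mem 0 (BitVec.ofNat w (n * u + v)) =
      if v ∈ (ofGraph G L name).nbr u then 1#w else 0#w := by
  have hlt : n * u + v < 2 ^ w := by
    calc n * u + v < n * (u + 1) := by rw [mul_add]; omega
      _ ≤ n * n := Nat.mul_le_mul_left _ hu
      _ ≤ _ := hn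
  classical
  simp only [listColoringInput, if_true, BitVec.toNat_ofNat, Nat.mod_eq_of_lt hlt]
  refine if_congr ?_ rfl rfl
  rw [mem_ofGraph_nbr]
  refine exists_congr fun a => exists_congr fun b => and_congr_right fun _ => ?_
  constructor
  · intro h
    have h1 := congrArg (· / n) h
    have h2 := congrArg (· % n) h
    simp only [Nat.mul_add_div (by omega : 0 < n), Nat.mul_add_mod, Nat.div_eq_of_lt hv,
      Nat.div_eq_of_lt b.2, Nat.mod_eq_of_lt hv, Nat.mod_eq_of_lt b.2, add_zero] at h1 h2
    exact ⟨h1.symm, h2.symm⟩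
  · rintro ⟨rfl, rfl⟩; rfl

theorem listColoringInput_len (hn : n ≤ 2 ^ w) {v : ℕ} (hv : v < n) :
    (listColoringInput k n w G L name).mem 1 (BitVec.ofNat w v) =
      BitVec.ofNat w ((ofGraph G L name).len v) := by
  have hm : v % 2 ^ w = v := Nat.mod_eq_of_lt (by omega)
  simp [listColoringInput, ofGraph, hm, hv]

theorem listColoringInput_col (hn : k * n ≤ 2 ^ w) {v j : ℕ} (hv : v < n) (hj : j < k) :
    (listColoringInput k n w G L name).mem 2 (BitVec.ofNat w (k * v + j)) =
      (ofGraph G L name).col v j := by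
  have hlt : k * v + j < 2 ^ w := by
    calc k * v + j < k * (v + 1) := by rw [mul_add]; omega
      _ ≤ k * n := Nat.mul_le_mul_left _ hv
      _ ≤ _ := hn
  have h1 : (k * v + j) / k = v := by
    rw [Nat.mul_add_div (by omega), Nat.div_eq_of_lt hj, add_zero]
  have h2 : (k * v + j) % k = j := by rw [Nat.mul_add_mod, Nat.mod_eq_of_lt hj]
  simp [listColoringInput, ofGraph, Nat.mod_eq_of_lt hlt, h1, h2, hv]

end Input

/-! ### The choice of the constants. -/

theorem theorem2 (k : ℕ) (Δ α : ℝ) (hk : 0 < k) (hΔ : 0 < Δ) (hα : 0 < α) :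
    ∃ ε : ℝ, 0 < ε ∧ ε < 2 ∧ ∃ T : ℕ → ℕ,
      ((fun n => (T n : ℝ)) =O[atTop] fun n => (2 - ε) ^ n) ∧
        ListColoringSolvableInTime.{u} k α Δ T := by
  obtain ⟨d, hd⟩ : ∃ d, d = ⌊Δ⌋₊ := ⟨_, rfl⟩
  obtain ⟨ℓ, hℓ⟩ : ∃ ℓ, ℓ = -Real.log (1 - 1 / 2 ^ (d + 1)) := ⟨_, rfl⟩
  have hℓ0 : 0 < ℓ := by
    have hq1 : (1 : ℝ) < 2 ^ (d + 1) := one_lt_pow₀ (by norm_num) (by omega)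
    have h1 : (0 : ℝ) < 1 - 1 / 2 ^ (d + 1) := by
      rw [sub_pos, div_lt_one (by positivity)]; exact hq1
    have h2 : (0 : ℝ) < 1 / 2 ^ (d + 1) := by positivity
    rw [hℓ, neg_pos]
    exact Real.log_neg h1 (by linarith)
  -- `M` is so large that a heavy set of size at most n/(DM) costs no more than half of the gain
  -- from the scattered set.
  obtain ⟨M, hM0, hM⟩ : ∃ M : ℕ, 0 < M ∧ 2 * Real.log k * (d + 1) ≤ ℓ * α * M := by
    obtain ⟨M, hM⟩ := exists_nat_ge (2 * Real.log k * (d + 1) / (ℓ * α))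
    refine ⟨M + 1, by omega, ?_⟩
    rw [div_le_iff₀ (by positivity)] at hM
    push_cast
    nlinarith [mul_pos hℓ0 hα]
  -- With more than 2dM scales the averaging argument finds a good one, and `E` bounds all of them.
  obtain ⟨J, hJ⟩ : ∃ J, J = 2 * d * M + 1 := ⟨_, rfl⟩
  obtain ⟨E, hE⟩ : ∃ E, E = (d + 1) * 2 ^ J := ⟨_, rfl⟩
  have hE0 : 0 < E := by rw [hE]; positivity
  obtain ⟨β, hβ⟩ : ∃ β, β = 2 * Real.exp (Real.log (1 - 1 / 2 ^ (d + 1)) * α / (2 * (d + 1) * E)) :=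
    ⟨_, rfl⟩
  have hβ0 : 0 < β := by rw [hβ]; positivity
  have hβ2 : β < 2 := by
    have : Real.log (1 - 1 / 2 ^ (d + 1)) * α / (2 * (d + 1) * E) < 0 := by
      have hE' : (0 : ℝ) < E := by exact_mod_cast hE0
      rw [show Real.log (1 - 1 / 2 ^ (d + 1)) = -ℓ by rw [hℓ, neg_neg], neg_mul, neg_div,
        neg_lt_zero]
      positivity
    have := Real.exp_lt_one_iff.2 this
    rw [hβ]
    linarith
  obtain ⟨B, hB⟩ : ∃ B, B = 1200 + 200 * (J + 1) + 4000 * (k + 1) ^ 2 := ⟨_, rfl⟩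
  -- Then 2 - ε = 1 + β/2 lies strictly between β and 2, which leaves room for the polynomial
  -- factor.
  refine ⟨(2 - β) / 2, by linarith, by linarith, fun n => ⌊B * (n + 1 : ℝ) ^ 2 * β ^ n⌋₊,
    isBigO_floor_mul_pow hβ0.le (by linarith), WordRAM.solve k d J M,
    (d + 1) * 2 ^ J * (M + 1) + k + J + d + 3, ?_⟩
  intro n w hw U G C L name hG hC hL hname
  have hpow : n * n ≤ 2 ^ w ∧ k * n ≤ 2 ^ w ∧ n ≤ 2 ^ w := by
    have hw' : (k + 2) * (n + 1) ≤ w := le_trans (Nat.mul_le_mul_right _ (by omega)) hw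
    have h1 := @Nat.lt_two_pow_self w
    have h2 : (k + 2) * (n + 1) = k * n + k + 2 * n + 2 := by ring
    refine ⟨?_, by omega, by omega⟩
    calc n * n ≤ 2 ^ n * 2 ^ n := Nat.mul_le_mul Nat.lt_two_pow_self.le Nat.lt_two_pow_self.le
      _ = 2 ^ (n + n) := by rw [pow_add]
      _ ≤ 2 ^ w := Nat.pow_le_pow_right (by norm_num) (by omega)
  obtain ⟨hnn, hkn, hn⟩ := hpow
  have hI := ListInstance.ofGraph_valid (G := G) hC hL hname
  obtain ⟨D, A, H, hD0, hDE, hH, hlow, hF0, hF, t, τ, hr, ht, hτ⟩ :=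
    WordRAM.solve_spec (d := d) (J := J) (M := M) hI hk (by omega) hw
      (σ := listColoringInput k n w G L name) listColoringInput_reg_zero
      (fun u hu v hv => listColoringInput_adj hnn hu hv)
      (fun v hv => listColoringInput_len hn hv)
      (fun v hv j hj => listColoringInput_col hkn hv (hj.trans_le (hI.len_le v)))
  refine ⟨t, τ, hr, Nat.le_floor (le_trans (Nat.cast_le.2 ht) ?_),
    hτ.trans (ListInstance.ofGraph_colorable hL hname)⟩
  have ha : α * n ≤ A.card * ((d + 1) * D) := by
    have h := ListInstance.le_card_ofGraph_low (L := L) (name := name) hG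
    rw [← hd] at h
    exact h.trans (by exact_mod_cast hlow)
  have hbound := mul_pow_le_of_trimmed hk hα hD0 (hE ▸ hDE) hM0 (hℓ ▸ hM) hF hH ha
  rw [← hβ] at hbound
  rw [← hB]
  push_cast
  exact mul_le_mul_of_nonneg_left hbound (by positivity)
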